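/- Consider an $n\times n$ input-queued switch in discrete time with $q_{ij}(t+1)=[q_{ij}(t)+a_{ij}(t)-s_{ij}(t)]^+$, where a schedule $s(t)\in\{0,1\}^{n\times n}$ is feasible if all its row and column sums are at most $1$, and maximal if they all equal $1$. A scheduling policy picks a feasible schedule $s(t)$ in every slot, possibly at random, from the past and the current queue lengths $q(t)$, before the arrivals $a(t)$ are known. The MaxWeight policy picks, on the basis of $q(t)$ only, a maximal schedule that maximizes $\sum_{ij}q_{ij}(t)s_{ij}$ over all feasible schedules, with ties broken by an arbitrary (possibly random) rule. Let $0\le n_1,n_2<n$. For $0<\epsilon<1$ let the arrivals $a_{ij}(t)$ be independent over $i,j,t$, the arrivals of slot $t$ being independent of the past and of $s(t)$, and let $a_{ij}(t)$ be Bernoulli with mean $\lambda^{(\epsilon)}_{ij}=(1-\epsilon)/(2n)$ if $i>n_1$ and $j>n_2$, and $\lambda^{(\epsilon)}_{ij}=(1-\epsilon)/n$ otherwise. (a) Under MaxWeight, for every $\epsilon\in(0,1)$ the queue length process has a stationary law to which it converges in distribution from every initial law; let $\bar q^{(\epsilon)}$ denote a random matrix with this law. Then $$\lim_{\epsilon\downarrow0}\epsilon\,\mathbb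 E\Big[\sum_{ij}\bar q^{(\epsilon)}_{ij}\Big]=\frac{n_1+n_2}{2}\Big(1-\frac1n\Big).$$ (b) Consider any policy (which may depend on $\epsilon$) under which, for every $\epsilon\in(0,1)$, the switch is stable in the sense that the queue length process, from some initial law, converges in distribution to a (finite) random matrix $\hat q^{(\epsilon)}$. Then, with expectations in $[0,\infty]$, $$\liminf_{\epsilon\downarrow0}\epsilon\,\mathbb E\Big[\sum_{ij}\hat q^{(\epsilon)}_{ij}\Big]\ \ge\ \frac{\max\{n_1,n_2\}}{2}\Big(1-\frac1n\Big).$$ (c) Hence MaxWeight is within a factor of two of optimal in heavy traffic: for every policy as in (b), $$\limsup_{\epsilon\downarrow0}\epsilon\,\mathbb E\Big[\sum_{ij}\bar q^{(\epsilon)}_{ij}\Big]\ \le\ 2\,\liminf_{\epsilon\downarrow0}\epsilon\,\mathbb E\Big[\sum_{ij}\hat q^{(\epsilon)}_{ij}\Big].$$ -/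

import Mathlib

open Filter Topology MeasureTheory
open scoped ENNReal

namespace SwitchModel

noncomputable section

/-- Queue lengths (number of packets) of an `n × n` switch; entry `(i, j)` is the queue of packets
at input port `i` destined for output port `j`. -/
abbrev QueueMatrix (n : ℕ) : Type := Fin n → Fin n → ℕ

/-- A feasible schedule: in one slot every input and every output takes part in at most one
transfer. (The constraints force all entries into `{0, 1}`.) -/
def Schedule (n : ℕ) : Type :=
  {s : Fin n → Fin n → ℕ // (∀ i, ∑ j, s i j ≤ 1) ∧ ∀ j, ∑ i, s i j ≤ 1}

/-- A maximal schedule: every input and every output is matched. -/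
def Schedule.IsMaximal {n : ℕ} (s : Schedule n) : Prop :=
  (∀ i, ∑ j, s.1 i j = 1) ∧ ∀ j, ∑ i, s.1 i j = 1

/-- The weight `⟨q, s⟩` of a schedule at queue lengths `q`. -/
def Schedule.weight {n : ℕ} (q : QueueMatrix n) (s : Schedule n) : ℕ :=
  ∑ i, ∑ j, q i j * s.1 i j

/-- `min 1 (max 0 x)` as an extended nonnegative real; it is `x` itself when `0 ≤ x ≤ 1`. -/
def prob (x : ℝ) : ℝ≥0∞ := min 1 (ENNReal.ofReal x)

theorem sum_bernoulli_weights {n : ℕ} (lam : Fin n → Fin n → ℝ) :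
    ∑ a : Fin n → Fin n → Bool,
      ∏ i, ∏ j, (if a i j then prob (lam i j) else 1 - prob (lam i j)) = 1 := by
  have h : ∀ i : Fin n, ∑ r : Fin n → Bool,
      ∏ j, (if r j then prob (lam i j) else 1 - prob (lam i j)) = 1 := by
    intro i
    rw [← Fintype.prod_sum (fun (j : Fin n) (b : Bool) =>
      if b then prob (lam i j) else 1 - prob (lam i j))]
    refine Finset.prod_eq_one fun j _ => ?_
    simp [prob, add_tsub_cancel_of_le]
  rw [← Fintype.prod_sum (fun (i : Fin n) (r : Fin n → Bool) =>
    ∏ j, if r j then prob (lam i j) else 1 - prob (lam i j))]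
  exact Finset.prod_eq_one fun i _ => h i

/-- The arrivals of one slot: independent Bernoulli variables, the one of queue `(i, j)` having
mean `lam i j` (`true` means that one packet arrives). -/
def arrivalLaw {n : ℕ} (lam : Fin n → Fin n → ℝ) : PMF (Fin n → Fin n → Bool) :=
  PMF.ofFintype
    (fun a => ∏ i, ∏ j, (if a i j then prob (lam i j) else 1 - prob (lam i j)))
    (sum_bernoulli_weights lam)

/-- The queue evolution `q(t+1) = [q(t) + a(t) - s(t)]⁺` (truncated subtraction). -/
def nextQueue {n : ℕ} (q : QueueMatrix n) (a : Fin n → Fin n → Bool) (s : Schedule n) :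
    QueueMatrix n :=
  fun i j => q i j + (a i j).toNat - s.1 i j

/-- The past of the switch, most recent slot first: for every past slot the queue lengths at its
beginning, the schedule used, and the arrivals. -/
abbrev History (n : ℕ) : Type :=
  List (QueueMatrix n × Schedule n × (Fin n → Fin n → Bool))

/-- A scheduling policy: it picks the schedule of the current slot, possibly at random, from the
past and the current queue lengths, before the arrivals of the slot are known. -/
abbrev Policy (n : ℕ) : Type := History n → QueueMatrix n → PMF (Schedule n)

/-- One slot: the policy picks a schedule, then the arrivals are drawn independently of everything
before, then the queues are served and updated. -/
def step {n : ℕ} (P : Policy n) (lam : Fin n → Fin n → ℝ) (x : History n × QueueMatrix n) :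
    PMF (History n × QueueMatrix n) :=
  (P x.1 x.2).bind fun s =>
    (arrivalLaw lam).map fun a => ((x.2, s, a) :: x.1, nextQueue x.2 a s)

/-- Joint law of the past and the queue lengths at the beginning of slot `t`, when the initial
queue lengths have law `init`. -/
def trajectoryLaw {n : ℕ} (P : Policy n) (lam : Fin n → Fin n → ℝ) (init : PMF (QueueMatrix n)) :
    ℕ → PMF (History n × QueueMatrix n)
  | 0 => init.map fun q => ([], q)
  | t + 1 => (trajectoryLaw P lam init t).bind (step P lam)

/-- The law of the queue lengths `q(t)`. -/
def queueLaw {n : ℕ} (P : Policy n) (lam : Fin n → Fin n → ℝ) (init : PMF (QueueMatrix n))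
    (t : ℕ) : PMF (QueueMatrix n) :=
  (trajectoryLaw P lam init t).map Prod.snd

/-- A law on queue matrices as an element of Mathlib's space of probability measures, which carries
the topology of convergence in distribution. -/
def toProbabilityMeasure {n : ℕ} (p : PMF (QueueMatrix n)) : ProbabilityMeasure (QueueMatrix n) :=
  ⟨p.toMeasure, inferInstance⟩

/-- The queue length process converges in distribution to a (finite) random matrix of law `π`. -/
def ConvergesInLaw {n : ℕ} (P : Policy n) (lam : Fin n → Fin n → ℝ) (init π : PMF (QueueMatrix n)) :
    Prop :=
  Tendsto (fun t => toProbabilityMeasure (queueLaw P lam init t)) atTop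
    (𝓝 (toProbabilityMeasure π))

/-- MaxWeight: in every slot, on the basis of the current queue lengths only, a maximal schedule is
picked whose weight is largest among all feasible schedules; ties are broken by an arbitrary,
possibly random, rule (for example uniformly at random). -/
def IsMaxWeight {n : ℕ} (P : Policy n) : Prop :=
  ∃ rule : QueueMatrix n → PMF (Schedule n), (∀ h q, P h q = rule q) ∧
    ∀ q, ∀ s ∈ (rule q).support, s.IsMaximal ∧ ∀ s' : Schedule n, s'.weight q ≤ s.weight q

/-- The expected total queue length `E[∑ᵢⱼ qᵢⱼ] ∈ [0, ∞]` when `q` has law `π`. -/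
def meanTotal {n : ℕ} (π : PMF (QueueMatrix n)) : ℝ≥0∞ :=
  ∫⁻ q, ∑ i, ∑ j, (q i j : ℝ≥0∞) ∂π.toMeasure

/-- Arrival rates: `(1 - ε) / (2n)` for an unsaturated input and an unsaturated output, `(1 - ε) / n`
otherwise; the saturated ports are the first `n₁` inputs and the first `n₂` outputs. -/
def rate (n n₁ n₂ : ℕ) (ε : ℝ) (i j : Fin n) : ℝ :=
  if n₁ ≤ i.val ∧ n₂ ≤ j.val then (1 - ε) / (2 * n) else (1 - ε) / n

end

end SwitchModel

open SwitchModel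

/-
The queues of one saturated port, whatever the policy, dominate the single-server queue
`r ↦ (r + A - 1)⁺` fed by the arrivals `A` to the port, since a schedule removes at most one packet
per port and slot. Quadratic and cubic test functions bound the mean of that queue from below by
`(Var A - ε (1 - ε)) / (2 ε)`; the saturated inputs have disjoint queues, and so have the saturated
outputs.

For MaxWeight, the cone spanned by the indicators of the saturated ports attracts the queue vector:
the drift of the cube of the distance to it bounds the second moment of this distance in the steady
state uniformly in `ε` (state space collapse). Up to terms that collapse makes negligible, the
squared norm of the projection `P q` of the queue vector to the span of the same indicators changes
in the mean by its noise `1 / n * (1 - 1 / n) * (n₁ + n₂)` minus `2 ε / n` times the total queue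
length. It has no drift in the steady state, so the total queue length is known in the limit. Its
cross term with the unused service is small because unused service occurs at empty queues, where
`P q` agrees with `P q - q`.
-/

namespace SwitchModel

noncomputable section

section Mean

variable {X Y : Type*}

/-- The expectation of an extended nonnegative function under a discrete law. It is written as a
sum, so that no measurability enters. -/
def mean (p : PMF X) (f : X → ℝ≥0∞) : ℝ≥0∞ := ∑' x, p x * f x

lemma mean_pure (x : X) (f : X → ℝ≥0∞) : mean (PMF.pure x) f = f x := by
  classical
  rw [mean, tsum_eq_single x fun y hy => by simp [hy]]
  simp

lemma mean_bind (p : PMF X) (K : X → PMF Y) (f : Y → ℝ≥0∞) :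
    mean (p.bind K) f = mean p fun x => mean (K x) f := by
  simp only [mean, PMF.bind_apply, ← ENNReal.tsum_mul_left, ← ENNReal.tsum_mul_right]
  rw [ENNReal.tsum_comm]
  simp only [mul_assoc]

lemma mean_map (p : PMF X) (g : X → Y) (f : Y → ℝ≥0∞) :
    mean (p.map g) f = mean p fun x => f (g x) := by
  rw [← PMF.bind_pure_comp, mean_bind]
  simp only [Function.comp_apply, mean_pure]

lemma mean_const (p : PMF X) (c : ℝ≥0∞) : mean p (fun _ => c) = c := by
  simp [mean, ENNReal.tsum_mul_right]

lemma mean_add (p : PMF X) (f g : X → ℝ≥0∞) :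
    mean p (fun x => f x + g x) = mean p f + mean p g := by
  simp only [mean, mul_add, ENNReal.tsum_add]

lemma mean_const_mul (p : PMF X) (c : ℝ≥0∞) (f : X → ℝ≥0∞) :
    mean p (fun x => c * f x) = c * mean p f := by
  simp only [mean, ← ENNReal.tsum_mul_left, mul_left_comm]

lemma mean_finsetSum {ι : Type*} (p : PMF X) (s : Finset ι) (f : ι → X → ℝ≥0∞) :
    mean p (fun x => ∑ i ∈ s, f i x) = ∑ i ∈ s, mean p (f i) := by
  simp only [mean, Finset.mul_sum]
  exact Summable.tsum_finsetSum fun _ _ => ENNReal.summable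

lemma mean_mono_of_support {p : PMF X} {f g : X → ℝ≥0∞} (h : ∀ x ∈ p.support, f x ≤ g x) :
    mean p f ≤ mean p g := by
  refine ENNReal.tsum_le_tsum fun x => ?_
  by_cases hx : p x = 0
  · simp [hx]
  · gcongr
    exact h x ((p.mem_support_iff x).2 hx)

lemma mean_mono {p : PMF X} {f g : X → ℝ≥0∞} (h : ∀ x, f x ≤ g x) : mean p f ≤ mean p g :=
  mean_mono_of_support fun x _ => h x

lemma mean_le_const {p : PMF X} {f : X → ℝ≥0∞} {c : ℝ≥0∞} (h : ∀ x, f x ≤ c) : mean p f ≤ c :=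
  (mean_mono h).trans_eq (mean_const p c)

lemma lintegral_toMeasure_eq_mean [MeasurableSpace X] [MeasurableSingletonClass X] [Countable X]
    (p : PMF X) (f : X → ℝ≥0∞) : ∫⁻ x, f x ∂p.toMeasure = mean p f := by
  rw [lintegral_countable']
  refine tsum_congr fun x => ?_
  rw [PMF.toMeasure_apply_singleton p x (measurableSet_singleton x), mul_comm]

lemma tendsto_mean_of_dominated (p : PMF X) {f : ℕ → X → ℝ≥0∞} {g bound : X → ℝ≥0∞}
    (hbound : mean p bound ≠ ∞) (hle : ∀ t x, f t x ≤ bound x)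
    (hlim : ∀ x, Tendsto (fun t => f t x) atTop (𝓝 (g x))) :
    Tendsto (fun t => mean p (f t)) atTop (𝓝 (mean p g)) := by
  let _ : MeasurableSpace X := ⊤
  have mean_eq (h : X → ℝ≥0∞) : mean p h = ∫⁻ x, p x * h x ∂Measure.count :=
    (lintegral_count _).symm
  simp only [mean_eq] at hbound ⊢
  exact tendsto_lintegral_of_dominated_convergence (fun x => p x * bound x)
    (fun t => measurable_from_top)
    (fun t => Eventually.of_forall fun x => mul_le_mul_right (hle t x) (p x)) hbound
    (Eventually.of_forall fun x =>
      ENNReal.Tendsto.const_mul (hlim x) (Or.inr (p.apply_ne_top x)))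

lemma mean_le_of_mean_min_le {p : PMF X} {f : X → ℝ≥0∞} {c : ℝ≥0∞}
    (h : ∀ m : ℕ, mean p (fun x => min (f x) m) ≤ c) : mean p f ≤ c := by
  rw [mean, ENNReal.tsum_eq_iSup_sum]
  refine iSup_le fun F => ?_
  have hlim : Tendsto (fun m : ℕ => ∑ x ∈ F, p x * min (f x) m) atTop
      (𝓝 (∑ x ∈ F, p x * f x)) := by
    refine tendsto_finsetSum F fun x _ =>
      ENNReal.Tendsto.const_mul ?_ (Or.inr (p.apply_ne_top x))
    simpa using tendsto_const_nhds.min ENNReal.tendsto_nat_nhds_top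
  exact le_of_tendsto' hlim fun m => (ENNReal.sum_le_tsum F).trans (h m)

lemma eq_of_forall_apply_le {p q : PMF X} (h : ∀ x, p x ≤ q x) : p = q := by
  by_contra hne
  obtain ⟨x, hx⟩ : ∃ x, p x ≠ q x := not_forall.1 (mt PMF.ext hne)
  have hlt := ENNReal.tsum_lt_tsum (by simp [p.tsum_coe]) h ((h x).lt_of_ne hx)
  simp [p.tsum_coe, q.tsum_coe] at hlt

section PointwiseLimit

variable {ι : Type*} {l : Filter ι} {p : ι → PMF X}

lemma tsum_mul_le_of_tendsto [l.NeBot] {p₀ f : X → ℝ≥0∞} {B : ι → ℝ≥0∞} {C : ℝ≥0∞}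
    (hp : ∀ x, Tendsto (fun i => p i x) l (𝓝 (p₀ x))) (hf : ∀ x, f x ≠ ∞)
    (hB : ∀ i, mean (p i) f ≤ B i) (hC : Tendsto B l (𝓝 C)) :
    ∑' x, p₀ x * f x ≤ C := by
  rw [ENNReal.tsum_eq_iSup_sum]
  refine iSup_le fun F => le_of_tendsto_of_tendsto' ?_ hC
    fun i => (ENNReal.sum_le_tsum F).trans (hB i)
  exact tendsto_finsetSum F fun x _ => ENNReal.Tendsto.mul_const (hp x) (Or.inr (hf x))

lemma one_le_sum_add_inv_mul_mean {p : PMF X} {f : X → ℝ≥0∞} {r : ℝ≥0∞} (hr : r ≠ 0)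
    (hr' : r ≠ ∞) {F : Finset X} (hF : ∀ x, f x ≤ r → x ∈ F) :
    1 ≤ ∑ x ∈ F, p x + r⁻¹ * mean p f := by
  classical
  calc 1 = mean p fun _ => 1 := (mean_const p 1).symm
    _ ≤ mean p fun x => (if x ∈ F then 1 else 0) + r⁻¹ * f x := by
        refine mean_mono fun x => ?_
        by_cases hx : x ∈ F
        · simp [hx]
        · have hfx : r ≤ f x := (not_le.1 (mt (hF x) hx)).le
          simpa [hx, ENNReal.inv_mul_cancel hr hr'] using mul_le_mul_right hfx r⁻¹
    _ = ∑ x ∈ F, p x + r⁻¹ * mean p f := by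
        simp only [mean_add, mean_const_mul]
        rw [mean, tsum_eq_sum (s := F) fun x hx => by simp [hx]]
        exact congrArg (· + _) (Finset.sum_congr rfl fun x hx => by simp [hx])

theorem exists_tendsto_of_tight {u : Ultrafilter ι} {f : X → ℝ≥0∞} {C : ℝ≥0∞} (hC : C ≠ ∞)
    (hfin : ∀ r : ℕ, {x | f x ≤ r}.Finite) (hp : ∀ i, mean (p i) f ≤ C) :
    ∃ π : PMF X, ∀ x, Tendsto (fun i => p i x) u (𝓝 (π x)) := by
  obtain ⟨p₀, hp₀⟩ : ∃ p₀ : X → ℝ≥0∞, Tendsto (fun i x => p i x) u (𝓝 p₀) :=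
    ⟨_, (u.map fun i x => p i x).le_nhds_lim⟩
  have hpx (x) : Tendsto (fun i => p i x) u (𝓝 (p₀ x)) := tendsto_pi_nhds.1 hp₀ x
  have hle : ∑' x, p₀ x ≤ 1 := by
    simpa using tsum_mul_le_of_tendsto (f := fun _ => 1) hpx (by simp)
      (fun i => (mean_const (p i) 1).le) tendsto_const_nhds
  have hge (r : ℕ) : 1 ≤ ∑' x, p₀ x + ((r + 1 : ℕ) : ℝ≥0∞)⁻¹ * C := by
    let F := (hfin (r + 1)).toFinset
    have hF (i) : 1 ≤ ∑ x ∈ F, p i x + ((r + 1 : ℕ) : ℝ≥0∞)⁻¹ * C :=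
      (one_le_sum_add_inv_mul_mean (Nat.cast_ne_zero.2 r.succ_ne_zero)
        (ENNReal.natCast_ne_top (r + 1)) fun x hx => (hfin (r + 1)).mem_toFinset.2 hx).trans
        (by gcongr; exact hp i)
    refine (ge_of_tendsto' ((tendsto_finsetSum F fun x _ => hpx x).add_const _) hF).trans ?_
    gcongr
    exact ENNReal.sum_le_tsum F
  have hlim : Tendsto (fun r : ℕ => ∑' x, p₀ x + ((r + 1 : ℕ) : ℝ≥0∞)⁻¹ * C) atTop
      (𝓝 (∑' x, p₀ x)) := by
    simpa using (ENNReal.Tendsto.mul_const (ENNReal.tendsto_inv_nat_nhds_zero.comp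
      (tendsto_add_atTop_nat 1)) (Or.inr hC)).const_add (∑' x, p₀ x)
  exact ⟨⟨p₀, le_antisymm hle (ge_of_tendsto' hlim hge) ▸ ENNReal.summable.hasSum⟩, hpx⟩

end PointwiseLimit

end Mean

section Chain

variable {X : Type*} (K : X → PMF X)

/-- The law after `t` steps of the Markov chain with transition law `K`, started at `x`. -/
def kernelPow : ℕ → X → PMF X
  | 0, x => PMF.pure x
  | t + 1, x => (K x).bind (kernelPow t)

lemma kernelPow_bind (t : ℕ) (x : X) : (kernelPow K t x).bind K = kernelPow K (t + 1) x := by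
  induction t generalizing x with
  | zero => simp only [kernelPow, PMF.pure_bind, PMF.bind_pure]
  | succ t ih =>
    rw [kernelPow, PMF.bind_bind, kernelPow]
    simp only [ih]

lemma bind_kernelPow_of_invariant {π : PMF X} (h : π.bind K = π) (t : ℕ) :
    π.bind (kernelPow K t) = π := by
  induction t with
  | zero => exact PMF.bind_pure π
  | succ t ih =>
    change π.bind (fun x => (K x).bind (kernelPow K t)) = π
    rw [← PMF.bind_bind, h, ih]

lemma sum_mean_kernelPow_le {V f : X → ℝ≥0∞} {b : ℝ≥0∞}
    (h : ∀ x, mean (K x) V + f x ≤ V x + b) (T : ℕ) (x : X) :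
    ∑ t ∈ Finset.range T, mean (kernelPow K t x) f ≤ V x + T * b := by
  suffices H : mean (kernelPow K T x) V + ∑ t ∈ Finset.range T, mean (kernelPow K t x) f
      ≤ V x + T * b from le_add_self.trans H
  induction T with
  | zero => simp [kernelPow, mean_pure]
  | succ T ih =>
    have hstep : mean (kernelPow K (T + 1) x) V + mean (kernelPow K T x) f
        ≤ mean (kernelPow K T x) V + b := by
      rw [← kernelPow_bind, mean_bind, ← mean_add]
      exact (mean_mono h).trans_eq (by rw [mean_add, mean_const])
    calc _ = mean (kernelPow K (T + 1) x) V + mean (kernelPow K T x) f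
          + ∑ t ∈ Finset.range T, mean (kernelPow K t x) f := by
            rw [Finset.sum_range_succ]; ring
      _ ≤ mean (kernelPow K T x) V + b + ∑ t ∈ Finset.range T, mean (kernelPow K t x) f := by
            gcongr
      _ = (mean (kernelPow K T x) V + ∑ t ∈ Finset.range T, mean (kernelPow K t x) f) + b := by
            ring
      _ ≤ V x + T * b + b := by gcongr
      _ = _ := by push_cast; ring

/-- The average of the laws of the first `T + 1` states of the chain started at `x`. -/
def cesaro (T : ℕ) (x : X) : PMF X :=
  (PMF.uniformOfFintype (Fin (T + 1))).bind fun t => kernelPow K t x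

lemma mean_cesaro (T : ℕ) (x : X) (f : X → ℝ≥0∞) :
    mean (cesaro K T x) f
      = ((T + 1 : ℕ) : ℝ≥0∞)⁻¹ * ∑ t ∈ Finset.range (T + 1), mean (kernelPow K t x) f := by
  rw [cesaro, mean_bind, mean, tsum_fintype, Finset.mul_sum,
    Finset.sum_range fun t => ((T + 1 : ℕ) : ℝ≥0∞)⁻¹ * mean (kernelPow K t x) f]
  simp only [PMF.uniformOfFintype_apply, Fintype.card_fin]

lemma cesaro_apply (T : ℕ) (x y : X) :
    cesaro K T x y
      = ((T + 1 : ℕ) : ℝ≥0∞)⁻¹ * ∑ t ∈ Finset.range (T + 1), kernelPow K t x y := by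
  rw [cesaro, PMF.bind_apply, tsum_fintype, Finset.mul_sum,
    Finset.sum_range fun t => ((T + 1 : ℕ) : ℝ≥0∞)⁻¹ * kernelPow K t x y]
  simp only [PMF.uniformOfFintype_apply, Fintype.card_fin]

lemma mean_cesaro_le {V f : X → ℝ≥0∞} {b : ℝ≥0∞} (h : ∀ x, mean (K x) V + f x ≤ V x + b)
    (T : ℕ) (x : X) : mean (cesaro K T x) f ≤ ((T + 1 : ℕ) : ℝ≥0∞)⁻¹ * V x + b := by
  rw [mean_cesaro]
  refine (mul_le_mul_right (sum_mean_kernelPow_le K h (T + 1) x) _).trans_eq ?_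
  rw [mul_add, ← mul_assoc, ENNReal.inv_mul_cancel (by simp) (ENNReal.natCast_ne_top _), one_mul]

lemma bind_cesaro_of_invariant {π : PMF X} (h : π.bind K = π) (T : ℕ) :
    π.bind (cesaro K T) = π := by
  change π.bind (fun x => (PMF.uniformOfFintype (Fin (T + 1))).bind fun t => kernelPow K t x) = π
  rw [PMF.bind_comm]
  simp only [bind_kernelPow_of_invariant K h, PMF.bind_const]

lemma cesaro_bind_apply_le (T : ℕ) (x y : X) :
    (cesaro K T x).bind K y ≤ cesaro K T x y + ((T + 1 : ℕ) : ℝ≥0∞)⁻¹ := by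
  have hstep (t : ℕ) : mean (kernelPow K t x) (fun z => K z y) = kernelPow K (t + 1) x y := by
    rw [← kernelPow_bind, PMF.bind_apply, mean]
  rw [PMF.bind_apply, ← mean, mean_cesaro, cesaro_apply]
  simp only [hstep]
  calc _ ≤ ((T + 1 : ℕ) : ℝ≥0∞)⁻¹ * (∑ t ∈ Finset.range (T + 1), kernelPow K t x y + 1) := by
        rw [Finset.sum_range_succ, Finset.sum_range_succ']
        gcongr
        · exact le_self_add
        · exact PMF.coe_le_one _ _
    _ = _ := by rw [mul_add, mul_one]

lemma tendsto_inv_succ_mul {c : ℝ≥0∞} (hc : c ≠ ∞) :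
    Tendsto (fun T : ℕ => ((T + 1 : ℕ) : ℝ≥0∞)⁻¹ * c) atTop (𝓝 0) := by
  simpa using ENNReal.Tendsto.mul_const
    (ENNReal.tendsto_inv_nat_nhds_zero.comp (tendsto_add_atTop_nat 1)) (Or.inr hc)

theorem exists_invariant_of_drift {V f : X → ℝ≥0∞} {b : ℝ≥0∞} (hb : b ≠ ∞) {x₀ : X}
    (hV : V x₀ ≠ ∞) (h : ∀ x, mean (K x) V + f x ≤ V x + b)
    (hfin : ∀ r : ℕ, {x | f x ≤ r}.Finite) : ∃ π : PMF X, π.bind K = π := by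
  have hbdd (T : ℕ) : mean (cesaro K T x₀) f ≤ V x₀ + b := by
    refine (mean_cesaro_le K h T x₀).trans ?_
    gcongr
    exact mul_le_of_le_one_left' (ENNReal.inv_le_one.2 (by simp))
  obtain ⟨π, hπ⟩ := exists_tendsto_of_tight (u := hyperfilter ℕ)
    (ENNReal.add_ne_top.2 ⟨hV, hb⟩) hfin hbdd
  have hinv (y : X) :
      Tendsto (fun T : ℕ => cesaro K T x₀ y + ((T + 1 : ℕ) : ℝ≥0∞)⁻¹) (hyperfilter ℕ)
        (𝓝 (π y)) := by
    have hsmall := (tendsto_inv_succ_mul ENNReal.one_ne_top).mono_left Nat.hyperfilter_le_atTop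
    simpa using (hπ y).add hsmall
  refine ⟨π, eq_of_forall_apply_le fun y => ?_⟩
  rw [PMF.bind_apply]
  exact tsum_mul_le_of_tendsto hπ (fun x => (K x).apply_ne_top y)
    (fun T => cesaro_bind_apply_le K T x₀ y) (hinv y)

/-- Truncating `f` makes the time average converge boundedly, so `V` need not be `π`-integrable. -/
theorem mean_le_of_drift_of_invariant {π : PMF X} (hπ : π.bind K = π) {V f : X → ℝ≥0∞}
    {b : ℝ≥0∞} (hV : ∀ x, V x ≠ ∞) (h : ∀ x, mean (K x) V + f x ≤ V x + b) :
    mean π f ≤ b := by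
  refine mean_le_of_mean_min_le fun m => ?_
  have hle (T : ℕ) : mean π (fun x => min (f x) m)
      ≤ mean π fun x => min (((T + 1 : ℕ) : ℝ≥0∞)⁻¹ * V x + b) m := by
    calc mean π (fun x => min (f x) m)
        = mean π fun x => mean (cesaro K T x) fun y => min (f y) m := by
          rw [← mean_bind, bind_cesaro_of_invariant K hπ]
      _ ≤ _ := mean_mono fun x => le_min
          ((mean_mono fun y => min_le_left _ _).trans (mean_cesaro_le K h T x))
          (mean_le_const fun y => min_le_right _ _)
  have hlim : Tendsto (fun T : ℕ => mean π fun x => min (((T + 1 : ℕ) : ℝ≥0∞)⁻¹ * V x + b) m)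
      atTop (𝓝 (mean π fun _ => min b m)) := by
    refine tendsto_mean_of_dominated π (bound := fun _ => m) (by simp [mean_const])
      (fun T x => min_le_right _ _) fun x => ?_
    simpa using ((tendsto_inv_succ_mul (hV x)).add_const b).min tendsto_const_nhds
  rw [mean_const] at hlim
  exact (ge_of_tendsto' hlim hle).trans (min_le_left _ _)

open Classical in
/-- The probability that the chain started at `x` has not visited `A` by time `t`. -/
def avoidProb (A : Set X) : ℕ → X → ℝ≥0∞
  | 0, x => if x ∈ A then 0 else 1
  | t + 1, x => if x ∈ A then 0 else mean (K x) (avoidProb A t)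

section AvoidProb

variable {A : Set X}

lemma avoidProb_of_mem {x : X} (hx : x ∈ A) (t : ℕ) : avoidProb K A t x = 0 := by
  cases t <;> simp [avoidProb, hx]

lemma avoidProb_succ_of_notMem {x : X} (hx : x ∉ A) (t : ℕ) :
    avoidProb K A (t + 1) x = mean (K x) (avoidProb K A t) := by
  simp only [avoidProb, hx, if_false]

lemma avoidProb_zero_of_notMem {x : X} (hx : x ∉ A) : avoidProb K A 0 x = 1 := by
  simp only [avoidProb, hx, if_false]

lemma avoidProb_le_one (t : ℕ) (x : X) : avoidProb K A t x ≤ 1 := by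
  by_cases hx : x ∈ A
  · simp [avoidProb_of_mem K hx]
  induction t generalizing x with
  | zero => exact (avoidProb_zero_of_notMem K hx).le
  | succ t ih =>
    rw [avoidProb_succ_of_notMem K hx]
    refine mean_le_const fun y => ?_
    by_cases hy : y ∈ A
    · simp [avoidProb_of_mem K hy]
    · exact ih y hy

lemma avoidProb_antitone (x : X) : Antitone fun t => avoidProb K A t x := by
  refine antitone_nat_of_succ_le fun t => ?_
  by_cases hx : x ∈ A
  · simp [avoidProb_of_mem K hx]
  induction t generalizing x with
  | zero => exact (avoidProb_le_one K _ x).trans (avoidProb_zero_of_notMem K hx).ge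
  | succ t ih =>
    rw [avoidProb_succ_of_notMem K hx, avoidProb_succ_of_notMem K hx]
    refine mean_mono fun y => ?_
    by_cases hy : y ∈ A
    · simp [avoidProb_of_mem K hy]
    · exact ih y hy

lemma sum_avoidProb_le {W : X → ℝ≥0∞} (hW : ∀ x ∉ A, mean (K x) W + 1 ≤ W x) (T : ℕ) (x : X) :
    ∑ t ∈ Finset.range T, avoidProb K A t x ≤ W x := by
  induction T generalizing x with
  | zero => simp
  | succ T ih =>
    by_cases hx : x ∈ A
    · simp [avoidProb_of_mem K hx]
    · calc ∑ t ∈ Finset.range (T + 1), avoidProb K A t x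
          = mean (K x) (fun y => ∑ t ∈ Finset.range T, avoidProb K A t y) + 1 := by
            rw [Finset.sum_range_succ', mean_finsetSum]
            simp only [avoidProb_succ_of_notMem K hx, avoidProb_zero_of_notMem K hx]
        _ ≤ mean (K x) W + 1 := by gcongr; exact mean_mono ih
        _ ≤ W x := hW x hx

theorem tendsto_avoidProb {W : X → ℝ≥0∞} (hW : ∀ x ∉ A, mean (K x) W + 1 ≤ W x)
    (hW' : ∀ x, W x ≠ ∞) (x : X) : Tendsto (fun t => avoidProb K A t x) atTop (𝓝 0) := by
  have hle (t : ℕ) : avoidProb K A t x ≤ ((t + 1 : ℕ) : ℝ≥0∞)⁻¹ * W x := by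
    rw [mul_comm, ← div_eq_mul_inv,
      ENNReal.le_div_iff_mul_le (Or.inl (by simp)) (Or.inl (ENNReal.natCast_ne_top _))]
    calc avoidProb K A t x * (t + 1 : ℕ)
        = ∑ _s ∈ Finset.range (t + 1), avoidProb K A t x := by simp [mul_comm]
      _ ≤ ∑ s ∈ Finset.range (t + 1), avoidProb K A s x :=
          Finset.sum_le_sum fun s hs =>
            avoidProb_antitone K x (Nat.lt_succ_iff.1 (Finset.mem_range.1 hs))
      _ ≤ W x := sum_avoidProb_le K hW (t + 1) x
  exact tendsto_of_tendsto_of_tendsto_of_le_of_le tendsto_const_nhds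
    (tendsto_inv_succ_mul (hW' x)) (fun _ => zero_le) hle

lemma exists_levelWeight {σ D : ℝ≥0∞} (hσ : σ ≠ 0) (hσ' : σ ≠ ∞) (hD : D ≠ ∞) (R : ℕ) :
    ∃ w : ℕ → ℝ≥0∞, Antitone w ∧ (∀ k, w k ≠ ∞) ∧ (∀ k, R ≤ k → w k = 0) ∧
      ∀ k < R, w (k + 1) + D = σ * w k := by
  refine ⟨fun k => ∑ i ∈ Finset.range (R - k), D / σ ^ (i + 1), fun j k hjk => ?_, fun k => ?_,
    fun k hk => ?_, fun k hk => ?_⟩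
  · exact Finset.sum_le_sum_of_subset (Finset.range_mono (by omega))
  · exact ENNReal.sum_ne_top.2 fun i _ => ENNReal.div_ne_top hD (pow_ne_zero _ hσ)
  · simp [Nat.sub_eq_zero_of_le hk]
  · have hσmul (i : ℕ) : σ * (D / σ ^ (i + 1)) = D / σ ^ i := by
      rw [pow_succ', div_eq_mul_inv, div_eq_mul_inv,
        ENNReal.mul_inv (Or.inl hσ) (Or.inl hσ'), mul_left_comm, ← mul_assoc σ,
        ENNReal.mul_inv_cancel hσ hσ', one_mul]
    simp only [Finset.mul_sum, hσmul]
    rw [show R - k = R - (k + 1) + 1 by omega, Finset.sum_range_succ']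
    simp

lemma mul_le_mean_comp_of_antitone {p : PMF X} {w : ℕ → ℝ≥0∞} (hw : Antitone w) {ℓ : X → ℕ}
    {k : ℕ} {σ : ℝ≥0∞} (h : σ ≤ mean p fun y => if ℓ y ≤ k then 1 else 0) :
    σ * w k ≤ mean p fun y => w (ℓ y) := by
  calc σ * w k ≤ w k * mean p fun y => if ℓ y ≤ k then 1 else 0 := by rw [mul_comm]; gcongr
    _ ≤ _ := by
        rw [← mean_const_mul]
        refine mean_mono fun y => ?_
        split_ifs with hy
        · simpa using hw hy
        · simp

/-- `W = V + w 0 - w ∘ ℓ` decreases: above level `R` because of the drift of `V`, below because the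
weights `w` make each possible drop of the level worth more than the constant of the drift. -/
theorem tendsto_avoidProb_of_drift {V f : X → ℝ≥0∞} {b σ : ℝ≥0∞} {ℓ : X → ℕ} {R : ℕ}
    (hb : b ≠ ∞) (hV : ∀ x, V x ≠ ∞) (h : ∀ x, mean (K x) V + f x ≤ V x + b)
    (hR : ∀ x, ℓ x ≤ R ∨ b + 1 ≤ f x) (hσ : σ ≠ 0)
    (hdown : ∀ x, σ ≤ mean (K x) fun y => if ℓ y ≤ ℓ x - 1 then 1 else 0)
    (hA : ∀ x, ℓ x = 0 → x ∈ A) (x : X) :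
    Tendsto (fun t => avoidProb K A t x) atTop (𝓝 0) := by
  have hσ' : σ ≠ ∞ := ne_top_of_le_ne_top ENNReal.one_ne_top
    ((hdown x).trans (mean_le_const fun y => by split_ifs <;> simp))
  obtain ⟨w, hanti, hfin, hzero, hrec⟩ :=
    exists_levelWeight hσ hσ' (ENNReal.add_ne_top.2 ⟨hb, ENNReal.one_ne_top⟩) R
  have hsum (k : ℕ) : w 0 - w k + w k = w 0 := tsub_add_cancel_of_le (hanti (Nat.zero_le k))
  refine tendsto_avoidProb K (W := fun x => V x + (w 0 - w (ℓ x))) (fun x hx => ?_)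
    (fun x => ENNReal.add_ne_top.2 ⟨hV x, ENNReal.sub_ne_top (hfin 0)⟩) x
  rw [mean_add]
  set m := mean (K x) fun y => w 0 - w (ℓ y)
  rcases le_or_gt (ℓ x) R with hlow | hhigh
  · obtain ⟨k, hk⟩ : ∃ k, ℓ x = k + 1 := Nat.exists_eq_succ_of_ne_zero (mt (hA x) hx)
    have hdrop : σ * w k ≤ mean (K x) fun y => w (ℓ y) :=
      mul_le_mean_comp_of_antitone hanti (by simpa [hk] using hdown x)
    have hlevel : m + (b + 1) ≤ w 0 - w (ℓ x) := by
      refine (ENNReal.add_le_add_iff_right (hfin (ℓ x))).1 ?_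
      calc m + (b + 1) + w (ℓ x) = m + σ * w k := by rw [hk, ← hrec k (by omega)]; ring
        _ ≤ m + mean (K x) fun y => w (ℓ y) := by gcongr
        _ = w 0 - w (ℓ x) + w (ℓ x) := by rw [← mean_add]; simp only [hsum, mean_const]
    calc mean (K x) V + m + 1 ≤ V x + b + m + 1 := by
          gcongr
          exact le_self_add.trans (h x)
      _ = V x + (m + (b + 1)) := by ring
      _ ≤ _ := by gcongr
  · have hdrift : mean (K x) V + 1 ≤ V x := by
      refine (ENNReal.add_le_add_iff_right hb).1 (le_trans ?_ (h x))
      rw [add_assoc, add_comm 1 b]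
      gcongr
      exact (hR x).resolve_left (by omega)
    have hlevel : m ≤ w 0 - w (ℓ x) := by
      rw [hzero (ℓ x) hhigh.le, tsub_zero]
      exact mean_le_const fun y => tsub_le_self
    calc mean (K x) V + m + 1 = mean (K x) V + 1 + m := by ring
      _ ≤ _ := add_le_add hdrift hlevel

end AvoidProb

/-- One step of two independent copies of the chain. -/
def pairKernel (z : X × X) : PMF (X × X) := (K z.1).bind fun x => (K z.2).map (Prod.mk x)

lemma mean_pairKernel (z : X × X) (f : X × X → ℝ≥0∞) :
    mean (pairKernel K z) f = mean (K z.1) fun x => mean (K z.2) fun y => f (x, y) := by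
  simp only [pairKernel, mean_bind, mean_map]

lemma mean_kernelPow_le_add_avoidProb {f : X → ℝ≥0∞} (hf : ∀ x, f x ≤ 1) (t : ℕ) (x y : X) :
    mean (kernelPow K t x) f
      ≤ mean (kernelPow K t y) f + avoidProb (pairKernel K) (Set.diagonal X) t (x, y) := by
  by_cases hxy : (x, y) ∈ Set.diagonal X
  · obtain rfl : x = y := hxy
    exact le_self_add
  induction t generalizing x y with
  | zero =>
    rw [avoidProb_zero_of_notMem _ hxy]
    exact (mean_le_const hf).trans le_add_self
  | succ t ih =>
    rw [avoidProb_succ_of_notMem _ hxy, mean_pairKernel, kernelPow, kernelPow, mean_bind, mean_bind]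
    calc mean (K x) (fun x' => mean (kernelPow K t x') f)
        = mean (K x) fun x' => mean (K y) fun _ => mean (kernelPow K t x') f := by
          simp only [mean_const]
      _ ≤ mean (K x) fun x' => mean (K y) fun y' => mean (kernelPow K t y') f
            + avoidProb (pairKernel K) (Set.diagonal X) t (x', y') := by
          refine mean_mono fun x' => mean_mono fun y' => ?_
          by_cases hxy' : (x', y') ∈ Set.diagonal X
          · obtain rfl : x' = y' := hxy'
            exact le_self_add
          · exact ih x' y' hxy'
      _ = _ := by simp only [mean_add, mean_const]

theorem mean_le_liminf_of_tendsto_avoidProb {π : PMF X} (hπ : π.bind K = π)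
    (hmeet : ∀ z, Tendsto (fun t => avoidProb (pairKernel K) (Set.diagonal X) t z) atTop (𝓝 0))
    (ν : PMF X) {f : X → ℝ≥0∞} (hf : ∀ x, f x ≤ 1) :
    mean π f ≤ liminf (fun t => mean (ν.bind (kernelPow K t)) f) atTop := by
  let e (t : ℕ) : ℝ≥0∞ := mean π fun x => mean ν fun y =>
    avoidProb (pairKernel K) (Set.diagonal X) t (x, y)
  have he : Tendsto e atTop (𝓝 0) := by
    simpa [mean_const] using tendsto_mean_of_dominated π (bound := fun _ => 1) (g := fun _ => 0)
      (by simp [mean_const]) (fun t x => mean_le_const fun y => avoidProb_le_one _ t (x, y))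
      fun x => by
        simpa [mean_const] using tendsto_mean_of_dominated ν (bound := fun _ => 1)
          (g := fun _ => 0) (by simp [mean_const]) (fun t y => avoidProb_le_one _ t (x, y))
          fun y => hmeet (x, y)
  have hle (t : ℕ) : mean π f ≤ mean (ν.bind (kernelPow K t)) f + e t := by
    calc mean π f = mean π fun x => mean ν fun _ => mean (kernelPow K t x) f := by
          simp only [mean_const]
          rw [← mean_bind, bind_kernelPow_of_invariant K hπ]
      _ ≤ mean π fun x => mean ν fun y => mean (kernelPow K t y) f
            + avoidProb (pairKernel K) (Set.diagonal X) t (x, y) :=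
          mean_mono fun x => mean_mono fun y => mean_kernelPow_le_add_avoidProb K hf t x y
      _ = _ := by simp only [mean_add, mean_const, mean_bind, e]
  have hne : mean π f ≠ ∞ := ne_top_of_le_ne_top ENNReal.one_ne_top (mean_le_const hf)
  have hsub : Tendsto (fun t => mean π f - e t) atTop (𝓝 (mean π f)) := by
    simpa using ENNReal.Tendsto.sub (tendsto_const_nhds (x := mean π f)) he (Or.inl hne)
  rw [← hsub.liminf_eq]
  exact liminf_le_liminf (Eventually.of_forall fun t => tsub_le_iff_right.2 (hle t))

lemma tendsto_avoidProb_pairKernel_of_drift {V f : X → ℝ≥0∞} {b ρ : ℝ≥0∞} {ℓ : X → ℕ} {R : ℕ}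
    (hb : b ≠ ∞) (hV : ∀ x, V x ≠ ∞) (h : ∀ x, mean (K x) V + f x ≤ V x + b)
    (hR : ∀ x, ℓ x ≤ R ∨ 2 * b + 1 ≤ f x) (hρ : ρ ≠ 0)
    (hdown : ∀ x, ρ ≤ mean (K x) fun y => if ℓ y ≤ ℓ x - 1 then 1 else 0)
    (hzero : ∀ x y, ℓ x = 0 → ℓ y = 0 → x = y) (z : X × X) :
    Tendsto (fun t => avoidProb (pairKernel K) (Set.diagonal X) t z) atTop (𝓝 0) := by
  refine tendsto_avoidProb_of_drift (pairKernel K) (V := fun z => V z.1 + V z.2)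
    (f := fun z => f z.1 + f z.2) (b := 2 * b) (σ := ρ * ρ) (ℓ := fun z => max (ℓ z.1) (ℓ z.2))
    (R := R) (ENNReal.mul_ne_top (by simp) hb)
    (fun z => ENNReal.add_ne_top.2 ⟨hV _, hV _⟩) (fun z => ?_) (fun z => ?_)
    (mul_ne_zero hρ hρ) (fun z => ?_) (fun z hz => ?_) z
  · calc _ = (mean (K z.1) V + f z.1) + (mean (K z.2) V + f z.2) := by
          simp only [mean_pairKernel, mean_add, mean_const]; ring
      _ ≤ (V z.1 + b) + (V z.2 + b) := add_le_add (h _) (h _)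
      _ = _ := by ring
  · rcases hR z.1 with h1 | h1
    · rcases hR z.2 with h2 | h2
      · exact Or.inl (max_le h1 h2)
      · exact Or.inr (h2.trans le_add_self)
    · exact Or.inr (h1.trans le_self_add)
  · rw [mean_pairKernel]
    calc ρ * ρ ≤ mean (K z.1) fun x => (if ℓ x ≤ ℓ z.1 - 1 then 1 else 0) *
            mean (K z.2) fun y => if ℓ y ≤ ℓ z.2 - 1 then 1 else 0 := by
          simp only [mul_comm _ (mean (K z.2) _), mean_const_mul]
          exact mul_le_mul' (hdown _) (hdown _)
      _ ≤ _ := by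
          refine mean_mono fun x => ?_
          rw [← mean_const_mul]
          refine mean_mono fun y => ?_
          by_cases hx : ℓ x ≤ ℓ z.1 - 1 <;> by_cases hy : ℓ y ≤ ℓ z.2 - 1
          · simp [hx, hy, show max (ℓ x) (ℓ y) ≤ max (ℓ z.1) (ℓ z.2) - 1 by omega]
          all_goals simp [hx, hy]
  · simp only [Nat.max_eq_zero_iff] at hz
    exact hzero _ _ hz.1 hz.2

/-- Two chains with the same transition law, moving independently, meet almost surely: this is
where the uniqueness of the state of level zero enters. -/
theorem mean_le_liminf_of_drift {V f : X → ℝ≥0∞} {b ρ : ℝ≥0∞} {ℓ : X → ℕ} {R : ℕ}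
    (hb : b ≠ ∞) (hV : ∀ x, V x ≠ ∞) (h : ∀ x, mean (K x) V + f x ≤ V x + b)
    (hR : ∀ x, ℓ x ≤ R ∨ 2 * b + 1 ≤ f x) (hρ : ρ ≠ 0)
    (hdown : ∀ x, ρ ≤ mean (K x) fun y => if ℓ y ≤ ℓ x - 1 then 1 else 0)
    (hzero : ∀ x y, ℓ x = 0 → ℓ y = 0 → x = y) {π : PMF X} (hπ : π.bind K = π) (ν : PMF X)
    {g : X → ℝ≥0∞} (hg : ∀ x, g x ≤ 1) :
    mean π g ≤ liminf (fun t => mean (ν.bind (kernelPow K t)) g) atTop :=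
  mean_le_liminf_of_tendsto_avoidProb K hπ
    (tendsto_avoidProb_pairKernel_of_drift K hb hV h hR hρ hdown hzero) ν hg

end Chain

section Arrivals

variable {n : ℕ}

/-- The probability of an arrival pattern, as a real number; it agrees with `arrivalLaw` when the
rates lie in `[0, 1]`. -/
def arrivalWeight (lam : Fin n → Fin n → ℝ) (a : Fin n → Fin n → Bool) : ℝ :=
  ∏ i, ∏ j, if a i j then lam i j else 1 - lam i j

/-- The expectation of a real function of the arrivals of one slot, as a linear functional. -/
def arrivalMean (lam : Fin n → Fin n → ℝ) : ((Fin n → Fin n → Bool) → ℝ) →ₗ[ℝ] ℝ where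
  toFun F := ∑ a, arrivalWeight lam a * F a
  map_add' F G := by simp [mul_add, Finset.sum_add_distrib]
  map_smul' c F := by simp [Finset.mul_sum, mul_left_comm]

lemma arrivalMean_apply (lam : Fin n → Fin n → ℝ) (F : (Fin n → Fin n → Bool) → ℝ) :
    arrivalMean lam F = ∑ a, arrivalWeight lam a * F a := rfl

lemma arrivalWeight_nonneg {lam : Fin n → Fin n → ℝ} (h0 : ∀ i j, 0 ≤ lam i j)
    (h1 : ∀ i j, lam i j ≤ 1) (a : Fin n → Fin n → Bool) : 0 ≤ arrivalWeight lam a := by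
  refine Finset.prod_nonneg fun i _ => Finset.prod_nonneg fun j _ => ?_
  split_ifs
  · exact h0 i j
  · exact sub_nonneg.2 (h1 i j)

lemma arrivalMean_mono {lam : Fin n → Fin n → ℝ} (h0 : ∀ i j, 0 ≤ lam i j)
    (h1 : ∀ i j, lam i j ≤ 1) {F G : (Fin n → Fin n → Bool) → ℝ} (h : ∀ a, F a ≤ G a) :
    arrivalMean lam F ≤ arrivalMean lam G :=
  Finset.sum_le_sum fun a _ => mul_le_mul_of_nonneg_left (h a) (arrivalWeight_nonneg h0 h1 a)

lemma arrivalLaw_apply {lam : Fin n → Fin n → ℝ} (h0 : ∀ i j, 0 ≤ lam i j)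
    (h1 : ∀ i j, lam i j ≤ 1) (a : Fin n → Fin n → Bool) :
    arrivalLaw lam a = ENNReal.ofReal (arrivalWeight lam a) := by
  have hprob : ∀ i j, prob (lam i j) = ENNReal.ofReal (lam i j) := fun i j =>
    min_eq_right (by simpa using h1 i j)
  have hnonneg : ∀ i j, 0 ≤ (if a i j then lam i j else 1 - lam i j) := by
    intro i j
    split_ifs
    · exact h0 i j
    · exact sub_nonneg.2 (h1 i j)
  rw [arrivalLaw, PMF.ofFintype_apply, arrivalWeight,
    ENNReal.ofReal_prod_of_nonneg fun i _ => Finset.prod_nonneg fun j _ => hnonneg i j]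
  refine Finset.prod_congr rfl fun i _ => ?_
  rw [ENNReal.ofReal_prod_of_nonneg fun j _ => hnonneg i j]
  refine Finset.prod_congr rfl fun j _ => ?_
  split_ifs
  · exact hprob i j
  · rw [hprob, ENNReal.ofReal_sub _ (h0 i j), ENNReal.ofReal_one]

lemma mean_arrivalLaw {lam : Fin n → Fin n → ℝ} (h0 : ∀ i j, 0 ≤ lam i j)
    (h1 : ∀ i j, lam i j ≤ 1) {F : (Fin n → Fin n → Bool) → ℝ} (hF : ∀ a, 0 ≤ F a) :
    mean (arrivalLaw lam) (fun a => ENNReal.ofReal (F a)) = ENNReal.ofReal (arrivalMean lam F) := by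
  rw [mean, tsum_fintype, arrivalMean_apply, ENNReal.ofReal_sum_of_nonneg fun a _ =>
    mul_nonneg (arrivalWeight_nonneg h0 h1 a) (hF a)]
  refine Finset.sum_congr rfl fun a _ => ?_
  rw [arrivalLaw_apply h0 h1, ENNReal.ofReal_mul (arrivalWeight_nonneg h0 h1 a)]

lemma arrivalMean_prod (lam : Fin n → Fin n → ℝ) (φ : Fin n × Fin n → Bool → ℝ) :
    arrivalMean lam (fun a => ∏ x, φ x (a x.1 x.2))
      = ∏ x : Fin n × Fin n, (lam x.1 x.2 * φ x true + (1 - lam x.1 x.2) * φ x false) := by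
  have hrow : ∀ i : Fin n, ∑ r : Fin n → Bool,
      ∏ j, (if r j then lam i j else 1 - lam i j) * φ (i, j) (r j)
        = ∏ j, (lam i j * φ (i, j) true + (1 - lam i j) * φ (i, j) false) := by
    intro i
    rw [← Fintype.prod_sum fun (j : Fin n) (b : Bool) =>
      (if b then lam i j else 1 - lam i j) * φ (i, j) b]
    simp
  simp only [arrivalMean_apply, arrivalWeight, Fintype.prod_prod_type, ← Finset.prod_mul_distrib]
  rw [← Fintype.prod_sum fun (i : Fin n) (r : Fin n → Bool) =>
    ∏ j, (if r j then lam i j else 1 - lam i j) * φ (i, j) (r j)]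
  exact Finset.prod_congr rfl fun i _ => hrow i

lemma arrivalMean_const (lam : Fin n → Fin n → ℝ) (c : ℝ) :
    arrivalMean lam (fun _ => c) = c := by
  have hone : arrivalMean lam (fun _ => 1) = 1 := by
    simpa using arrivalMean_prod lam fun _ _ => 1
  have hc : (fun _ : Fin n → Fin n → Bool => c) = c • fun _ => (1 : ℝ) := by funext; simp
  rw [hc, map_smul, hone, smul_eq_mul, mul_one]

/-- The number of arrivals, zero or one, at queue `x`, as a real number. -/
def arrivalCount (a : Fin n → Fin n → Bool) (x : Fin n × Fin n) : ℝ := ((a x.1 x.2).toNat : ℝ)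

lemma arrivalMean_arrivalCount (lam : Fin n → Fin n → ℝ) (x : Fin n × Fin n) :
    arrivalMean lam (fun a => arrivalCount a x) = lam x.1 x.2 := by
  have hprod := arrivalMean_prod lam fun y b => if y = x then ((b.toNat : ℕ) : ℝ) else 1
  simp only [Finset.prod_ite_eq', Finset.mem_univ, if_true] at hprod
  unfold arrivalCount
  rw [hprod, Finset.prod_eq_single x]
  · simp
  · intro y _ hy; simp [hy]
  · simp

lemma arrivalMean_covariance (lam : Fin n → Fin n → ℝ) (x y : Fin n × Fin n) :
    arrivalMean lam (fun a => (arrivalCount a x - lam x.1 x.2) * (arrivalCount a y - lam y.1 y.2))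
      = if x = y then lam x.1 x.2 * (1 - lam x.1 x.2) else 0 := by
  have hprod := arrivalMean_prod lam fun z b =>
    (if z = x then ((b.toNat : ℕ) : ℝ) - lam x.1 x.2 else 1) *
      (if z = y then ((b.toNat : ℕ) : ℝ) - lam y.1 y.2 else 1)
  simp only [Finset.prod_mul_distrib, Finset.prod_ite_eq', Finset.mem_univ, if_true] at hprod
  unfold arrivalCount
  rw [hprod]
  split_ifs with hxy
  · subst hxy
    rw [Finset.prod_eq_single x]
    · simp; ring
    · intro z _ hz; simp [hz]
    · simp
  · refine Finset.prod_eq_zero (Finset.mem_univ x) ?_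
    simp [hxy]; ring

lemma arrivalMean_sum_mul_arrivalCount (lam : Fin n → Fin n → ℝ) (c : Fin n × Fin n → ℝ) :
    arrivalMean lam (fun a => ∑ x, c x * arrivalCount a x) = ∑ x, c x * lam x.1 x.2 := by
  have hsum : (fun a : Fin n → Fin n → Bool => ∑ x, c x * arrivalCount a x)
      = ∑ x, c x • fun a => arrivalCount a x := by funext a; simp
  simp only [hsum, map_sum, map_smul, arrivalMean_arrivalCount, smul_eq_mul]

lemma arrivalMean_quadratic (lam : Fin n → Fin n → ℝ) (Q : Fin n × Fin n → Fin n × Fin n → ℝ) :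
    arrivalMean lam (fun a => ∑ x, ∑ y, Q x y *
        ((arrivalCount a x - lam x.1 x.2) * (arrivalCount a y - lam y.1 y.2)))
      = ∑ x : Fin n × Fin n, Q x x * (lam x.1 x.2 * (1 - lam x.1 x.2)) := by
  have hsum : (fun a : Fin n → Fin n → Bool => ∑ x, ∑ y, Q x y *
        ((arrivalCount a x - lam x.1 x.2) * (arrivalCount a y - lam y.1 y.2)))
      = ∑ x, ∑ y, Q x y • fun a =>
        (arrivalCount a x - lam x.1 x.2) * (arrivalCount a y - lam y.1 y.2) := by funext a; simp
  simp only [hsum, map_sum, map_smul, arrivalMean_covariance, smul_eq_mul, mul_ite, mul_zero,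
    Finset.sum_ite_eq, Finset.mem_univ, if_true]

end Arrivals

section QueueLaw

variable {n : ℕ}

lemma meanTotal_eq_mean (π : PMF (QueueMatrix n)) :
    meanTotal π = mean π fun q => ∑ i, ∑ j, (q i j : ℝ≥0∞) :=
  lintegral_toMeasure_eq_mean π _

lemma mean_queueLaw (P : Policy n) (lam : Fin n → Fin n → ℝ) (init : PMF (QueueMatrix n)) (t : ℕ)
    (f : QueueMatrix n → ℝ≥0∞) :
    mean (queueLaw P lam init t) f = mean (trajectoryLaw P lam init t) fun x => f x.2 :=
  mean_map _ _ _

lemma mean_trajectoryLaw_succ (P : Policy n) (lam : Fin n → Fin n → ℝ)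
    (init : PMF (QueueMatrix n)) (t : ℕ) (f : QueueMatrix n → ℝ≥0∞) :
    mean (trajectoryLaw P lam init (t + 1)) (fun x => f x.2)
      = mean (trajectoryLaw P lam init t) fun x => mean (P x.1 x.2) fun s =>
          mean (arrivalLaw lam) fun a => f (nextQueue x.2 a s) := by
  simp only [trajectoryLaw, mean_bind, step, mean_map]

lemma ConvergesInLaw.tendsto_mean {P : Policy n} {lam : Fin n → Fin n → ℝ}
    {init π : PMF (QueueMatrix n)} (h : ConvergesInLaw P lam init π) (f : QueueMatrix n → ℕ)
    {C : ℕ} (hf : ∀ q, f q ≤ C) :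
    Tendsto (fun t => mean (queueLaw P lam init t) fun q => (f q : ℝ≥0∞)) atTop
      (𝓝 (mean π fun q => (f q : ℝ≥0∞))) := by
  let F : BoundedContinuousFunction (QueueMatrix n) NNReal :=
    BoundedContinuousFunction.mkOfBound ⟨fun q => (f q : NNReal), continuous_of_discreteTopology⟩ C
      fun x y => by
        have hx : (f x : ℝ) ≤ C := by exact_mod_cast hf x
        have hy : (f y : ℝ) ≤ C := by exact_mod_cast hf y
        simp only [NNReal.dist_eq, ContinuousMap.coe_mk, NNReal.coe_natCast]
        exact abs_sub_le_of_nonneg_of_le (Nat.cast_nonneg _) hx (Nat.cast_nonneg _) hy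
  have hF : ∀ p : PMF (QueueMatrix n),
      ∫⁻ q, F q ∂(toProbabilityMeasure p : Measure (QueueMatrix n))
        = mean p fun q => (f q : ℝ≥0∞) := fun p => lintegral_toMeasure_eq_mean p _
  simpa only [hF] using ProbabilityMeasure.tendsto_iff_forall_lintegral_tendsto.1 h F

end QueueLaw

section SingleServer

variable {n : ℕ}

/-- The number of arrivals in one slot to a port, that is, to a set `C` of queues sharing a
server. -/
def portArrivals (C : Finset (Fin n × Fin n)) (a : Fin n → Fin n → Bool) : ℕ :=
  ∑ x ∈ C, (a x.1 x.2).toNat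

/-- The number of packets in the queues of a port. -/
def portQueue (C : Finset (Fin n × Fin n)) (q : QueueMatrix n) : ℕ := ∑ x ∈ C, q x.1 x.2

/-- The variance of the number of arrivals to a port. -/
def portVariance (lam : Fin n → Fin n → ℝ) (C : Finset (Fin n × Fin n)) : ℝ :=
  ∑ x ∈ C, lam x.1 x.2 * (1 - lam x.1 x.2)

/-- The transition operator of the Lindley recursion `r ↦ (r + A - 1)⁺`, the single-server queue fed
by the arrivals `A` to a port. -/
def lindley (lam : Fin n → Fin n → ℝ) (C : Finset (Fin n × Fin n)) (h : ℕ → ℝ≥0∞) (r : ℕ) :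
    ℝ≥0∞ :=
  mean (arrivalLaw lam) fun a => h (r + portArrivals C a - 1)

section Comparison

variable (lam : Fin n → Fin n → ℝ) (C : Finset (Fin n × Fin n))

lemma lindley_monotone {h : ℕ → ℝ≥0∞} (hh : Monotone h) : Monotone (lindley lam C h) :=
  fun _ _ hrs => mean_mono fun _ => hh (by omega)

lemma lindley_iterate_monotone {h : ℕ → ℝ≥0∞} (hh : Monotone h) (t : ℕ) :
    Monotone ((lindley lam C)^[t] h) := by
  induction t with
  | zero => exact hh
  | succ t ih => rw [Function.iterate_succ_apply']; exact lindley_monotone lam C ih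

lemma lindley_iterate_zero_monotone {h : ℕ → ℝ≥0∞} (hh : Monotone h) :
    Monotone fun t => (lindley lam C)^[t] h 0 := by
  refine monotone_nat_of_le_succ fun t => ?_
  rw [Function.iterate_succ_apply']
  calc (lindley lam C)^[t] h 0
      = mean (arrivalLaw lam) fun _ => (lindley lam C)^[t] h 0 := (mean_const _ _).symm
    _ ≤ _ := mean_mono fun _ => lindley_iterate_monotone lam C hh t (Nat.zero_le _)

lemma portArrivals_le_card (a : Fin n → Fin n → Bool) : portArrivals C a ≤ C.card :=
  (Finset.sum_le_card_nsmul _ _ 1 fun _ _ => Bool.toNat_le _).trans_eq (by simp)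

lemma lindley_iterate_congr {h g : ℕ → ℝ≥0∞} (t : ℕ) {B : ℕ} (hhg : ∀ r ≤ B, h r = g r) (r : ℕ)
    (hr : r + t * C.card ≤ B) : (lindley lam C)^[t] h r = (lindley lam C)^[t] g r := by
  induction t generalizing r with
  | zero => exact hhg r (by simpa using hr)
  | succ t ih =>
    simp only [Function.iterate_succ_apply', lindley]
    congr 1
    funext a
    refine ih _ ?_
    have := portArrivals_le_card C a
    rw [Nat.succ_mul] at hr
    omega

variable {C} in
lemma portQueue_add_sub_one_le_portQueue_nextQueue
    (hC : ∀ s : Schedule n, ∑ x ∈ C, s.1 x.1 x.2 ≤ 1)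
    (q : QueueMatrix n) (a : Fin n → Fin n → Bool) (s : Schedule n) :
    portQueue C q + portArrivals C a - 1 ≤ portQueue C (nextQueue q a s) := by
  have hserved : portQueue C q + portArrivals C a
      ≤ portQueue C (nextQueue q a s) + ∑ x ∈ C, s.1 x.1 x.2 := by
    simp only [portQueue, portArrivals, ← Finset.sum_add_distrib, nextQueue]
    exact Finset.sum_le_sum fun x _ => by omega
  have := hC s
  omega

variable {C} in
lemma lindley_iterate_le_mean_queueLaw (hC : ∀ s : Schedule n, ∑ x ∈ C, s.1 x.1 x.2 ≤ 1)
    (P : Policy n) (init : PMF (QueueMatrix n)) (t : ℕ) {h : ℕ → ℝ≥0∞} (hh : Monotone h) :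
    (lindley lam C)^[t] h 0 ≤ mean (queueLaw P lam init t) fun q => h (portQueue C q) := by
  rw [mean_queueLaw]
  induction t generalizing h with
  | zero =>
    calc h 0 = mean (trajectoryLaw P lam init 0) fun _ => h 0 := (mean_const _ _).symm
      _ ≤ _ := mean_mono fun _ => hh (Nat.zero_le _)
  | succ t ih =>
    rw [mean_trajectoryLaw_succ P lam init t fun q => h (portQueue C q),
      Function.iterate_succ_apply]
    refine (ih (lindley_monotone lam C hh)).trans (mean_mono fun x => ?_)
    calc lindley lam C h (portQueue C x.2)
        = mean (P x.1 x.2) fun _ => lindley lam C h (portQueue C x.2) := (mean_const _ _).symm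
      _ ≤ _ := mean_mono fun s => mean_mono fun a =>
        hh (portQueue_add_sub_one_le_portQueue_nextQueue hC _ _ _)

variable {lam C} in
lemma lindley_iterate_le_mean_of_convergesInLaw
    (hC : ∀ s : Schedule n, ∑ x ∈ C, s.1 x.1 x.2 ≤ 1)
    {P : Policy n} {init π : PMF (QueueMatrix n)} (hπ : ConvergesInLaw P lam init π) (t : ℕ) :
    (lindley lam C)^[t] (fun r => (r : ℝ≥0∞)) 0 ≤ mean π fun q => (portQueue C q : ℝ≥0∞) := by
  set B := t * C.card
  let h : ℕ → ℝ≥0∞ := fun r => ((min r B : ℕ) : ℝ≥0∞)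
  have hmono : Monotone h := fun r s hrs => Nat.cast_le.2 (min_le_min_right B hrs)
  rw [lindley_iterate_congr lam C t (g := h) (B := B) (fun r hr => by simp [h, hr]) 0 (by omega)]
  have hlim := hπ.tendsto_mean (fun q => min (portQueue C q) B) (C := B) fun q => min_le_right _ _
  refine (ge_of_tendsto hlim ?_).trans (mean_mono fun q => Nat.cast_le.2 (min_le_left _ _))
  filter_upwards [eventually_ge_atTop t] with u hu
  exact (lindley_iterate_zero_monotone lam C hmono hu).trans
    (lindley_iterate_le_mean_queueLaw lam hC P init u hmono)

end Comparison

/-- The action of the Lindley recursion on real functions, as a linear map. -/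
def lindleyReal (lam : Fin n → Fin n → ℝ) (C : Finset (Fin n × Fin n)) :
    (ℕ → ℝ) →ₗ[ℝ] (ℕ → ℝ) where
  toFun h r := arrivalMean lam fun a => h (r + portArrivals C a - 1)
  map_add' _ _ := by funext r; exact map_add (arrivalMean lam) _ _
  map_smul' c _ := by funext r; exact map_smul (arrivalMean lam) c _

lemma lindleyReal_apply (lam : Fin n → Fin n → ℝ) (C : Finset (Fin n × Fin n)) (h : ℕ → ℝ) (r : ℕ) :
    lindleyReal lam C h r = arrivalMean lam fun a => h (r + portArrivals C a - 1) := rfl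

variable {lam : Fin n → Fin n → ℝ} {C : Finset (Fin n × Fin n)}

lemma lindleyReal_pow_const (c : ℝ) (t : ℕ) :
    (lindleyReal lam C ^ t) (fun _ => c) = fun _ => c := by
  induction t with
  | zero => rfl
  | succ t ih =>
    funext r
    rw [pow_succ', Module.End.mul_apply, ih, lindleyReal_apply, arrivalMean_const]

lemma lindleyReal_pow_nonneg (h0 : ∀ i j, 0 ≤ lam i j) (h1 : ∀ i j, lam i j ≤ 1) {h : ℕ → ℝ}
    (hh : ∀ r, 0 ≤ h r) (t : ℕ) (r : ℕ) : 0 ≤ (lindleyReal lam C ^ t) h r := by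
  induction t generalizing r with
  | zero => exact hh r
  | succ t ih =>
    rw [pow_succ', Module.End.mul_apply, lindleyReal_apply, ← arrivalMean_const lam 0]
    exact arrivalMean_mono h0 h1 fun _ => ih _

lemma lindley_iterate_ofReal (h0 : ∀ i j, 0 ≤ lam i j) (h1 : ∀ i j, lam i j ≤ 1) {h : ℕ → ℝ}
    (hh : ∀ r, 0 ≤ h r) (t : ℕ) (r : ℕ) :
    (lindley lam C)^[t] (fun r => ENNReal.ofReal (h r)) r
      = ENNReal.ofReal ((lindleyReal lam C ^ t) h r) := by
  induction t generalizing r with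
  | zero => rfl
  | succ t ih =>
    rw [Function.iterate_succ_apply', lindley]
    simp only [ih]
    rw [mean_arrivalLaw h0 h1 fun a => lindleyReal_pow_nonneg h0 h1 hh t _, pow_succ']
    rfl

lemma lindleyReal_pow_zero_le_pow_succ (h0 : ∀ i j, 0 ≤ lam i j) (h1 : ∀ i j, lam i j ≤ 1)
    {h : ℕ → ℝ} (hh : ∀ r, 0 ≤ h r) (hm : Monotone h) (t : ℕ) :
    (lindleyReal lam C ^ t) h 0 ≤ (lindleyReal lam C ^ (t + 1)) h 0 := by
  have hmono := lindley_iterate_zero_monotone lam C (h := fun r => ENNReal.ofReal (h r))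
    (fun _ _ hrs => ENNReal.ofReal_le_ofReal (hm hrs)) (Nat.le_succ t)
  simp only [lindley_iterate_ofReal h0 h1 hh] at hmono
  exact (ENNReal.ofReal_le_ofReal_iff (lindleyReal_pow_nonneg h0 h1 hh _ _)).1 hmono

lemma arrivalMean_portArrivals :
    arrivalMean lam (fun a => (portArrivals C a : ℝ)) = ∑ x ∈ C, lam x.1 x.2 := by
  have hsum : (fun a => (portArrivals C a : ℝ)) = ∑ x ∈ C, fun a => arrivalCount a x := by
    funext a; simp [portArrivals, arrivalCount]
  simp only [hsum, map_sum, arrivalMean_arrivalCount]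

lemma arrivalMean_portArrivals_sq :
    arrivalMean lam (fun a => (portArrivals C a : ℝ) ^ 2)
      = portVariance lam C + (∑ x ∈ C, lam x.1 x.2) ^ 2 := by
  set c := ∑ x ∈ C, lam x.1 x.2 with hc
  have hcenter : (fun a => (portArrivals C a : ℝ) ^ 2)
      = (∑ x ∈ C, ∑ y ∈ C, fun a => (arrivalCount a x - lam x.1 x.2) *
          (arrivalCount a y - lam y.1 y.2))
        + ((2 * c) • (fun a => (portArrivals C a : ℝ)) + fun _ => - c ^ 2) := by
    funext a
    have hsub : (portArrivals C a : ℝ) - c = ∑ x ∈ C, (arrivalCount a x - lam x.1 x.2) := by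
      rw [Finset.sum_sub_distrib, ← hc]
      simp [portArrivals, arrivalCount]
    simp only [Pi.add_apply, Finset.sum_apply, Pi.smul_apply, smul_eq_mul, ← Finset.sum_mul_sum,
      ← hsub]
    ring
  rw [hcenter, portVariance]
  simp only [map_add, map_sum, map_smul, arrivalMean_const, arrivalMean_portArrivals, ← hc,
    arrivalMean_covariance, Finset.sum_ite_eq, Finset.sum_ite_mem, Finset.inter_self, smul_eq_mul]
  ring

/-- The test function `r (r + 1)`; unlike `r²` it takes the same value `0` at `-1` and at `0`, so
that the truncation in the Lindley recursion is invisible to it. -/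
def quadTest (r : ℕ) : ℝ := (r : ℝ) * (r + 1)

/-- The test function `(r - 1) r (r + 1)`, the cubic analogue of `quadTest`. -/
def cubicTest (r : ℕ) : ℝ := ((r : ℝ) - 1) * r * (r + 1)

lemma quadTest_add_sub_one (r a : ℕ) :
    quadTest (r + a - 1) = (a : ℝ) ^ 2 + (2 * (r : ℝ) - 1) * a + (r : ℝ) * (r - 1) := by
  rcases Nat.eq_zero_or_pos (r + a) with h | h
  · obtain ⟨rfl, rfl⟩ : r = 0 ∧ a = 0 := by omega
    simp [quadTest]
  · rw [quadTest, Nat.cast_sub h]; push_cast; ring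

lemma cubicTest_add_sub_one (r a : ℕ) :
    cubicTest (r + a - 1) = ((a : ℝ) - 1) ^ 3 + 3 * (r : ℝ) * ((a : ℝ) - 1) ^ 2
      + (3 * (r : ℝ) ^ 2 - 1) * a + ((r : ℝ) ^ 3 - r - 3 * (r : ℝ) ^ 2 + 1) := by
  rcases Nat.eq_zero_or_pos (r + a) with h | h
  · obtain ⟨rfl, rfl⟩ : r = 0 ∧ a = 0 := by omega
    norm_num [cubicTest]
  · rw [cubicTest, Nat.cast_sub h]; push_cast; ring

lemma lindleyReal_quadTest {ε : ℝ} (hε : ∑ x ∈ C, lam x.1 x.2 = 1 - ε) :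
    lindleyReal lam C quadTest
      = quadTest + (-(2 * ε)) • Nat.cast + fun _ => portVariance lam C - ε * (1 - ε) := by
  funext r
  have hexpand : (fun a => quadTest (r + portArrivals C a - 1))
      = (fun a => (portArrivals C a : ℝ) ^ 2)
        + (2 * (r : ℝ) - 1) • (fun a => (portArrivals C a : ℝ)) + fun _ => (r : ℝ) * (r - 1) :=
    funext fun a => quadTest_add_sub_one r _
  rw [lindleyReal_apply, hexpand, map_add, map_add, map_smul, arrivalMean_portArrivals_sq,
    arrivalMean_portArrivals, arrivalMean_const, hε]
  simp only [quadTest, Pi.add_apply, Pi.smul_apply, smul_eq_mul]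
  ring

lemma lindleyReal_cubicTest {ε : ℝ} (hε : ∑ x ∈ C, lam x.1 x.2 = 1 - ε) :
    lindleyReal lam C cubicTest
      = cubicTest + (-(3 * ε)) • quadTest
        + (3 * (arrivalMean lam (fun a => ((portArrivals C a : ℝ) - 1) ^ 2) + ε)) • Nat.cast
        + fun _ => arrivalMean lam (fun a => ((portArrivals C a : ℝ) - 1) ^ 3) + ε := by
  funext r
  have hexpand : (fun a => cubicTest (r + portArrivals C a - 1))
      = (fun a => ((portArrivals C a : ℝ) - 1) ^ 3)
        + (3 * (r : ℝ)) • (fun a => ((portArrivals C a : ℝ) - 1) ^ 2)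
        + (3 * (r : ℝ) ^ 2 - 1) • (fun a => (portArrivals C a : ℝ))
        + fun _ => (r : ℝ) ^ 3 - r - 3 * (r : ℝ) ^ 2 + 1 :=
    funext fun a => cubicTest_add_sub_one r _
  rw [lindleyReal_apply, hexpand, map_add, map_add, map_add, map_smul, map_smul,
    arrivalMean_portArrivals, arrivalMean_const, hε]
  simp only [cubicTest, quadTest, Pi.add_apply, Pi.smul_apply, smul_eq_mul]
  ring

lemma cubicTest_monotone : Monotone cubicTest := monotone_nat_of_le_succ fun r => by
  have hincr : cubicTest (r + 1) = cubicTest r + 3 * ((r : ℝ) ^ 2 + r) := by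
    simp only [cubicTest]; push_cast; ring
  rw [hincr]
  exact le_add_of_nonneg_right (by positivity)

lemma cubicTest_nonneg (r : ℕ) : 0 ≤ cubicTest r := by
  simpa [cubicTest] using cubicTest_monotone (Nat.zero_le r)

lemma mul_le_lindleyReal_pow_quadTest {ε : ℝ} (hε : 0 ≤ ε) (hc : ∑ x ∈ C, lam x.1 x.2 = 1 - ε)
    {M : ℝ} (hM : ∀ t, (lindleyReal lam C ^ t) Nat.cast 0 ≤ M) (t : ℕ) :
    t * (portVariance lam C - ε * (1 - ε) - 2 * ε * M) ≤ (lindleyReal lam C ^ t) quadTest 0 := by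
  induction t with
  | zero => simp [quadTest]
  | succ t ih =>
    rw [pow_succ, Module.End.mul_apply, lindleyReal_quadTest hc, map_add, map_add, map_smul]
    simp only [Pi.add_apply, Pi.smul_apply, lindleyReal_pow_const, smul_eq_mul]
    push_cast
    linarith [mul_le_mul_of_nonneg_left (hM t) (by positivity : 0 ≤ 2 * ε)]

-- The third moment started from an empty queue increases with time; its drift is `-3 ε` times the
-- second moment up to lower order, which keeps the second moment bounded.
lemma exists_lindleyReal_pow_quadTest_le (h0 : ∀ i j, 0 ≤ lam i j) (h1 : ∀ i j, lam i j ≤ 1)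
    {ε : ℝ} (hε : 0 < ε) (hc : ∑ x ∈ C, lam x.1 x.2 = 1 - ε)
    {M : ℝ} (hM : ∀ t, (lindleyReal lam C ^ t) Nat.cast 0 ≤ M) :
    ∃ B, ∀ t, (lindleyReal lam C ^ t) quadTest 0 ≤ B := by
  set v := arrivalMean lam fun a => ((portArrivals C a : ℝ) - 1) ^ 2
  set κ := arrivalMean lam (fun a => ((portArrivals C a : ℝ) - 1) ^ 3) + ε
  have hv : 0 ≤ v := by
    rw [← arrivalMean_const lam 0]
    exact arrivalMean_mono h0 h1 fun _ => sq_nonneg _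
  refine ⟨(3 * (v + ε) * M + κ) / (3 * ε), fun t => ?_⟩
  have hincr :=
    lindleyReal_pow_zero_le_pow_succ (C := C) h0 h1 cubicTest_nonneg cubicTest_monotone t
  rw [pow_succ, Module.End.mul_apply, lindleyReal_cubicTest hc, map_add, map_add, map_add, map_smul,
    map_smul] at hincr
  simp only [Pi.add_apply, Pi.smul_apply, lindleyReal_pow_const, smul_eq_mul] at hincr
  rw [le_div_iff₀ (by positivity)]
  linarith [mul_le_mul_of_nonneg_left (hM t) (by positivity : 0 ≤ 3 * (v + ε))]

lemma exists_lt_lindleyReal_pow_natCast (h0 : ∀ i j, 0 ≤ lam i j) (h1 : ∀ i j, lam i j ≤ 1)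
    {ε : ℝ} (hε : 0 < ε) (hc : ∑ x ∈ C, lam x.1 x.2 = 1 - ε)
    {M : ℝ} (hM : M < (portVariance lam C - ε * (1 - ε)) / (2 * ε)) :
    ∃ t, M < (lindleyReal lam C ^ t) Nat.cast 0 := by
  by_contra! hle
  have hpos : 0 < portVariance lam C - ε * (1 - ε) - 2 * ε * M := by
    rw [lt_div_iff₀ (by positivity)] at hM
    linarith
  obtain ⟨B, hB⟩ := exists_lindleyReal_pow_quadTest_le h0 h1 hε hc hle
  obtain ⟨t, ht⟩ := exists_nat_gt (B / (portVariance lam C - ε * (1 - ε) - 2 * ε * M))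
  rw [div_lt_iff₀ hpos] at ht
  exact (ht.trans_le (mul_le_lindleyReal_pow_quadTest hε.le hc hle t)).not_ge (hB t)

theorem le_mean_portQueue (h0 : ∀ i j, 0 ≤ lam i j) (h1 : ∀ i j, lam i j ≤ 1)
    (hC : ∀ s : Schedule n, ∑ x ∈ C, s.1 x.1 x.2 ≤ 1)
    {ε : ℝ} (hε : 0 < ε) (hc : ∑ x ∈ C, lam x.1 x.2 = 1 - ε)
    {P : Policy n} {init π : PMF (QueueMatrix n)} (hπ : ConvergesInLaw P lam init π) :
    ENNReal.ofReal ((portVariance lam C - ε * (1 - ε)) / (2 * ε))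
      ≤ mean π fun q => (portQueue C q : ℝ≥0∞) := by
  refine le_of_forall_lt fun x hx => ?_
  obtain ⟨t, ht⟩ := exists_lt_lindleyReal_pow_natCast h0 h1 hε hc
    ((ENNReal.lt_ofReal_iff_toReal_lt hx.ne_top).1 hx)
  have hreal := lindley_iterate_ofReal (C := C) h0 h1 (h := Nat.cast) Nat.cast_nonneg t 0
  simp only [ENNReal.ofReal_natCast] at hreal
  calc x < ENNReal.ofReal ((lindleyReal lam C ^ t) Nat.cast 0) :=
        (ENNReal.lt_ofReal_iff_toReal_lt hx.ne_top).2 ht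
    _ = (lindley lam C)^[t] (fun r => (r : ℝ≥0∞)) 0 := hreal.symm
    _ ≤ _ := lindley_iterate_le_mean_of_convergesInLaw hC hπ t

end SingleServer

section Birkhoff

lemma exists_doublyStochastic_ge {ι : Type*} [Fintype ι] [DecidableEq ι] {r : Matrix ι ι ℝ}
    (h0 : ∀ i j, 0 ≤ r i j) (hrow : ∀ i, ∑ j, r i j ≤ 1) (hcol : ∀ j, ∑ i, r i j ≤ 1) :
    ∃ M ∈ doublyStochastic ℝ ι, ∀ i j, r i j ≤ M i j := by
  let c : ι → ℝ := fun i => 1 - ∑ j, r i j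
  let d : ι → ℝ := fun j => 1 - ∑ i, r i j
  have hc : ∀ i, 0 ≤ c i := fun i => sub_nonneg.2 (hrow i)
  have hd : ∀ j, 0 ≤ d j := fun j => sub_nonneg.2 (hcol j)
  set D : ℝ := ∑ i, c i with hD
  have hdD : ∑ j, d j = D := by
    simp only [hD, c, d, Finset.sum_sub_distrib]
    rw [Finset.sum_comm]
  have hD0 : 0 ≤ D := Finset.sum_nonneg fun i _ => hc i
  have hcD : ∀ i, D = 0 → c i = 0 := fun i h =>
    (Finset.sum_eq_zero_iff_of_nonneg fun i _ => hc i).1 h i (Finset.mem_univ i)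
  have hdD' : ∀ j, D = 0 → d j = 0 := fun j h =>
    (Finset.sum_eq_zero_iff_of_nonneg fun j _ => hd j).1 (hdD.trans h) j (Finset.mem_univ j)
  have hfill : ∀ i j, 0 ≤ c i * d j / D := fun i j =>
    div_nonneg (mul_nonneg (hc i) (hd j)) hD0
  refine ⟨fun i j => r i j + c i * d j / D, mem_doublyStochastic_iff_sum.2
    ⟨fun i j => add_nonneg (h0 i j) (hfill i j), fun i => ?_, fun j => ?_⟩,
    fun i j => le_add_of_nonneg_right (hfill i j)⟩
  · rw [Finset.sum_add_distrib, ← Finset.sum_div, ← Finset.mul_sum, hdD,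
      mul_div_cancel_of_imp (hcD i)]
    exact add_sub_cancel _ _
  · rw [Finset.sum_add_distrib, ← Finset.sum_div, ← Finset.sum_mul, ← hD, mul_comm,
      mul_div_cancel_of_imp (hdD' j)]
    exact add_sub_cancel _ _

variable {n : ℕ}

/-- The schedule matching input `i` to output `σ i`. -/
def permSchedule (σ : Equiv.Perm (Fin n)) : Schedule n :=
  ⟨fun i j => if σ i = j then 1 else 0, fun i => by simp, fun j => by
    simp only [← Equiv.eq_symm_apply]; simp⟩

lemma sum_mul_permMatrix (q : QueueMatrix n) (σ : Equiv.Perm (Fin n)) :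
    ∑ i, ∑ j, (q i j : ℝ) * σ.permMatrix ℝ i j = (permSchedule σ).weight q := by
  simp only [Schedule.weight, permSchedule]
  push_cast
  refine Finset.sum_congr rfl fun i _ => Finset.sum_congr rfl fun j _ => ?_
  simp [Equiv.Perm.permMatrix, PEquiv.toMatrix_apply, Equiv.toPEquiv_apply, eq_comm]

lemma sum_mul_le_weight {q : QueueMatrix n} {s : Schedule n}
    (hs : ∀ s' : Schedule n, s'.weight q ≤ s.weight q) {r : Matrix (Fin n) (Fin n) ℝ}
    (h0 : ∀ i j, 0 ≤ r i j) (hrow : ∀ i, ∑ j, r i j ≤ 1) (hcol : ∀ j, ∑ i, r i j ≤ 1) :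
    ∑ i, ∑ j, (q i j : ℝ) * r i j ≤ s.weight q := by
  obtain ⟨M, hM, hrM⟩ := exists_doublyStochastic_ge h0 hrow hcol
  let halfSpace : Set (Matrix (Fin n) (Fin n) ℝ) :=
    {M | ∑ i, ∑ j, (q i j : ℝ) * M i j ≤ s.weight q}
  have hconvex : Convex ℝ halfSpace := convex_halfSpace_le
    ⟨fun M N => by simp [mul_add, Finset.sum_add_distrib],
      fun c M => by simp [Finset.mul_sum, mul_left_comm]⟩ _
  have hperm : {σ.permMatrix ℝ | σ : Equiv.Perm (Fin n)} ⊆ halfSpace := by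
    rintro _ ⟨σ, rfl⟩
    exact (sum_mul_permMatrix q σ).trans_le (Nat.cast_le.2 (hs _))
  have hMs : M ∈ halfSpace := convexHull_min hperm hconvex
    (by rwa [← doublyStochastic_eq_convexHull_permMatrix])
  exact (Finset.sum_le_sum fun i _ => Finset.sum_le_sum fun j _ =>
    mul_le_mul_of_nonneg_left (hrM i j) (Nat.cast_nonneg _)).trans hMs

end Birkhoff

section Vectors

lemma inner_eq_sum_mul {ι : Type*} [Fintype ι] (v w : EuclideanSpace ℝ ι) :
    inner ℝ v w = ∑ x, v x * w x := by
  simp [PiLp.inner_apply, mul_comm]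

lemma abs_apply_le_norm {ι : Type*} [Fintype ι] (v : EuclideanSpace ℝ ι) (x : ι) :
    |v x| ≤ ‖v‖ := by
  simpa using PiLp.norm_apply_le v x

variable {n : ℕ}

/-- The Euclidean space of real `n × n` matrices, indexed by queues. -/
abbrev Vec (n : ℕ) : Type := EuclideanSpace ℝ (Fin n × Fin n)

/-- The queue lengths as a vector. -/
def queueVec (q : QueueMatrix n) : Vec n := WithLp.toLp 2 fun x => (q x.1 x.2 : ℝ)

/-- A schedule as a vector. -/
def schedVec (s : Schedule n) : Vec n := WithLp.toLp 2 fun x => (s.1 x.1 x.2 : ℝ)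

/-- The arrivals of one slot as a vector. -/
def arrVec (a : Fin n → Fin n → Bool) : Vec n := WithLp.toLp 2 (arrivalCount a)

/-- A matrix of arrival rates as a vector. -/
def rateVec (lam : Fin n → Fin n → ℝ) : Vec n := WithLp.toLp 2 fun x => lam x.1 x.2

/-- The unused service of one slot: the schedule minus the packets that actually depart. -/
def unusedVec (q : QueueMatrix n) (a : Fin n → Fin n → Bool) (s : Schedule n) : Vec n :=
  queueVec (nextQueue q a s) - queueVec q - arrVec a + schedVec s

@[simp] lemma queueVec_apply (q : QueueMatrix n) (x) : queueVec q x = (q x.1 x.2 : ℝ) := rfl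
@[simp] lemma schedVec_apply (s : Schedule n) (x) : schedVec s x = (s.1 x.1 x.2 : ℝ) := rfl
@[simp] lemma arrVec_apply (a : Fin n → Fin n → Bool) (x) : arrVec a x = arrivalCount a x := rfl
@[simp] lemma rateVec_apply (lam : Fin n → Fin n → ℝ) (x) : rateVec lam x = lam x.1 x.2 := rfl

lemma norm_le_mul_of_abs_apply_le {v : Vec n} {c : ℝ} (hc : 0 ≤ c) (h : ∀ x, |v x| ≤ c) :
    ‖v‖ ≤ n * c := by
  refine le_of_sq_le_sq ?_ (by positivity)
  rw [EuclideanSpace.real_norm_sq_eq]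
  calc ∑ x, v x ^ 2 ≤ ∑ _x : Fin n × Fin n, c ^ 2 :=
        Finset.sum_le_sum fun x _ => sq_le_sq.2 ((h x).trans (le_abs_self c))
    _ = _ := by simp; ring

lemma norm_queueVec_le_sum (q : QueueMatrix n) : ‖queueVec q‖ ≤ ∑ x, queueVec q x := by
  refine le_of_sq_le_sq ?_ (Finset.sum_nonneg fun x _ => Nat.cast_nonneg _)
  rw [EuclideanSpace.real_norm_sq_eq]
  exact Finset.sum_sq_le_sq_sum_of_nonneg fun x _ => Nat.cast_nonneg _

lemma schedule_apply_le_one (s : Schedule n) (i j : Fin n) : s.1 i j ≤ 1 :=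
  (Finset.single_le_sum (f := fun j => s.1 i j) (fun _ _ => Nat.zero_le _)
    (Finset.mem_univ j)).trans (s.2.1 i)

lemma queueVec_nextQueue (q : QueueMatrix n) (a : Fin n → Fin n → Bool) (s : Schedule n) :
    queueVec (nextQueue q a s) = queueVec q + arrVec a - schedVec s + unusedVec q a s := by
  unfold unusedVec; abel

lemma unusedVec_apply_eq_zero_or (q : QueueMatrix n) (a : Fin n → Fin n → Bool) (s : Schedule n)
    (x) : unusedVec q a s x = 0 ∨
      (unusedVec q a s x = 1 ∧ q x.1 x.2 = 0 ∧ nextQueue q a s x.1 x.2 = 0) := by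
  have hs := schedule_apply_le_one s x.1 x.2
  have hunused : unusedVec q a s x = ((q x.1 x.2 + (a x.1 x.2).toNat - s.1 x.1 x.2 : ℕ) : ℝ)
      - (q x.1 x.2 : ℝ) - ((a x.1 x.2).toNat : ℝ) + (s.1 x.1 x.2 : ℝ) := rfl
  rcases Nat.lt_or_ge (q x.1 x.2 + (a x.1 x.2).toNat) (s.1 x.1 x.2) with h | h
  · obtain ⟨hq, ha, hs⟩ : q x.1 x.2 = 0 ∧ (a x.1 x.2).toNat = 0 ∧ s.1 x.1 x.2 = 1 := by omega
    refine .inr ⟨?_, hq, ?_⟩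
    · rw [hunused, hq, ha, hs]; simp
    · simp [nextQueue, hq, ha]
  · left
    rw [hunused, Nat.cast_sub h]; push_cast; ring

lemma unusedVec_apply_nonneg (q : QueueMatrix n) (a : Fin n → Fin n → Bool) (s : Schedule n) (x) :
    0 ≤ unusedVec q a s x := by
  rcases unusedVec_apply_eq_zero_or q a s x with h | ⟨h, -, -⟩ <;> rw [h]; exact zero_le_one

lemma unusedVec_apply_sq (q : QueueMatrix n) (a : Fin n → Fin n → Bool) (s : Schedule n) (x) :
    unusedVec q a s x ^ 2 = unusedVec q a s x := by
  rcases unusedVec_apply_eq_zero_or q a s x with h | ⟨h, -, -⟩ <;> simp [h]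

lemma inner_queueVec_unusedVec (q : QueueMatrix n) (a : Fin n → Fin n → Bool) (s : Schedule n) :
    inner ℝ (queueVec q) (unusedVec q a s) = 0 := by
  rw [inner_eq_sum_mul]
  refine Finset.sum_eq_zero fun x _ => ?_
  rcases unusedVec_apply_eq_zero_or q a s x with h | ⟨-, h, -⟩ <;> simp [h]

lemma queueVec_nextQueue_mul_unusedVec (q : QueueMatrix n) (a : Fin n → Fin n → Bool)
    (s : Schedule n) (x) : queueVec (nextQueue q a s) x * unusedVec q a s x = 0 := by
  rcases unusedVec_apply_eq_zero_or q a s x with h | ⟨-, -, h⟩ <;> simp [h]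

lemma norm_queueVec_nextQueue_sub_le (q : QueueMatrix n) (a : Fin n → Fin n → Bool)
    (s : Schedule n) : ‖queueVec (nextQueue q a s) - queueVec q‖ ≤ n := by
  refine (norm_le_mul_of_abs_apply_le zero_le_one fun x => ?_).trans_eq (mul_one _)
  have hs := schedule_apply_le_one s x.1 x.2
  have ha := Bool.toNat_le (a x.1 x.2)
  have hup : (nextQueue q a s x.1 x.2 : ℝ) ≤ q x.1 x.2 + 1 := by
    exact_mod_cast (by simp only [nextQueue]; omega : nextQueue q a s x.1 x.2 ≤ q x.1 x.2 + 1)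
  have hdown : (q x.1 x.2 : ℝ) ≤ nextQueue q a s x.1 x.2 + 1 := by
    exact_mod_cast (by simp only [nextQueue]; omega : q x.1 x.2 ≤ nextQueue q a s x.1 x.2 + 1)
  rw [PiLp.sub_apply, queueVec_apply, queueVec_apply, abs_sub_le_iff]
  constructor <;> linarith

lemma inner_queueVec_le_inner_schedVec {q : QueueMatrix n} {s : Schedule n}
    (hs : ∀ s' : Schedule n, s'.weight q ≤ s.weight q) {r : Vec n}
    (h0 : ∀ x, 0 ≤ r x) (hrow : ∀ i, ∑ j, r (i, j) ≤ 1) (hcol : ∀ j, ∑ i, r (i, j) ≤ 1) :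
    inner ℝ (queueVec q) r ≤ inner ℝ (queueVec q) (schedVec s) := by
  have hweight : (s.weight q : ℝ) = inner ℝ (queueVec q) (schedVec s) := by
    rw [inner_eq_sum_mul, Fintype.sum_prod_type]
    simp [Schedule.weight]
  rw [← hweight, inner_eq_sum_mul, Fintype.sum_prod_type]
  exact sum_mul_le_weight hs (r := fun i j => r (i, j)) (fun i j => h0 _) hrow hcol

lemma arrivalMean_inner_arrVec (lam : Fin n → Fin n → ℝ) (v : Vec n) :
    arrivalMean lam (fun a => inner ℝ v (arrVec a)) = inner ℝ v (rateVec lam) := by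
  simp only [inner_eq_sum_mul]
  exact arrivalMean_sum_mul_arrivalCount lam v

end Vectors

section Rates

variable {n n₁ n₂ : ℕ}

lemma rate_eq_mul_rate_zero (n n₁ n₂ : ℕ) (ε : ℝ) (i j : Fin n) :
    rate n n₁ n₂ ε i j = (1 - ε) * rate n n₁ n₂ 0 i j := by
  unfold rate; split_ifs <;> ring

lemma rateVec_rate (n n₁ n₂ : ℕ) (ε : ℝ) :
    rateVec (rate n n₁ n₂ ε) = (1 - ε) • rateVec (rate n n₁ n₂ 0) := by
  ext x; simp [rate_eq_mul_rate_zero n n₁ n₂ ε]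

lemma rate_zero_le (n n₁ n₂ : ℕ) (i j : Fin n) : rate n n₁ n₂ 0 i j ≤ 1 / n := by
  have : (0 : ℝ) < n := by exact_mod_cast i.pos
  unfold rate; split_ifs
  · rw [sub_zero]; gcongr; linarith
  · rw [sub_zero]

lemma le_rate_zero (n n₁ n₂ : ℕ) (i j : Fin n) : 1 / (2 * n) ≤ rate n n₁ n₂ 0 i j := by
  have : (0 : ℝ) < n := by exact_mod_cast i.pos
  unfold rate; split_ifs
  · rw [sub_zero]
  · rw [sub_zero]; gcongr; linarith

lemma rate_zero_nonneg (n n₁ n₂ : ℕ) (i j : Fin n) : 0 ≤ rate n n₁ n₂ 0 i j :=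
  le_trans (by positivity) (le_rate_zero n n₁ n₂ i j)

lemma rate_nonneg {ε : ℝ} (hε : ε ≤ 1) (i j : Fin n) : 0 ≤ rate n n₁ n₂ ε i j := by
  rw [rate_eq_mul_rate_zero]; exact mul_nonneg (by linarith) (rate_zero_nonneg _ _ _ _ _)

lemma rate_le_one_sub {ε : ℝ} (hε : ε ≤ 1) (i j : Fin n) : rate n n₁ n₂ ε i j ≤ 1 - ε := by
  have hn : (1 : ℝ) ≤ n := by exact_mod_cast i.pos
  rw [rate_eq_mul_rate_zero]
  exact mul_le_of_le_one_right (by linarith)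
    ((rate_zero_le n n₁ n₂ i j).trans (div_le_one_of_le₀ hn (by linarith)))

lemma rate_le_one {ε : ℝ} (hε0 : 0 ≤ ε) (hε1 : ε ≤ 1) (i j : Fin n) : rate n n₁ n₂ ε i j ≤ 1 :=
  (rate_le_one_sub hε1 i j).trans (by linarith)

lemma rate_of_saturated {ε : ℝ} {i j : Fin n} (h : i.val < n₁ ∨ j.val < n₂) :
    rate n n₁ n₂ ε i j = (1 - ε) / n :=
  if_neg (by omega)

lemma sum_rate_row {ε : ℝ} {i : Fin n} (h : i.val < n₁) : ∑ j, rate n n₁ n₂ ε i j = 1 - ε := by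
  have : (n : ℝ) ≠ 0 := by have := i.pos; positivity
  simp only [rate_of_saturated (Or.inl h), Finset.sum_const, Finset.card_univ, Fintype.card_fin,
    nsmul_eq_mul]
  field_simp

lemma sum_rate_col {ε : ℝ} {j : Fin n} (h : j.val < n₂) : ∑ i, rate n n₁ n₂ ε i j = 1 - ε := by
  have : (n : ℝ) ≠ 0 := by have := j.pos; positivity
  simp only [rate_of_saturated (Or.inr h), Finset.sum_const, Finset.card_univ, Fintype.card_fin,
    nsmul_eq_mul]
  field_simp

lemma sum_le_of_forall_le_one_div {f : Fin n → ℝ} (hf : ∀ k, f k ≤ 1 / n) (k : Fin n)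
    (hk : f k = 1 / (2 * n)) : ∑ k, f k ≤ 1 - 1 / (2 * n) := by
  have hn : (0 : ℝ) < n := by exact_mod_cast k.pos
  have hgap : 1 / (n : ℝ) - f k ≤ ∑ k, (1 / (n : ℝ) - f k) :=
    Finset.single_le_sum (f := fun k => 1 / (n : ℝ) - f k) (fun k _ => sub_nonneg.2 (hf k))
      (Finset.mem_univ k)
  have hone : ∑ _k : Fin n, 1 / (n : ℝ) = 1 := by simp [hn.ne']
  have hhalf : 1 / (n : ℝ) = 1 / (2 * n) + 1 / (2 * n) := by field_simp; norm_num
  rw [Finset.sum_sub_distrib, hk] at hgap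
  linarith

lemma sum_rate_zero_row_le (hn₂ : n₂ < n) {i : Fin n} (h : n₁ ≤ i.val) :
    ∑ j, rate n n₁ n₂ 0 i j ≤ 1 - 1 / (2 * n) :=
  sum_le_of_forall_le_one_div (fun j => rate_zero_le n n₁ n₂ i j) ⟨n₂, hn₂⟩ (by simp [rate, h])

lemma sum_rate_zero_col_le (hn₁ : n₁ < n) {j : Fin n} (h : n₂ ≤ j.val) :
    ∑ i, rate n n₁ n₂ 0 i j ≤ 1 - 1 / (2 * n) :=
  sum_le_of_forall_le_one_div (fun i => rate_zero_le n n₁ n₂ i j) ⟨n₁, hn₁⟩ (by simp [rate, h])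

lemma norm_rateVec_zero_le (hn : 0 < n) : ‖rateVec (rate n n₁ n₂ 0)‖ ≤ 1 := by
  have hn' : (n : ℝ) ≠ 0 := by positivity
  refine (norm_le_mul_of_abs_apply_le (c := 1 / n) (by positivity) fun x => ?_).trans_eq
    (mul_one_div_cancel hn')
  rw [rateVec_apply, abs_of_nonneg (rate_zero_nonneg _ _ _ _ _)]
  exact rate_zero_le _ _ _ _ _

end Rates

section PortSpace

variable {n n₁ n₂ : ℕ}

/-- The saturated ports: the first `n₁` inputs and the first `n₂` outputs. -/
abbrev Port (n n₁ n₂ : ℕ) : Type := {i : Fin n // i.val < n₁} ⊕ {j : Fin n // j.val < n₂}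

/-- The indicator matrix of the queues of a saturated port. -/
def portVec (n n₁ n₂ : ℕ) : Port n n₁ n₂ → Vec n
  | .inl i => WithLp.toLp 2 fun x => if x.1 = i.1 then 1 else 0
  | .inr j => WithLp.toLp 2 fun x => if x.2 = j.1 then 1 else 0

/-- The span of the indicator matrices of the saturated ports. -/
def portSpace (n n₁ n₂ : ℕ) : Submodule ℝ (Vec n) := Submodule.span ℝ (Set.range (portVec n n₁ n₂))

lemma portVec_mem_portSpace (k : Port n n₁ n₂) : portVec n n₁ n₂ k ∈ portSpace n n₁ n₂ :=
  Submodule.subset_span ⟨k, rfl⟩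

lemma inner_portVec_inl (i : {i : Fin n // i.val < n₁}) (v : Vec n) :
    inner ℝ (portVec n n₁ n₂ (.inl i)) v = ∑ j, v (i.1, j) := by
  rw [inner_eq_sum_mul, Fintype.sum_prod_type, Finset.sum_eq_single i.1]
  · simp [portVec]
  · intro k _ hk; simp [portVec, hk]
  · simp

lemma inner_portVec_inr (j : {j : Fin n // j.val < n₂}) (v : Vec n) :
    inner ℝ (portVec n n₁ n₂ (.inr j)) v = ∑ i, v (i, j.1) := by
  rw [inner_eq_sum_mul, Fintype.sum_prod_type_right, Finset.sum_eq_single j.1]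
  · simp [portVec]
  · intro k _ hk; simp [portVec, hk]
  · simp

lemma sum_portVec (k : Port n n₁ n₂) : ∑ x, portVec n n₁ n₂ k x = n := by
  have hones : ∑ x, portVec n n₁ n₂ k x
      = inner ℝ (portVec n n₁ n₂ k) (WithLp.toLp 2 fun _ => (1 : ℝ)) := by
    simp [inner_eq_sum_mul]
  rw [hones]
  rcases k with i | j
  · simp [inner_portVec_inl]
  · simp [inner_portVec_inr]

lemma portVec_apply_nonneg (k : Port n n₁ n₂) (x) : 0 ≤ portVec n n₁ n₂ k x := by
  rcases k with i | j <;> simp only [portVec] <;> split_ifs <;> norm_num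

lemma apply_eq_zero_of_mem_portSpace {y : Vec n} (hy : y ∈ portSpace n n₁ n₂)
    {x : Fin n × Fin n} (h1 : n₁ ≤ x.1.val) (h2 : n₂ ≤ x.2.val) : y x = 0 := by
  induction hy using Submodule.span_induction with
  | mem v hv =>
    obtain ⟨i | j, rfl⟩ := hv
    · have : x.1 ≠ i.1 := fun h => absurd i.2 (by omega)
      simp [portVec, this]
    · have : x.2 ≠ j.1 := fun h => absurd j.2 (by omega)
      simp [portVec, this]
  | zero => rfl
  | add u v _ _ hu hv => simp [hu, hv]
  | smul c v _ hv => simp [hv]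

lemma inner_eq_sum_div_of_mem_portSpace (hn : 0 < n) {r : Vec n}
    (hr : ∀ k, inner ℝ (portVec n n₁ n₂ k) r = 1) {y : Vec n} (hy : y ∈ portSpace n n₁ n₂) :
    inner ℝ y r = (∑ x, y x) / n := by
  have hn' : (n : ℝ) ≠ 0 := by positivity
  induction hy using Submodule.span_induction with
  | mem v hv =>
    obtain ⟨k, rfl⟩ := hv
    rw [hr, sum_portVec, div_self hn']
  | zero => simp
  | add u v _ _ hu hv =>
    simp only [inner_add_left, hu, hv, PiLp.add_apply, Finset.sum_add_distrib, add_div]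
  | smul c v _ hv =>
    simp only [inner_smul_left, hv, PiLp.smul_apply, ← Finset.mul_sum, smul_eq_mul,
      RCLike.conj_to_real, mul_div_assoc]

lemma inner_rateVec_zero_of_mem_portSpace (hn : 0 < n) {y : Vec n} (hy : y ∈ portSpace n n₁ n₂) :
    inner ℝ y (rateVec (rate n n₁ n₂ 0)) = (∑ x, y x) / n := by
  refine inner_eq_sum_div_of_mem_portSpace hn (fun k => ?_) hy
  rcases k with i | j
  · rw [inner_portVec_inl]; exact (sum_rate_row i.2).trans (sub_zero 1)
  · rw [inner_portVec_inr]; exact (sum_rate_col j.2).trans (sub_zero 1)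

lemma inner_schedVec_of_mem_portSpace (hn : 0 < n) {s : Schedule n} (hs : s.IsMaximal) {y : Vec n}
    (hy : y ∈ portSpace n n₁ n₂) : inner ℝ y (schedVec s) = (∑ x, y x) / n := by
  refine inner_eq_sum_div_of_mem_portSpace hn (fun k => ?_) hy
  rcases k with i | j
  · rw [inner_portVec_inl]; simp only [schedVec_apply]; exact_mod_cast hs.1 i.1
  · rw [inner_portVec_inr]; simp only [schedVec_apply]; exact_mod_cast hs.2 j.1

end PortSpace

section PortCone

lemma exists_infDist_eq_norm_sub_of_isClosed {E : Type*} [NormedAddCommGroup E]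
    [InnerProductSpace ℝ E] [ProperSpace E] {K : PointedCone ℝ E} (hK : IsClosed (K : Set E))
    (v : E) : ∃ y ∈ K, Metric.infDist v K = ‖v - y‖ ∧ inner ℝ (v - y) y = 0 ∧
      ∀ k ∈ K, inner ℝ (v - y) k ≤ 0 := by
  obtain ⟨y, hy, hdist⟩ := hK.exists_infDist_eq_dist ⟨0, K.zero_mem⟩ v
  rw [dist_eq_norm] at hdist
  have hmin : ‖v - y‖ = ⨅ w : (K : Set E), ‖v - w‖ := by
    rw [← hdist, Metric.infDist_eq_iInf]
    simp only [dist_eq_norm]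
  have hobtuse := (norm_eq_iInf_iff_real_inner_le_zero K.toConvexCone.convex hy).1 hmin
  have hortho : inner ℝ (v - y) y = 0 := by
    have hzero := hobtuse 0 K.zero_mem
    have htwice := hobtuse (y + y) (K.add_mem hy hy)
    rw [add_sub_cancel_right] at htwice
    rw [zero_sub, inner_neg_right] at hzero
    linarith
  refine ⟨y, hy, hdist, hortho, fun k hk => ?_⟩
  have := hobtuse k hk
  rwa [inner_sub_right, hortho, sub_zero] at this

variable {n n₁ n₂ : ℕ}

/-- The cone of nonnegative matrices in the span of the saturated ports, onto which the queue
lengths collapse in heavy traffic. -/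
def portCone (n n₁ n₂ : ℕ) : PointedCone ℝ (Vec n) where
  carrier := {y | y ∈ portSpace n n₁ n₂ ∧ ∀ x, 0 ≤ y x}
  add_mem' hu hv := ⟨Submodule.add_mem _ hu.1 hv.1, fun x => add_nonneg (hu.2 x) (hv.2 x)⟩
  zero_mem' := ⟨Submodule.zero_mem _, fun _ => le_rfl⟩
  smul_mem' c _ hy := ⟨Submodule.smul_mem _ (c : ℝ) hy.1, fun x => mul_nonneg c.2 (hy.2 x)⟩

lemma isClosed_portCone : IsClosed (portCone n n₁ n₂ : Set (Vec n)) := by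
  have hspace : IsClosed (portSpace n n₁ n₂ : Set (Vec n)) :=
    Submodule.closed_of_finiteDimensional _
  have hnonneg : IsClosed {y : Vec n | ∀ x, 0 ≤ y x} := by
    simp only [Set.ofPred_forall]
    exact isClosed_iInter fun x => isClosed_le continuous_const (by fun_prop)
  exact hspace.inter hnonneg

lemma portVec_mem_portCone (k : Port n n₁ n₂) : portVec n n₁ n₂ k ∈ portCone n n₁ n₂ :=
  ⟨portVec_mem_portSpace k, portVec_apply_nonneg k⟩

lemma sum_add_le_one {f g : Fin n → ℝ} (hf : ∑ k, f k ≤ 1 - 1 / (2 * n))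
    (hg : ∀ k, g k ≤ 1 / (2 * n ^ 2)) : ∑ k, (f k + g k) ≤ 1 := by
  have hsum : ∑ k, g k ≤ n * (1 / (2 * (n : ℝ) ^ 2)) :=
    (Finset.sum_le_card_nsmul _ _ _ fun k _ => hg k).trans_eq (by simp)
  have hn : (n : ℝ) * (1 / (2 * (n : ℝ) ^ 2)) = 1 / (2 * n) := by
    rcases eq_or_ne (n : ℝ) 0 with h | h
    · simp [h]
    · field_simp
  rw [Finset.sum_add_distrib]
  linarith

-- The perturbed critical rates are still doubly substochastic: at a saturated port the
-- perturbation has nonpositive sum, and an unsaturated port has slack `1 / (2n)`.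
lemma inner_rateVec_zero_add_le_inner_schedVec (hn₁ : n₁ < n) (hn₂ : n₂ < n) {q : QueueMatrix n}
    {s : Schedule n} (hs : ∀ s' : Schedule n, s'.weight q ≤ s.weight q) {w : Vec n}
    (hw : ∀ x, |w x| ≤ 1 / (2 * n ^ 2)) (hport : ∀ k, inner ℝ (portVec n n₁ n₂ k) w ≤ 0) :
    inner ℝ (queueVec q) (rateVec (rate n n₁ n₂ 0) + w) ≤ inner ℝ (queueVec q) (schedVec s) := by
  have hn : (1 : ℝ) ≤ n := by exact_mod_cast (by omega : 1 ≤ n)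
  refine inner_queueVec_le_inner_schedVec hs (fun x => ?_) (fun i => ?_) fun j => ?_
  · have hsq : 1 / (2 * (n : ℝ) ^ 2) ≤ 1 / (2 * n) := by gcongr; nlinarith
    rw [PiLp.add_apply, rateVec_apply]
    linarith [(abs_le.1 (hw x)).1, le_rate_zero n n₁ n₂ x.1 x.2]
  · simp only [PiLp.add_apply, rateVec_apply]
    rcases lt_or_ge i.val n₁ with hi | hi
    · have hsum := hport (.inl ⟨i, hi⟩)
      rw [inner_portVec_inl] at hsum
      rw [Finset.sum_add_distrib, sum_rate_row hi]
      linarith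
    · exact sum_add_le_one (sum_rate_zero_row_le hn₂ hi) fun j => (le_abs_self _).trans (hw _)
  · simp only [PiLp.add_apply, rateVec_apply]
    rcases lt_or_ge j.val n₂ with hj | hj
    · have hsum := hport (.inr ⟨j, hj⟩)
      rw [inner_portVec_inr] at hsum
      rw [Finset.sum_add_distrib, sum_rate_col hj]
      linarith
    · exact sum_add_le_one (sum_rate_zero_col_le hn₁ hj) fun i => (le_abs_self _).trans (hw _)

lemma inner_rateVec_zero_add_norm_le_inner_schedVec (hn₁ : n₁ < n) (hn₂ : n₂ < n)
    {q : QueueMatrix n} {s : Schedule n} (hs : ∀ s' : Schedule n, s'.weight q ≤ s.weight q)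
    {z : Vec n} (hz : ∀ k, inner ℝ (portVec n n₁ n₂ k) z ≤ 0)
    (hqz : inner ℝ (queueVec q) z = ‖z‖ ^ 2) :
    inner ℝ (queueVec q) (rateVec (rate n n₁ n₂ 0)) + 1 / (2 * n ^ 2) * ‖z‖
      ≤ inner ℝ (queueVec q) (schedVec s) := by
  set δ : ℝ := 1 / (2 * n ^ 2)
  have hδ0 : 0 ≤ δ := by positivity
  have hscale : δ / ‖z‖ * ‖z‖ ^ 2 = δ * ‖z‖ := by
    rcases eq_or_ne ‖z‖ 0 with h | h
    · simp [h]
    · field_simp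
  have hsmall : ∀ x, |((δ / ‖z‖) • z : Vec n) x| ≤ δ := fun x => by
    rw [PiLp.smul_apply, smul_eq_mul, abs_mul, abs_of_nonneg (by positivity), div_mul_eq_mul_div]
    exact div_le_of_le_mul₀ (norm_nonneg _) hδ0
      (mul_le_mul_of_nonneg_left (abs_apply_le_norm z x) hδ0)
  have hport : ∀ k, inner ℝ (portVec n n₁ n₂ k) ((δ / ‖z‖) • z) ≤ 0 := fun k => by
    rw [inner_smul_right]
    exact mul_nonpos_of_nonneg_of_nonpos (by positivity) (hz k)
  have hmax := inner_rateVec_zero_add_le_inner_schedVec hn₁ hn₂ hs hsmall hport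
  rwa [inner_add_right, inner_smul_right, hqz, hscale] at hmax

end PortCone

section Drift

variable {n n₁ n₂ : ℕ}

lemma arrivalMean_norm_add_sq_le {lam : Fin n → Fin n → ℝ} (h0 : ∀ i j, 0 ≤ lam i j)
    (h1 : ∀ i j, lam i j ≤ 1) (q : QueueMatrix n) (s : Schedule n) {z : Vec n}
    (hz : ∀ a, inner ℝ z (unusedVec q a s) ≤ 0) :
    arrivalMean lam (fun a => ‖z + (queueVec (nextQueue q a s) - queueVec q)‖ ^ 2)
      ≤ ‖z‖ ^ 2 + 2 * (inner ℝ z (rateVec lam) - inner ℝ z (schedVec s)) + (n : ℝ) ^ 2 := by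
  refine (arrivalMean_mono h0 h1 (G := (2 : ℝ) • (fun a => inner ℝ z (arrVec a)) +
    fun _ => ‖z‖ ^ 2 - 2 * inner ℝ z (schedVec s) + (n : ℝ) ^ 2) fun a => ?_).trans_eq ?_
  · have hjump : ‖queueVec (nextQueue q a s) - queueVec q‖ ^ 2 ≤ (n : ℝ) ^ 2 :=
      pow_le_pow_left₀ (norm_nonneg _) (norm_queueVec_nextQueue_sub_le q a s) 2
    have hinner : inner ℝ z (queueVec (nextQueue q a s) - queueVec q)
        = inner ℝ z (arrVec a) - inner ℝ z (schedVec s) + inner ℝ z (unusedVec q a s) := by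
      rw [queueVec_nextQueue, ← inner_sub_right, ← inner_add_right]
      congr 1; abel
    rw [norm_add_sq_real, hinner]
    simp only [Pi.add_apply, Pi.smul_apply, smul_eq_mul]
    linarith [hz a]
  · rw [map_add, map_smul, arrivalMean_const, arrivalMean_inner_arrVec, smul_eq_mul]
    ring

/-- The distance of the queue lengths from the cone of state space collapse. -/
def coneDist (n₁ n₂ : ℕ) (q : QueueMatrix n) : ℝ := Metric.infDist (queueVec q) (portCone n n₁ n₂)

lemma coneDist_nonneg (q : QueueMatrix n) : 0 ≤ coneDist n₁ n₂ q := Metric.infDist_nonneg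

lemma abs_coneDist_nextQueue_sub_le (q : QueueMatrix n) (a : Fin n → Fin n → Bool)
    (s : Schedule n) : |coneDist n₁ n₂ (nextQueue q a s) - coneDist n₁ n₂ q| ≤ n :=
  ((Metric.lipschitz_infDist_pt _).dist_le_mul _ _).trans
    (by simpa [dist_eq_norm] using norm_queueVec_nextQueue_sub_le q a s)

-- The component along the cone cancels: a maximal schedule and the critical rates have the same
-- inner product with every element of the port space.
lemma inner_rateVec_sub_inner_schedVec_le (hn₁ : n₁ < n) (hn₂ : n₂ < n) {ε : ℝ} (hε : 0 ≤ ε)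
    (hε1 : ε ≤ 1 / (4 * n ^ 2)) {q : QueueMatrix n} {s : Schedule n} (hm : s.IsMaximal)
    (hs : ∀ s' : Schedule n, s'.weight q ≤ s.weight q) {y : Vec n} (hy : y ∈ portSpace n n₁ n₂)
    (hortho : inner ℝ (queueVec q - y) y = 0)
    (hpolar : ∀ k, inner ℝ (portVec n n₁ n₂ k) (queueVec q - y) ≤ 0) :
    inner ℝ (queueVec q - y) (rateVec (rate n n₁ n₂ ε)) - inner ℝ (queueVec q - y) (schedVec s)
      ≤ -(1 / (4 * n ^ 2) * ‖queueVec q - y‖) := by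
  have hn : 0 < n := by omega
  set z := queueVec q - y
  have hqzy : queueVec q = z + y := (sub_add_cancel _ _).symm
  have hqz : inner ℝ (queueVec q) z = ‖z‖ ^ 2 := by
    rw [hqzy, inner_add_left, real_inner_self_eq_norm_sq, real_inner_comm, hortho, add_zero]
  have hweight := inner_rateVec_zero_add_norm_le_inner_schedVec hn₁ hn₂ hs hpolar hqz
  rw [hqzy, inner_add_left, inner_add_left, inner_rateVec_zero_of_mem_portSpace hn hy,
    inner_schedVec_of_mem_portSpace hn hm hy] at hweight
  have hcs : -‖z‖ ≤ inner ℝ z (rateVec (rate n n₁ n₂ 0)) := by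
    have hle := (abs_real_inner_le_norm z (rateVec (rate n n₁ n₂ 0))).trans
      (mul_le_of_le_one_right (norm_nonneg z) (norm_rateVec_zero_le hn))
    exact (abs_le.1 hle).1
  have hεz : ε * ‖z‖ ≤ 1 / (4 * n ^ 2) * ‖z‖ := by gcongr
  have hhalf : 1 / (2 * (n : ℝ) ^ 2) = 2 * (1 / (4 * n ^ 2)) := by ring
  rw [rateVec_rate, inner_smul_right]
  rw [hhalf] at hweight
  linarith [mul_le_mul_of_nonneg_left hcs hε]

theorem arrivalMean_coneDist_sq_le (hn₁ : n₁ < n) (hn₂ : n₂ < n) {ε : ℝ} (hε : 0 ≤ ε)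
    (hε1 : ε ≤ 1 / (4 * n ^ 2)) {q : QueueMatrix n} {s : Schedule n} (hm : s.IsMaximal)
    (hs : ∀ s' : Schedule n, s'.weight q ≤ s.weight q) :
    arrivalMean (rate n n₁ n₂ ε) (fun a => coneDist n₁ n₂ (nextQueue q a s) ^ 2)
      ≤ coneDist n₁ n₂ q ^ 2 - 1 / (2 * n ^ 2) * coneDist n₁ n₂ q + (n : ℝ) ^ 2 := by
  have hn : (1 : ℝ) ≤ n := by exact_mod_cast (by omega : 1 ≤ n)
  have hε2 : ε ≤ 1 := hε1.trans ((div_le_one (by positivity)).2 (by nlinarith))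
  obtain ⟨y, hy, hdist, hortho, hpolar⟩ :=
    exists_infDist_eq_norm_sub_of_isClosed (isClosed_portCone (n₁ := n₁) (n₂ := n₂)) (queueVec q)
  have hunused : ∀ a, inner ℝ (queueVec q - y) (unusedVec q a s) ≤ 0 := fun a => by
    rw [inner_sub_left, inner_queueVec_unusedVec, zero_sub, neg_nonpos, inner_eq_sum_mul]
    exact Finset.sum_nonneg fun x _ => mul_nonneg (hy.2 x) (unusedVec_apply_nonneg q a s x)
  have hdrift := inner_rateVec_sub_inner_schedVec_le hn₁ hn₂ hε hε1 hm hs hy.1 hortho fun k => by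
    rw [real_inner_comm]; exact hpolar _ (portVec_mem_portCone k)
  rw [← hdist] at hdrift
  calc arrivalMean (rate n n₁ n₂ ε) (fun a => coneDist n₁ n₂ (nextQueue q a s) ^ 2)
      ≤ arrivalMean (rate n n₁ n₂ ε)
          (fun a => ‖queueVec q - y + (queueVec (nextQueue q a s) - queueVec q)‖ ^ 2) := by
        refine arrivalMean_mono (rate_nonneg hε2) (rate_le_one hε hε2) fun a =>
          pow_le_pow_left₀ (coneDist_nonneg _) ?_ 2
        refine (Metric.infDist_le_dist_of_mem hy).trans_eq ?_
        rw [dist_eq_norm]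
        congr 1; abel
    _ ≤ _ := arrivalMean_norm_add_sq_le (rate_nonneg hε2) (rate_le_one hε hε2) q s hunused
    _ ≤ _ := by
        have hhalf : 1 / (2 * (n : ℝ) ^ 2) = 2 * (1 / (4 * n ^ 2)) := by ring
        rw [← hdist, hhalf]
        simp only [coneDist]
        linarith

theorem arrivalMean_norm_sq_le (hn₁ : n₁ < n) (hn₂ : n₂ < n) {ε : ℝ} (hε : 0 ≤ ε)
    (hε1 : ε ≤ 1) {q : QueueMatrix n} {s : Schedule n}
    (hs : ∀ s' : Schedule n, s'.weight q ≤ s.weight q) :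
    arrivalMean (rate n n₁ n₂ ε) (fun a => ‖queueVec (nextQueue q a s)‖ ^ 2)
      ≤ ‖queueVec q‖ ^ 2 - ε / n * ‖queueVec q‖ + (n : ℝ) ^ 2 := by
  have hweight := inner_rateVec_zero_add_le_inner_schedVec (n₁ := n₁) (n₂ := n₂) hn₁ hn₂ hs
    (w := 0) (fun x => by simp) (by simp)
  rw [add_zero] at hweight
  have hload : 1 / (2 * n) * ‖queueVec q‖ ≤ inner ℝ (queueVec q) (rateVec (rate n n₁ n₂ 0)) := by
    refine (mul_le_mul_of_nonneg_left (norm_queueVec_le_sum q) (by positivity)).trans ?_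
    rw [inner_eq_sum_mul, Finset.mul_sum]
    refine Finset.sum_le_sum fun x _ => ?_
    rw [mul_comm]
    exact mul_le_mul_of_nonneg_left (le_rate_zero _ _ _ _ _) (Nat.cast_nonneg _)
  have hεload := mul_le_mul_of_nonneg_left hload hε
  have hn : ε * (1 / (2 * n) * ‖queueVec q‖) = ε / n * ‖queueVec q‖ / 2 := by ring
  have hdrift := arrivalMean_norm_add_sq_le (rate_nonneg (n₁ := n₁) (n₂ := n₂) hε1)
    (rate_le_one hε hε1) q s (z := queueVec q) fun a => (inner_queueVec_unusedVec q a s).le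
  simp only [add_sub_cancel] at hdrift
  rw [rateVec_rate, inner_smul_right] at hdrift
  linarith

lemma pow_three_le_of_abs_sub_le {x y B : ℝ} (hx : 0 ≤ x) (hB : |y - x| ≤ B) :
    y ^ 3 ≤ 3 / 2 * x * y ^ 2 + (3 / 2 * x * B ^ 2 + B ^ 3 - 1 / 2 * x ^ 3) := by
  obtain ⟨t, rfl⟩ : ∃ t, y = x + t := ⟨y - x, by ring⟩
  rw [add_sub_cancel_left] at hB
  have ht2 : t ^ 2 ≤ B ^ 2 := sq_le_sq.2 (hB.trans (le_abs_self B))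
  have ht3 : t ^ 3 ≤ B ^ 3 := (Odd.strictMono_pow (by decide)).monotone ((le_abs_self t).trans hB)
  nlinarith [mul_le_mul_of_nonneg_left ht2 hx]

lemma arrivalMean_pow_three_le {lam : Fin n → Fin n → ℝ} (h0 : ∀ i j, 0 ≤ lam i j)
    (h1 : ∀ i j, lam i j ≤ 1) {x B δ C : ℝ} {y : (Fin n → Fin n → Bool) → ℝ} (hx : 0 ≤ x)
    (hδ : 0 < δ) (hB : ∀ a, |y a - x| ≤ B)
    (h : arrivalMean lam (fun a => y a ^ 2) ≤ x ^ 2 - δ * x + C) :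
    arrivalMean lam (fun a => y a ^ 3)
      ≤ x ^ 3 - δ * x ^ 2 + ((3 / 2 * (C + B ^ 2)) ^ 2 / (2 * δ) + B ^ 3) := by
  have hcube := arrivalMean_mono h0 h1 (F := fun a => y a ^ 3)
    (G := (3 / 2 * x) • (fun a => y a ^ 2) +
      fun _ => 3 / 2 * x * B ^ 2 + B ^ 3 - 1 / 2 * x ^ 3)
    fun a => pow_three_le_of_abs_sub_le hx (hB a)
  rw [map_add, map_smul, arrivalMean_const, smul_eq_mul] at hcube
  have hsq := mul_le_mul_of_nonneg_left h (by positivity : 0 ≤ 3 / 2 * x)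
  set D := 3 / 2 * (C + B ^ 2) with hD
  have hyoung : D * x ≤ δ / 2 * x ^ 2 + D ^ 2 / (2 * δ) := by
    have hgap : δ / 2 * x ^ 2 + D ^ 2 / (2 * δ) - D * x = (δ * x - D) ^ 2 / (2 * δ) := by
      field_simp; ring
    exact sub_nonneg.1 (hgap ▸ by positivity)
  have hDx : 3 / 2 * x * C + 3 / 2 * x * B ^ 2 = D * x := by rw [hD]; ring
  nlinarith

end Drift

section Projection

variable {n n₁ n₂ : ℕ}

/-- The orthogonal projection to the span of the saturated ports. -/
def portProj (n n₁ n₂ : ℕ) : Vec n →L[ℝ] Vec n := (portSpace n n₁ n₂).starProjection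

lemma portProj_mem_portSpace (v : Vec n) : portProj n n₁ n₂ v ∈ portSpace n n₁ n₂ :=
  Submodule.starProjection_apply_mem _ _

lemma portProj_apply_eq_zero (v : Vec n) {x : Fin n × Fin n}
    (h : ¬(x.1.val < n₁ ∨ x.2.val < n₂)) : portProj n n₁ n₂ v x = 0 :=
  apply_eq_zero_of_mem_portSpace (portProj_mem_portSpace v) (by omega) (by omega)

lemma inner_portProj_comm (v w : Vec n) :
    inner ℝ (portProj n n₁ n₂ v) w = inner ℝ v (portProj n n₁ n₂ w) :=
  Submodule.inner_starProjection_left_eq_right _ v w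

lemma inner_portProj_portProj (v w : Vec n) :
    inner ℝ (portProj n n₁ n₂ v) (portProj n n₁ n₂ w) = inner ℝ (portProj n n₁ n₂ v) w := by
  rw [← inner_portProj_comm, portProj,
    Submodule.starProjection_eq_self_iff.2 (Submodule.starProjection_apply_mem _ _)]

lemma inner_portProj_self (v : Vec n) :
    inner ℝ (portProj n n₁ n₂ v) v = ‖portProj n n₁ n₂ v‖ ^ 2 := by
  rw [← inner_portProj_portProj, real_inner_self_eq_norm_sq]

lemma norm_sub_portProj_le_coneDist (q : QueueMatrix n) :
    ‖queueVec q - portProj n n₁ n₂ (queueVec q)‖ ≤ coneDist n₁ n₂ q := by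
  obtain ⟨y, hy, hdist, -⟩ :=
    exists_infDist_eq_norm_sub_of_isClosed (isClosed_portCone (n₁ := n₁) (n₂ := n₂)) (queueVec q)
  rw [coneDist, hdist, portProj, Submodule.starProjection_minimal]
  exact ciInf_le (f := fun x : portSpace n n₁ n₂ => ‖queueVec q - x‖)
    ⟨0, by rintro _ ⟨x, rfl⟩; exact norm_nonneg _⟩ ⟨y, hy.1⟩

lemma linearIndependent_portVec (hn₁ : n₁ < n) (hn₂ : n₂ < n) :
    LinearIndependent ℝ (portVec n n₁ n₂) := by
  rw [Fintype.linearIndependent_iff]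
  intro g hg
  have hentry : ∀ x : Fin n × Fin n, ∑ k, g k * portVec n n₁ n₂ k x = 0 := fun x => by
    simpa using congrArg (fun v : Vec n => v x) hg
  simp only [Fintype.sum_sum_type] at hentry
  rintro (i | j)
  · have hcol : ∀ j : {j : Fin n // j.val < n₂}, (⟨n₂, hn₂⟩ : Fin n) ≠ j.1 := fun j hj =>
      absurd j.2 (by simp [← hj])
    simpa [portVec, hcol, ← Subtype.ext_iff] using hentry (i.1, ⟨n₂, hn₂⟩)
  · have hrow : ∀ i : {i : Fin n // i.val < n₁}, (⟨n₁, hn₁⟩ : Fin n) ≠ i.1 := fun i hi =>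
      absurd i.2 (by simp [← hi])
    simpa [portVec, hrow, ← Subtype.ext_iff] using hentry (⟨n₁, hn₁⟩, j.1)

lemma card_fin_val_lt {m : ℕ} (h : m ≤ n) : Fintype.card {i : Fin n // i.val < m} = m := by
  rw [Fintype.card_subtype, Fin.card_filter_val_lt, min_eq_right h]

lemma card_port (hn₁ : n₁ ≤ n) (hn₂ : n₂ ≤ n) : Fintype.card (Port n n₁ n₂) = n₁ + n₂ := by
  rw [Fintype.card_sum, card_fin_val_lt hn₁, card_fin_val_lt hn₂]

lemma sum_portProj_single (hn₁ : n₁ < n) (hn₂ : n₂ < n) :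
    ∑ x, portProj n n₁ n₂ (EuclideanSpace.single x 1) x = n₁ + n₂ := by
  have hproj : LinearMap.IsProj (portSpace n n₁ n₂) (portProj n n₁ n₂ : Vec n →ₗ[ℝ] Vec n) :=
    ⟨portProj_mem_portSpace, fun v hv => Submodule.starProjection_eq_self_iff.2 hv⟩
  have htrace := hproj.trace
  rw [LinearMap.trace_eq_sum_inner _ (EuclideanSpace.basisFun (Fin n × Fin n) ℝ), portSpace,
    finrank_span_eq_card (linearIndependent_portVec hn₁ hn₂), card_port hn₁.le hn₂.le] at htrace
  simpa [EuclideanSpace.inner_single_left] using htrace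

lemma norm_portProj_sq (v : Vec n) :
    ‖portProj n n₁ n₂ v‖ ^ 2
      = ∑ x, ∑ y, portProj n n₁ n₂ (EuclideanSpace.single y 1) x * (v x * v y) := by
  have hexpand : v = ∑ y, v y • EuclideanSpace.single y (1 : ℝ) := by
    simpa using ((EuclideanSpace.basisFun (Fin n × Fin n) ℝ).sum_repr v).symm
  have hentry : ∀ x, portProj n n₁ n₂ v x
      = ∑ y, v y * portProj n n₁ n₂ (EuclideanSpace.single y 1) x := fun x => by
    conv_lhs => rw [hexpand, map_sum]
    simp
  rw [← inner_portProj_self, inner_eq_sum_mul]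
  refine Finset.sum_congr rfl fun x _ => ?_
  rw [hentry, Finset.sum_mul]
  exact Finset.sum_congr rfl fun y _ => by ring

/-- The variance of a Bernoulli arrival at a saturated port. -/
def satVariance (n : ℕ) (ε : ℝ) : ℝ := (1 - ε) / n * (1 - (1 - ε) / n)

lemma arrivalMean_norm_portProj_arrVec_sub_sq (hn₁ : n₁ < n) (hn₂ : n₂ < n) (ε : ℝ) :
    arrivalMean (rate n n₁ n₂ ε)
        (fun a => ‖portProj n n₁ n₂ (arrVec a - rateVec (rate n n₁ n₂ ε))‖ ^ 2)
      = satVariance n ε * (n₁ + n₂) := by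
  simp only [norm_portProj_sq, PiLp.sub_apply, arrVec_apply, rateVec_apply]
  rw [arrivalMean_quadratic _ fun x y => portProj n n₁ n₂ (EuclideanSpace.single y 1) x,
    ← sum_portProj_single hn₁ hn₂, Finset.mul_sum]
  refine Finset.sum_congr rfl fun x _ => ?_
  by_cases h : x.1.val < n₁ ∨ x.2.val < n₂
  · rw [rate_of_saturated h, satVariance, mul_comm]
  · rw [portProj_apply_eq_zero _ h]; ring

lemma portProj_rateVec_zero (hn : 0 < n) {s : Schedule n} (hs : s.IsMaximal) :
    portProj n n₁ n₂ (rateVec (rate n n₁ n₂ 0)) = portProj n n₁ n₂ (schedVec s) := by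
  rw [← sub_eq_zero, ← map_sub, ← norm_eq_zero, ← sq_eq_zero_iff, ← inner_portProj_self,
    inner_sub_right, inner_rateVec_zero_of_mem_portSpace hn (portProj_mem_portSpace _),
    inner_schedVec_of_mem_portSpace hn hs (portProj_mem_portSpace _), sub_self]

/-- The second moment of the projected net arrivals. -/
def netVariance (n n₁ n₂ : ℕ) (ε : ℝ) : ℝ :=
  satVariance n ε * (n₁ + n₂) + ε ^ 2 * ‖portProj n n₁ n₂ (rateVec (rate n n₁ n₂ 0))‖ ^ 2

theorem arrivalMean_norm_portProj_net_sq (hn₁ : n₁ < n) (hn₂ : n₂ < n) (ε : ℝ) {s : Schedule n}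
    (hs : s.IsMaximal) :
    arrivalMean (rate n n₁ n₂ ε) (fun a => ‖portProj n n₁ n₂ (arrVec a - schedVec s)‖ ^ 2)
      = netVariance n n₁ n₂ ε := by
  set lam := rate n n₁ n₂ ε with hlam
  set P := portProj n n₁ n₂ with hP
  set w := P (rateVec (rate n n₁ n₂ 0)) with hw
  have hnet : ∀ a, P (arrVec a - schedVec s) = P (arrVec a - rateVec lam) - ε • w := fun a => by
    rw [map_sub, map_sub, hlam, rateVec_rate, ← portProj_rateVec_zero (by omega) hs, map_smul,
      ← hP, ← hw]
    module
  have hcross : ∀ a, inner ℝ (P (arrVec a - rateVec lam)) w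
      = inner ℝ w (arrVec a) - inner ℝ w (rateVec lam) := fun a => by
    rw [real_inner_comm, hw, hP, inner_portProj_portProj, inner_sub_right]
  have hexpand : (fun a : Fin n → Fin n → Bool => ‖P (arrVec a - schedVec s)‖ ^ 2)
      = (fun a => ‖P (arrVec a - rateVec lam)‖ ^ 2)
        + ((-(2 * ε)) • (fun a => inner ℝ w (arrVec a))
          + fun _ => 2 * ε * inner ℝ w (rateVec lam) + ε ^ 2 * ‖w‖ ^ 2) := by
    funext a
    rw [hnet, norm_sub_sq_real, inner_smul_right, hcross, norm_smul, mul_pow, Real.norm_eq_abs,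
      sq_abs]
    simp only [Pi.add_apply, Pi.smul_apply, smul_eq_mul]
    ring
  rw [hexpand, map_add, map_add, map_smul, arrivalMean_norm_portProj_arrVec_sub_sq hn₁ hn₂,
    arrivalMean_inner_arrVec, arrivalMean_const, netVariance, smul_eq_mul]
  ring

end Projection

section PortUnused

variable {n n₁ n₂ : ℕ}

/-- The matrix whose entries count the saturated ports that a queue belongs to. -/
def portSum (n n₁ n₂ : ℕ) : Vec n := ∑ k, portVec n n₁ n₂ k

lemma portSum_mem_portSpace : portSum n n₁ n₂ ∈ portSpace n n₁ n₂ :=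
  Submodule.sum_mem _ fun k _ => portVec_mem_portSpace k

lemma portSum_apply (x : Fin n × Fin n) :
    portSum n n₁ n₂ x = ∑ k, portVec n n₁ n₂ k x := by
  simp [portSum]

lemma portSum_apply_nonneg (x : Fin n × Fin n) : 0 ≤ portSum n n₁ n₂ x := by
  rw [portSum_apply]; exact Finset.sum_nonneg fun k _ => portVec_apply_nonneg k x

lemma one_le_portSum_apply {x : Fin n × Fin n} (h : x.1.val < n₁ ∨ x.2.val < n₂) :
    1 ≤ portSum n n₁ n₂ x := by
  have hsingle := fun k => Finset.single_le_sum (f := fun k => portVec n n₁ n₂ k x)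
    (fun k _ => portVec_apply_nonneg k x) (Finset.mem_univ k)
  rw [portSum_apply]
  rcases h with h | h
  · simpa [portVec] using hsingle (.inl ⟨x.1, h⟩)
  · simpa [portVec] using hsingle (.inr ⟨x.2, h⟩)

lemma sum_portSum (hn₁ : n₁ ≤ n) (hn₂ : n₂ ≤ n) :
    ∑ x, portSum n n₁ n₂ x = n * (n₁ + n₂) := by
  simp only [portSum_apply]
  rw [Finset.sum_comm]
  simp only [sum_portVec, Finset.sum_const, Finset.card_univ, card_port hn₁ hn₂, nsmul_eq_mul]
  push_cast; ring

/-- The unused service at the saturated ports. -/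
def portUnused (n₁ n₂ : ℕ) (q : QueueMatrix n) (a : Fin n → Fin n → Bool) (s : Schedule n) : ℝ :=
  inner ℝ (portSum n n₁ n₂) (unusedVec q a s)

theorem inner_portSum_add_arrivalMean_portUnused (hn₁ : n₁ < n) (hn₂ : n₂ < n) (ε : ℝ)
    (q : QueueMatrix n) {s : Schedule n} (hs : s.IsMaximal) :
    inner ℝ (portSum n n₁ n₂) (queueVec q)
        + arrivalMean (rate n n₁ n₂ ε) (fun a => portUnused n₁ n₂ q a s)
      = arrivalMean (rate n n₁ n₂ ε)
          (fun a => inner ℝ (portSum n n₁ n₂) (queueVec (nextQueue q a s))) + ε * (n₁ + n₂) := by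
  have hn : 0 < n := by omega
  have hn' : (n : ℝ) ≠ 0 := by positivity
  have hexpand : (fun a => inner ℝ (portSum n n₁ n₂) (queueVec (nextQueue q a s)))
      = (fun a => inner ℝ (portSum n n₁ n₂) (arrVec a)) + ((fun a => portUnused n₁ n₂ q a s)
        + fun _ => inner ℝ (portSum n n₁ n₂) (queueVec q)
            - inner ℝ (portSum n n₁ n₂) (schedVec s)) := by
    funext a
    rw [queueVec_nextQueue, inner_add_right, inner_sub_right, inner_add_right]
    simp only [Pi.add_apply, portUnused]
    ring
  rw [hexpand, map_add, map_add, arrivalMean_inner_arrVec, arrivalMean_const, rateVec_rate,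
    inner_smul_right, inner_rateVec_zero_of_mem_portSpace hn portSum_mem_portSpace,
    inner_schedVec_of_mem_portSpace hn hs portSum_mem_portSpace, sum_portSum hn₁.le hn₂.le]
  field_simp
  ring

lemma abs_two_mul_mul_le {η u : ℝ} (hη : 0 < η) (hu : u ^ 2 = u) (y : ℝ) :
    |2 * (y * u)| ≤ η * y ^ 2 + 1 / η * u := by
  have hyoung : ∀ z : ℝ, 2 * (z * u) ≤ η * z ^ 2 + 1 / η * u := fun z => by
    have hsquare : η * z ^ 2 + 1 / η * u ^ 2 - 2 * (z * u) = (η * z - u) ^ 2 / η := by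
      field_simp; ring
    have : 0 ≤ (η * z - u) ^ 2 / η := by positivity
    rw [hu] at hsquare
    linarith
  have hneg := hyoung (-y)
  rw [neg_sq] at hneg
  exact abs_le.2 ⟨by linarith, hyoung y⟩

lemma unusedVec_apply_le_portSum_mul {x : Fin n × Fin n} (h : x.1.val < n₁ ∨ x.2.val < n₂)
    (q : QueueMatrix n) (a : Fin n → Fin n → Bool) (s : Schedule n) :
    unusedVec q a s x ≤ portSum n n₁ n₂ x * unusedVec q a s x :=
  le_mul_of_one_le_left (unusedVec_apply_nonneg q a s x) (one_le_portSum_apply h)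

lemma abs_two_mul_inner_unusedVec_le {η : ℝ} (hη : 0 < η) (q : QueueMatrix n)
    (a : Fin n → Fin n → Bool) (s : Schedule n) {w y : Vec n}
    (hw : ∀ x, ¬(x.1.val < n₁ ∨ x.2.val < n₂) → w x = 0)
    (hwy : ∀ x, |w x * unusedVec q a s x| = |y x * unusedVec q a s x|) :
    |2 * inner ℝ w (unusedVec q a s)| ≤ η * ‖y‖ ^ 2 + 1 / η * portUnused n₁ n₂ q a s := by
  rw [EuclideanSpace.real_norm_sq_eq, portUnused, inner_eq_sum_mul, inner_eq_sum_mul,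
    Finset.mul_sum, Finset.mul_sum, Finset.mul_sum, ← Finset.sum_add_distrib]
  refine (Finset.abs_sum_le_sum_abs _ _).trans (Finset.sum_le_sum fun x _ => ?_)
  by_cases h : x.1.val < n₁ ∨ x.2.val < n₂
  · rw [abs_mul, hwy, ← abs_mul]
    refine (abs_two_mul_mul_le hη (unusedVec_apply_sq q a s x) _).trans ?_
    gcongr
    exact unusedVec_apply_le_portSum_mul h q a s
  · have := mul_nonneg (portSum_apply_nonneg (n₁ := n₁) (n₂ := n₂) x)
      (unusedVec_apply_nonneg q a s x)
    rw [hw x h, zero_mul, mul_zero, abs_zero]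
    positivity

lemma norm_portProj_unusedVec_sq_le (q : QueueMatrix n) (a : Fin n → Fin n → Bool)
    (s : Schedule n) : ‖portProj n n₁ n₂ (unusedVec q a s)‖ ^ 2 ≤ portUnused n₁ n₂ q a s := by
  have hinner := abs_two_mul_inner_unusedVec_le one_pos q a s
    (fun x => portProj_apply_eq_zero (n₁ := n₁) (n₂ := n₂) (unusedVec q a s)) fun _ => rfl
  rw [inner_portProj_self, abs_of_nonneg (by positivity)] at hinner
  linarith

-- Complementary slackness: where there is unused service the queue empties, so that its projected
-- length is minus its component orthogonal to the ports.
lemma abs_inner_portProj_unusedVec_le {η : ℝ} (hη : 0 < η) (q : QueueMatrix n)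
    (a : Fin n → Fin n → Bool) (s : Schedule n) :
    |2 * inner ℝ (portProj n n₁ n₂ (queueVec (nextQueue q a s))) (unusedVec q a s)|
      ≤ η * coneDist n₁ n₂ (nextQueue q a s) ^ 2 + 1 / η * portUnused n₁ n₂ q a s := by
  set v := queueVec (nextQueue q a s) with hv
  refine (abs_two_mul_inner_unusedVec_le (y := v - portProj n n₁ n₂ v) hη q a s
    (fun x => portProj_apply_eq_zero v) fun x => ?_).trans ?_
  · rw [PiLp.sub_apply, sub_mul, hv, queueVec_nextQueue_mul_unusedVec, zero_sub, abs_neg]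
  · gcongr
    exact norm_sub_portProj_le_coneDist _

end PortUnused

section ProjectionDrift

variable {n n₁ n₂ : ℕ}

lemma abs_sum_portProj_sub_le (q : QueueMatrix n) :
    |∑ x, portProj n n₁ n₂ (queueVec q) x - ∑ x, queueVec q x| ≤ n ^ 2 * coneDist n₁ n₂ q := by
  rw [← Finset.sum_sub_distrib]
  calc |∑ x, (portProj n n₁ n₂ (queueVec q) x - queueVec q x)|
      ≤ ∑ x, |portProj n n₁ n₂ (queueVec q) x - queueVec q x| := Finset.abs_sum_le_sum_abs _ _
    _ ≤ ∑ _x : Fin n × Fin n, coneDist n₁ n₂ q := Finset.sum_le_sum fun x _ => by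
        rw [abs_sub_comm]
        exact (abs_apply_le_norm (queueVec q - portProj n n₁ n₂ (queueVec q)) x).trans
          (norm_sub_portProj_le_coneDist q)
    _ = _ := by simp [sq]

lemma abs_arrivalMean_le {lam : Fin n → Fin n → ℝ} (h0 : ∀ i j, 0 ≤ lam i j)
    (h1 : ∀ i j, lam i j ≤ 1) {F G : (Fin n → Fin n → Bool) → ℝ} (h : ∀ a, |F a| ≤ G a) :
    |arrivalMean lam F| ≤ arrivalMean lam G := by
  refine abs_le.2 ⟨?_, arrivalMean_mono h0 h1 fun a => (le_abs_self _).trans (h a)⟩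
  rw [← map_neg]
  exact arrivalMean_mono h0 h1 fun a => (neg_le_neg (h a)).trans (neg_abs_le _)

/-- The effect of the unused service on the squared norm of the projected queue lengths. -/
def unusedError (n₁ n₂ : ℕ) (q : QueueMatrix n) (a : Fin n → Fin n → Bool) (s : Schedule n) : ℝ :=
  2 * inner ℝ (portProj n n₁ n₂ (queueVec (nextQueue q a s))) (unusedVec q a s)
    - ‖portProj n n₁ n₂ (unusedVec q a s)‖ ^ 2

lemma abs_unusedError_le {η : ℝ} (hη : 0 < η) (q : QueueMatrix n) (a : Fin n → Fin n → Bool)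
    (s : Schedule n) : |unusedError n₁ n₂ q a s|
      ≤ η * coneDist n₁ n₂ (nextQueue q a s) ^ 2 + (1 / η + 1) * portUnused n₁ n₂ q a s := by
  refine (abs_sub _ _).trans ?_
  rw [abs_of_nonneg (sq_nonneg ‖portProj n n₁ n₂ (unusedVec q a s)‖)]
  linarith [abs_inner_portProj_unusedVec_le (n₁ := n₁) (n₂ := n₂) hη q a s,
    norm_portProj_unusedVec_sq_le (n₁ := n₁) (n₂ := n₂) q a s]

lemma norm_portProj_nextQueue_sq (q : QueueMatrix n) (a : Fin n → Fin n → Bool) (s : Schedule n) :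
    ‖portProj n n₁ n₂ (queueVec (nextQueue q a s))‖ ^ 2
      = unusedError n₁ n₂ q a s + (2 * inner ℝ (portProj n n₁ n₂ (queueVec q)) (arrVec a)
        + (‖portProj n n₁ n₂ (arrVec a - schedVec s)‖ ^ 2
          + (‖portProj n n₁ n₂ (queueVec q)‖ ^ 2
            - 2 * inner ℝ (portProj n n₁ n₂ (queueVec q)) (schedVec s)))) := by
  have hsplit : portProj n n₁ n₂ (queueVec (nextQueue q a s)) - portProj n n₁ n₂ (unusedVec q a s)
      = portProj n n₁ n₂ (queueVec q) + portProj n n₁ n₂ (arrVec a - schedVec s) := by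
    rw [← map_sub, ← map_add, queueVec_nextQueue]
    congr 1; abel
  have hsq := congrArg (fun w => ‖w‖ ^ 2) hsplit
  simp only [norm_sub_sq_real, norm_add_sq_real] at hsq
  rw [inner_portProj_portProj, inner_portProj_portProj, inner_sub_right] at hsq
  rw [unusedError]
  linarith

lemma arrivalMean_norm_portProj_nextQueue_sq (hn₁ : n₁ < n) (hn₂ : n₂ < n) (ε : ℝ)
    (q : QueueMatrix n) {s : Schedule n} (hs : s.IsMaximal) :
    arrivalMean (rate n n₁ n₂ ε) (fun a => ‖portProj n n₁ n₂ (queueVec (nextQueue q a s))‖ ^ 2)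
      = arrivalMean (rate n n₁ n₂ ε) (fun a => unusedError n₁ n₂ q a s)
        - 2 * ε / n * ∑ x, portProj n n₁ n₂ (queueVec q) x
        + (‖portProj n n₁ n₂ (queueVec q)‖ ^ 2 + netVariance n n₁ n₂ ε) := by
  have hn : 0 < n := by omega
  set p := portProj n n₁ n₂ (queueVec q)
  have hexpand : (fun a => ‖portProj n n₁ n₂ (queueVec (nextQueue q a s))‖ ^ 2)
      = (fun a => unusedError n₁ n₂ q a s) + ((2 : ℝ) • (fun a => inner ℝ p (arrVec a))
        + ((fun a => ‖portProj n n₁ n₂ (arrVec a - schedVec s)‖ ^ 2)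
          + fun _ => ‖p‖ ^ 2 - 2 * inner ℝ p (schedVec s))) :=
    funext fun a => norm_portProj_nextQueue_sq q a s
  rw [hexpand, map_add, map_add, map_add, map_smul, arrivalMean_inner_arrVec,
    arrivalMean_norm_portProj_net_sq hn₁ hn₂ ε hs, arrivalMean_const, smul_eq_mul, rateVec_rate,
    inner_smul_right, inner_rateVec_zero_of_mem_portSpace hn (portProj_mem_portSpace _),
    inner_schedVec_of_mem_portSpace hn hs (portProj_mem_portSpace _)]
  ring

theorem abs_drift_norm_portProj_sq_le (hn₁ : n₁ < n) (hn₂ : n₂ < n) {ε η : ℝ} (hε : 0 ≤ ε)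
    (hε1 : ε ≤ 1) (hη : 0 < η) (q : QueueMatrix n) {s : Schedule n} (hs : s.IsMaximal) :
    |arrivalMean (rate n n₁ n₂ ε) (fun a => ‖portProj n n₁ n₂ (queueVec (nextQueue q a s))‖ ^ 2)
        + 2 * ε / n * ∑ x, queueVec q x
        - (‖portProj n n₁ n₂ (queueVec q)‖ ^ 2 + netVariance n n₁ n₂ ε)|
      ≤ 2 * ε * n * coneDist n₁ n₂ q + arrivalMean (rate n n₁ n₂ ε) (fun a =>
          η * coneDist n₁ n₂ (nextQueue q a s) ^ 2 + (1 / η + 1) * portUnused n₁ n₂ q a s) := by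
  have hn : (n : ℝ) ≠ 0 := by exact_mod_cast (by omega : n ≠ 0)
  have hunused := abs_arrivalMean_le (rate_nonneg (n₁ := n₁) (n₂ := n₂) hε1) (rate_le_one hε hε1)
    fun a => abs_unusedError_le (n₁ := n₁) (n₂ := n₂) hη q a s
  have hsum : |2 * ε / n * (∑ x, portProj n n₁ n₂ (queueVec q) x - ∑ x, queueVec q x)|
      ≤ 2 * ε * n * coneDist n₁ n₂ q := by
    have hscale : 2 * ε / n * (n ^ 2 * coneDist n₁ n₂ q) = 2 * ε * n * coneDist n₁ n₂ q := by
      field_simp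
    rw [abs_mul, abs_of_nonneg (by positivity), ← hscale]
    gcongr
    exact abs_sum_portProj_sub_le q
  rw [arrivalMean_norm_portProj_nextQueue_sq hn₁ hn₂ ε q hs]
  refine (congrArg abs ?_).trans_le ((abs_sub _ _).trans ((add_le_add hunused hsum).trans_eq
    (add_comm _ _)))
  ring

end ProjectionDrift

section RuleKernel

variable {n : ℕ} {rule : QueueMatrix n → PMF (Schedule n)} {lam : Fin n → Fin n → ℝ}

/-- The transition law of the queue lengths when the schedule is drawn from `rule q` at queue
lengths `q`. -/
def ruleKernel (rule : QueueMatrix n → PMF (Schedule n)) (lam : Fin n → Fin n → ℝ)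
    (q : QueueMatrix n) : PMF (QueueMatrix n) :=
  (rule q).bind fun s => (arrivalLaw lam).map fun a => nextQueue q a s

lemma mean_ruleKernel (q : QueueMatrix n) (f : QueueMatrix n → ℝ≥0∞) :
    mean (ruleKernel rule lam q) f
      = mean (rule q) fun s => mean (arrivalLaw lam) fun a => f (nextQueue q a s) := by
  simp only [ruleKernel, mean_bind, mean_map]

lemma mean_ruleKernel_ofReal (h0 : ∀ i j, 0 ≤ lam i j) (h1 : ∀ i j, lam i j ≤ 1)
    {F : QueueMatrix n → ℝ} (hF : ∀ q, 0 ≤ F q) (q : QueueMatrix n) :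
    mean (ruleKernel rule lam q) (fun q => ENNReal.ofReal (F q))
      = mean (rule q) fun s =>
          ENNReal.ofReal (arrivalMean lam fun a => F (nextQueue q a s)) := by
  simp only [mean_ruleKernel, mean_arrivalLaw h0 h1 fun _ => hF _]

lemma queueLaw_eq_bind_kernelPow {P : Policy n} (hP : ∀ h q, P h q = rule q)
    (lam : Fin n → Fin n → ℝ) (init : PMF (QueueMatrix n)) (t : ℕ) :
    queueLaw P lam init t = init.bind (kernelPow (ruleKernel rule lam) t) := by
  induction t with
  | zero =>
    rw [queueLaw, trajectoryLaw, PMF.map_comp]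
    exact (PMF.map_id init).trans (PMF.bind_pure init).symm
  | succ t ih =>
    have hsucc : kernelPow (ruleKernel rule lam) (t + 1)
        = fun x => (kernelPow (ruleKernel rule lam) t x).bind (ruleKernel rule lam) :=
      funext fun x => (kernelPow_bind _ t x).symm
    rw [hsucc, ← PMF.bind_bind, ← ih, queueLaw, queueLaw, trajectoryLaw, PMF.map_bind, PMF.bind_map]
    congr 1
    funext x
    simp only [step, Function.comp_apply, ruleKernel, hP, PMF.map_bind, PMF.map_comp]
    rfl

lemma convergesInLaw_of_le_liminf {P : Policy n} {init π : PMF (QueueMatrix n)}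
    (h : ∀ g : QueueMatrix n → ℝ≥0∞, (∀ q, g q ≤ 1) →
      mean π g ≤ liminf (fun t => mean (queueLaw P lam init t) g) atTop) :
    ConvergesInLaw P lam init π := by
  refine tendsto_of_forall_isOpen_le_liminf' fun G _ => ?_
  have hmeasure (p : PMF (QueueMatrix n)) :
      (toProbabilityMeasure p : Measure (QueueMatrix n)) G = mean p (G.indicator 1) := by
    rw [← lintegral_toMeasure_eq_mean, lintegral_indicator_one MeasurableSet.of_discrete]
    rfl
  simp only [hmeasure]
  exact h _ fun q => Set.indicator_le_self' (fun _ _ => zero_le) q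

theorem mean_ruleKernel_drift (h0 : ∀ i j, 0 ≤ lam i j) (h1 : ∀ i j, lam i j ≤ 1)
    {V f : QueueMatrix n → ℝ} {b : ℝ} (hV : ∀ q, 0 ≤ V q) (hf : ∀ q, 0 ≤ f q) (hb : 0 ≤ b)
    {q : QueueMatrix n}
    (h : ∀ s ∈ (rule q).support,
      arrivalMean lam (fun a => V (nextQueue q a s)) ≤ V q - f q + b) :
    mean (ruleKernel rule lam q) (fun q => ENNReal.ofReal (V q)) + ENNReal.ofReal (f q)
      ≤ ENNReal.ofReal (V q) + ENNReal.ofReal b := by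
  rw [mean_ruleKernel_ofReal h0 h1 hV, ← mean_const (rule q) (ENNReal.ofReal (f q)), ← mean_add,
    ← ENNReal.ofReal_add (hV q) hb, ← mean_const (rule q) (ENNReal.ofReal (V q + b))]
  refine mean_mono_of_support fun s hs => ?_
  have hnonneg : 0 ≤ arrivalMean lam (fun a => V (nextQueue q a s)) := by
    rw [← arrivalMean_const lam 0]
    exact arrivalMean_mono h0 h1 fun a => hV _
  rw [← ENNReal.ofReal_add hnonneg (hf q)]
  exact ENNReal.ofReal_le_ofReal (by linarith [h s hs])

end RuleKernel

section MaxWeight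

variable {n n₁ n₂ : ℕ}

lemma apply_le_weight_permSchedule_swap (q : QueueMatrix n) (i j : Fin n) :
    q i j ≤ (permSchedule (Equiv.swap i j)).weight q := by
  calc q i j = q i j * (permSchedule (Equiv.swap i j)).1 i j := by simp [permSchedule]
    _ ≤ ∑ j', q i j' * (permSchedule (Equiv.swap i j)).1 i j' :=
        Finset.single_le_sum (f := fun j' => q i j' * (permSchedule (Equiv.swap i j)).1 i j')
          (fun _ _ => Nat.zero_le _) (Finset.mem_univ j)
    _ ≤ _ := Finset.single_le_sum
          (f := fun i' => ∑ j', q i' j' * (permSchedule (Equiv.swap i j)).1 i' j')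
          (fun _ _ => Nat.zero_le _) (Finset.mem_univ i)

lemma exists_pos_and_schedule_eq_one {q : QueueMatrix n} {s : Schedule n}
    (hs : ∀ s' : Schedule n, s'.weight q ≤ s.weight q) {i j : Fin n} (hij : 0 < q i j) :
    ∃ i' j', 0 < q i' j' ∧ s.1 i' j' = 1 := by
  have hweight : s.weight q ≠ 0 :=
    (hij.trans_le ((apply_le_weight_permSchedule_swap q i j).trans (hs _))).ne'
  obtain ⟨i', -, hi'⟩ := Finset.exists_ne_zero_of_sum_ne_zero hweight
  obtain ⟨j', -, hij'⟩ := Finset.exists_ne_zero_of_sum_ne_zero hi'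
  obtain ⟨hq, hs'⟩ := mul_ne_zero_iff.1 hij'
  exact ⟨i', j', Nat.pos_of_ne_zero hq, by have := schedule_apply_le_one s i' j'; omega⟩

/-- The total number of packets in the switch. -/
def totalQueue (q : QueueMatrix n) : ℕ := ∑ x : Fin n × Fin n, q x.1 x.2

lemma sum_queueVec (q : QueueMatrix n) : ∑ x, queueVec q x = (totalQueue q : ℝ) := by
  simp [totalQueue]

lemma totalQueue_le_norm (q : QueueMatrix n) : (totalQueue q : ℝ) ≤ n ^ 2 * ‖queueVec q‖ := by
  calc (totalQueue q : ℝ) = ∑ x, queueVec q x := (sum_queueVec q).symm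
    _ ≤ ∑ _x : Fin n × Fin n, ‖queueVec q‖ :=
        Finset.sum_le_sum fun x _ => (le_abs_self _).trans (abs_apply_le_norm _ x)
    _ = _ := by simp [sq]

lemma totalQueue_eq_zero {q : QueueMatrix n} : totalQueue q = 0 ↔ q = 0 := by
  simp [totalQueue, Finset.sum_eq_zero_iff, funext_iff]

lemma totalQueue_nextQueue_le {q : QueueMatrix n} {s : Schedule n}
    (hs : ∀ s' : Schedule n, s'.weight q ≤ s.weight q) :
    totalQueue (nextQueue q (fun _ _ => false) s) ≤ totalQueue q - 1 := by
  have hle (x : Fin n × Fin n) : nextQueue q (fun _ _ => false) s x.1 x.2 ≤ q x.1 x.2 := by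
    simp [nextQueue]
  by_cases h : ∃ i j, 0 < q i j
  · obtain ⟨i, j, hij⟩ := h
    obtain ⟨i', j', hq, hs'⟩ := exists_pos_and_schedule_eq_one hs hij
    refine Nat.le_sub_one_of_lt
      (Finset.sum_lt_sum (fun x _ => hle x) ⟨(i', j'), Finset.mem_univ _, ?_⟩)
    simp only [nextQueue, hs', Bool.toNat_false]
    omega
  · push Not at h
    obtain rfl : q = 0 := funext fun i => funext fun j => Nat.le_zero.1 (h i j)
    exact (Finset.sum_le_sum fun x _ => hle x).trans (by simp)

lemma finite_setOf_norm_queueVec_le (r : ℝ) : {q : QueueMatrix n | ‖queueVec q‖ ≤ r}.Finite := by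
  refine (Set.finite_Iic (fun _ _ => ⌈r⌉₊ : QueueMatrix n)).subset fun q hq i j => ?_
  have hle : (q i j : ℝ) ≤ r :=
    ((le_abs_self _).trans (abs_apply_le_norm (queueVec q) (i, j))).trans hq
  exact_mod_cast hle.trans (Nat.le_ceil r)

/-- The rule picks maximal schedules of maximal weight: `IsMaxWeight P` says that `P` follows such
a rule. -/
def IsMaxWeightRule (rule : QueueMatrix n → PMF (Schedule n)) : Prop :=
  ∀ q, ∀ s ∈ (rule q).support, s.IsMaximal ∧ ∀ s' : Schedule n, s'.weight q ≤ s.weight q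

lemma arrivalWeight_no_arrivals_pos {ε : ℝ} (hε : 0 < ε) (hε1 : ε ≤ 1) :
    0 < arrivalWeight (rate n n₁ n₂ ε) fun _ _ => false := by
  refine Finset.prod_pos fun i _ => Finset.prod_pos fun j _ => ?_
  have := rate_le_one_sub (n₁ := n₁) (n₂ := n₂) hε1 i j
  simp only [Bool.false_eq_true, if_false]
  linarith

variable {rule : QueueMatrix n → PMF (Schedule n)} {ε : ℝ}

lemma mean_ruleKernel_norm_sq_le (hn₁ : n₁ < n) (hn₂ : n₂ < n) (hrule : IsMaxWeightRule rule)
    (hε : 0 ≤ ε) (hε1 : ε ≤ 1) (q : QueueMatrix n) :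
    mean (ruleKernel rule (rate n n₁ n₂ ε) q) (fun q => ENNReal.ofReal (‖queueVec q‖ ^ 2))
        + ENNReal.ofReal (ε / n * ‖queueVec q‖)
      ≤ ENNReal.ofReal (‖queueVec q‖ ^ 2) + ENNReal.ofReal ((n : ℝ) ^ 2) :=
  mean_ruleKernel_drift (V := fun q => ‖queueVec q‖ ^ 2) (f := fun q => ε / n * ‖queueVec q‖)
    (rate_nonneg hε1) (rate_le_one hε hε1) (fun _ => by positivity) (fun _ => by positivity)
    (by positivity) fun s hs => arrivalMean_norm_sq_le hn₁ hn₂ hε hε1 (hrule q s hs).2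

theorem exists_invariant_ruleKernel (hn₁ : n₁ < n) (hn₂ : n₂ < n) (hrule : IsMaxWeightRule rule)
    (hε : 0 < ε) (hε1 : ε ≤ 1) :
    ∃ π : PMF (QueueMatrix n), π.bind (ruleKernel rule (rate n n₁ n₂ ε)) = π := by
  have hn : (0 : ℝ) < n := by exact_mod_cast (by omega : 0 < n)
  refine exists_invariant_of_drift _ ENNReal.ofReal_ne_top (x₀ := 0) ENNReal.ofReal_ne_top
    (mean_ruleKernel_norm_sq_le hn₁ hn₂ hrule hε.le hε1) fun r =>
      (finite_setOf_norm_queueVec_le (r / (ε / n))).subset fun q hq => ?_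
  rw [Set.mem_ofPred_eq, ENNReal.ofReal_le_natCast] at hq
  rw [Set.mem_ofPred_eq, le_div_iff₀ (by positivity), mul_comm]
  exact hq

theorem convergesInLaw_of_invariant (hn₁ : n₁ < n) (hn₂ : n₂ < n) (hrule : IsMaxWeightRule rule)
    (hε : 0 < ε) (hε1 : ε ≤ 1) {P : Policy n} (hP : ∀ h q, P h q = rule q)
    {π : PMF (QueueMatrix n)} (hπ : π.bind (ruleKernel rule (rate n n₁ n₂ ε)) = π)
    (init : PMF (QueueMatrix n)) : ConvergesInLaw P (rate n n₁ n₂ ε) init π := by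
  have hn : (0 : ℝ) < n := by exact_mod_cast (by omega : 0 < n)
  obtain ⟨R, hR⟩ := exists_nat_ge (n ^ 2 * ((2 * (n : ℝ) ^ 2 + 1) / (ε / n)))
  have hsum : 2 * ENNReal.ofReal ((n : ℝ) ^ 2) + 1 = ENNReal.ofReal (2 * (n : ℝ) ^ 2 + 1) := by
    rw [ENNReal.ofReal_add (by positivity) zero_le_one, ENNReal.ofReal_mul zero_le_two,
      ENNReal.ofReal_ofNat, ENNReal.ofReal_one]
  have hlarge (q : QueueMatrix n) : totalQueue q ≤ R ∨
      2 * ENNReal.ofReal ((n : ℝ) ^ 2) + 1 ≤ ENNReal.ofReal (ε / n * ‖queueVec q‖) := by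
    refine (le_or_gt (totalQueue q) R).imp_right fun hq => ?_
    have hRq : (R : ℝ) ≤ totalQueue q := by exact_mod_cast hq.le
    have hnorm :=
      le_of_mul_le_mul_left ((hR.trans hRq).trans (totalQueue_le_norm q)) (by positivity)
    rw [div_le_iff₀' (by positivity)] at hnorm
    exact hsum.trans_le (ENNReal.ofReal_le_ofReal hnorm)
  have hdown (q : QueueMatrix n) :
      ENNReal.ofReal (arrivalWeight (rate n n₁ n₂ ε) fun _ _ => false)
        ≤ mean (ruleKernel rule (rate n n₁ n₂ ε) q)
            fun q' => if totalQueue q' ≤ totalQueue q - 1 then 1 else 0 := by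
    rw [mean_ruleKernel, ← mean_const (rule q) (ENNReal.ofReal _)]
    refine mean_mono_of_support fun s hs => ?_
    rw [← arrivalLaw_apply (rate_nonneg hε1) (rate_le_one hε.le hε1), mean]
    refine le_trans ?_ (ENNReal.le_tsum fun _ _ => false)
    rw [if_pos (totalQueue_nextQueue_le (hrule q s hs).2), mul_one]
  refine convergesInLaw_of_le_liminf fun g hg => ?_
  simp only [queueLaw_eq_bind_kernelPow hP]
  exact mean_le_liminf_of_drift _ ENNReal.ofReal_ne_top (fun _ => ENNReal.ofReal_ne_top)
    (mean_ruleKernel_norm_sq_le hn₁ hn₂ hrule hε.le hε1) hlarge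
    (ENNReal.ofReal_pos.2 (arrivalWeight_no_arrivals_pos hε hε1)).ne' hdown
    (fun x y hx hy => (totalQueue_eq_zero.1 hx).trans (totalQueue_eq_zero.1 hy).symm) hπ init hg

end MaxWeight

section SteadyState

lemma integral_nonneg_of_mean_le {X : Type*} [Countable X] [MeasurableSpace X]
    [DiscreteMeasurableSpace X] {K : X → PMF X} {π : PMF X} (hπ : π.bind K = π) {F R : X → ℝ}
    (hF : Integrable F π.toMeasure) (hR : Integrable R π.toMeasure)
    (h : ∀ x, mean (K x) (fun y => ENNReal.ofReal (F y)) + ENNReal.ofReal (-F x)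
        + ENNReal.ofReal (-R x)
      ≤ ENNReal.ofReal (F x) + ENNReal.ofReal (R x)
        + mean (K x) fun y => ENNReal.ofReal (-F y)) :
    0 ≤ ∫ x, R x ∂π.toMeasure := by
  have hfinite {G : X → ℝ} (hG : Integrable G π.toMeasure) :
      mean π (fun x => ENNReal.ofReal (G x)) ≠ ∞ :=
    lintegral_toMeasure_eq_mean π _ ▸ hG.lintegral_lt_top.ne
  have hstat (G : X → ℝ≥0∞) : mean π (fun x => mean (K x) G) = mean π G := by
    rw [← mean_bind, hπ]
  have hle := mean_mono (p := π) h
  simp only [mean_add, hstat] at hle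
  have hneg : mean π (fun x => ENNReal.ofReal (-R x)) ≤ mean π fun x => ENNReal.ofReal (R x) := by
    refine (ENNReal.add_le_add_iff_left
      (ENNReal.add_ne_top.2 ⟨hfinite hF, hfinite hF.neg⟩)).1 (hle.trans_eq ?_)
    simp only [Pi.neg_apply]
    ring
  rw [integral_eq_lintegral_pos_part_sub_lintegral_neg_part hR, sub_nonneg,
    lintegral_toMeasure_eq_mean, lintegral_toMeasure_eq_mean]
  exact ENNReal.toReal_mono (hfinite hR) hneg

variable {n : ℕ} {rule : QueueMatrix n → PMF (Schedule n)} {lam : Fin n → Fin n → ℝ}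
  {π : PMF (QueueMatrix n)}

theorem integral_nonneg_of_drift (h0 : ∀ i j, 0 ≤ lam i j) (h1 : ∀ i j, lam i j ≤ 1)
    (hπ : π.bind (ruleKernel rule lam) = π) {F R : QueueMatrix n → ℝ}
    (hF : Integrable F π.toMeasure) (hR : Integrable R π.toMeasure)
    (h : ∀ q, ∀ s ∈ (rule q).support,
      arrivalMean lam (fun a => F (nextQueue q a s)) ≤ F q + R q) :
    0 ≤ ∫ q, R q ∂π.toMeasure := by
  refine integral_nonneg_of_mean_le hπ hF hR fun q => ?_
  have hmean (G : QueueMatrix n → ℝ) :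
      mean (ruleKernel rule lam q) (fun q => ENNReal.ofReal (G q))
        = mean (rule q) fun s =>
            ENNReal.ofReal (arrivalMean lam fun a => max (G (nextQueue q a s)) 0) := by
    rw [← mean_ruleKernel_ofReal h0 h1 (F := fun q => max (G q) 0) fun _ => le_max_right _ _]
    simp
  have hnonneg (G : QueueMatrix n → ℝ) (s : Schedule n) :
      0 ≤ arrivalMean lam fun a => max (G (nextQueue q a s)) 0 :=
    (arrivalMean_const lam 0).symm.trans_le (arrivalMean_mono h0 h1 fun a => le_max_right _ _)
  have hofReal (x : ℝ) : ENNReal.ofReal x = ENNReal.ofReal (max x 0) := by simp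
  rw [hmean F, hmean fun q => -F q]
  calc _ = mean (rule q) fun s =>
        ENNReal.ofReal (arrivalMean lam fun a => max (F (nextQueue q a s)) 0)
          + ENNReal.ofReal (-F q) + ENNReal.ofReal (-R q) := by simp only [mean_add, mean_const]
    _ ≤ mean (rule q) fun s => ENNReal.ofReal (F q) + ENNReal.ofReal (R q)
          + ENNReal.ofReal (arrivalMean lam fun a => max (-F (nextQueue q a s)) 0) := by
        refine mean_mono_of_support fun s hs => ?_
        rw [hofReal (F q), hofReal (R q), hofReal (-F q), hofReal (-R q),
          ← ENNReal.ofReal_add (hnonneg F s) (le_max_right _ _),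
          ← ENNReal.ofReal_add (le_max_right _ _) (le_max_right _ _),
          ← ENNReal.ofReal_add (add_nonneg (hnonneg F s) (le_max_right _ _)) (le_max_right _ _),
          ← ENNReal.ofReal_add (add_nonneg (le_max_right _ _) (le_max_right _ _))
            (hnonneg (fun q => -F q) s)]
        have hsplit : (fun a => F (nextQueue q a s)) = (fun a => max (F (nextQueue q a s)) 0)
            - fun a => max (-F (nextQueue q a s)) 0 :=
          funext fun a => (max_zero_sub_max_neg_zero_eq_self _).symm
        have hdrift := h q s hs
        rw [hsplit, map_sub] at hdrift
        refine ENNReal.ofReal_le_ofReal ?_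
        linarith [max_zero_sub_max_neg_zero_eq_self (F q), max_zero_sub_max_neg_zero_eq_self (R q)]
    _ = _ := by simp only [mean_add, mean_const]

theorem integrable_and_integral_le_of_drift (h0 : ∀ i j, 0 ≤ lam i j) (h1 : ∀ i j, lam i j ≤ 1)
    (hπ : π.bind (ruleKernel rule lam) = π) {V f : QueueMatrix n → ℝ} {b : ℝ}
    (hV : ∀ q, 0 ≤ V q) (hf : ∀ q, 0 ≤ f q) (hb : 0 ≤ b)
    (h : ∀ q, ∀ s ∈ (rule q).support,
      arrivalMean lam (fun a => V (nextQueue q a s)) ≤ V q - f q + b) :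
    Integrable f π.toMeasure ∧ ∫ q, f q ∂π.toMeasure ≤ b := by
  have hle : ∫⁻ q, ENNReal.ofReal (f q) ∂π.toMeasure ≤ ENNReal.ofReal b := by
    rw [lintegral_toMeasure_eq_mean]
    exact mean_le_of_drift_of_invariant _ hπ (fun _ => ENNReal.ofReal_ne_top)
      fun q => mean_ruleKernel_drift h0 h1 hV hf hb (h q)
  have hint : Integrable f π.toMeasure :=
    (lintegral_ofReal_ne_top_iff_integrable (measurable_of_countable f).aestronglyMeasurable
      (ae_of_all _ hf)).1 (ne_top_of_le_ne_top ENNReal.ofReal_ne_top hle)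
  refine ⟨hint, (ENNReal.ofReal_le_ofReal_iff hb).1 ?_⟩
  rwa [ofReal_integral_eq_lintegral_ofReal hint (ae_of_all _ hf)]

theorem integrable_and_integral_sq_le_of_sq_drift (h0 : ∀ i j, 0 ≤ lam i j)
    (h1 : ∀ i j, lam i j ≤ 1) (hπ : π.bind (ruleKernel rule lam) = π) {f : QueueMatrix n → ℝ}
    {B C δ : ℝ} (hf : ∀ q, 0 ≤ f q) (hB : 0 ≤ B) (hδ : 0 < δ)
    (hstep : ∀ q a s, |f (nextQueue q a s) - f q| ≤ B)
    (h : ∀ q, ∀ s ∈ (rule q).support,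
      arrivalMean lam (fun a => f (nextQueue q a s) ^ 2) ≤ f q ^ 2 - δ * f q + C) :
    Integrable (fun q => f q ^ 2) π.toMeasure ∧
      ∫ q, f q ^ 2 ∂π.toMeasure ≤ ((3 / 2 * (C + B ^ 2)) ^ 2 / (2 * δ) + B ^ 3) / δ := by
  obtain ⟨hint, hle⟩ := integrable_and_integral_le_of_drift h0 h1 hπ (V := fun q => f q ^ 3)
    (f := fun q => δ * f q ^ 2) (b := (3 / 2 * (C + B ^ 2)) ^ 2 / (2 * δ) + B ^ 3)
    (fun q => pow_nonneg (hf q) 3) (fun q => by positivity) (by positivity) fun q s hs =>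
      arrivalMean_pow_three_le h0 h1 (hf q) hδ (fun a => hstep q a s) (h q s hs)
  refine ⟨(integrable_const_mul_iff hδ.ne'.isUnit _).1 hint, ?_⟩
  rwa [integral_const_mul, ← le_div_iff₀' hδ] at hle

variable {n₁ n₂ : ℕ} {ε : ℝ}

lemma memLp_two_queueVec (hn₁ : n₁ < n) (hn₂ : n₂ < n) (hrule : IsMaxWeightRule rule)
    (hε : 0 < ε) (hε1 : ε ≤ 1) (hπ : π.bind (ruleKernel rule (rate n n₁ n₂ ε)) = π) :
    MemLp queueVec 2 π.toMeasure := by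
  have hn : (0 : ℝ) < n := by exact_mod_cast (by omega : 0 < n)
  rw [memLp_two_iff_integrable_sq_norm (measurable_of_countable _).aestronglyMeasurable]
  exact (integrable_and_integral_sq_le_of_sq_drift (rate_nonneg hε1) (rate_le_one hε.le hε1) hπ
    (f := fun q => ‖queueVec q‖) (fun q => norm_nonneg _) n.cast_nonneg
    (by positivity : 0 < ε / n)
    (fun q a s => (abs_norm_sub_norm_le _ _).trans (norm_queueVec_nextQueue_sub_le q a s))
    fun q s hs => arrivalMean_norm_sq_le hn₁ hn₂ hε.le hε1 (hrule q s hs).2).1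

/-- A bound on the second moment, in the steady state of MaxWeight, of the distance of the queue
vector to the port cone. That it does not depend on `ε` is state space collapse. -/
def collapseBound (n : ℕ) : ℝ :=
  ((3 / 2 * ((n : ℝ) ^ 2 + (n : ℝ) ^ 2)) ^ 2 / (2 * (1 / (2 * n ^ 2))) + (n : ℝ) ^ 3)
    / (1 / (2 * n ^ 2))

lemma one_div_four_mul_sq_le_one (hn : 0 < n) : 1 / (4 * (n : ℝ) ^ 2) ≤ 1 := by
  have : (1 : ℝ) ≤ n := by exact_mod_cast hn
  exact (div_le_one (by positivity)).2 (by nlinarith)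

theorem integrable_and_integral_coneDist_sq_le (hn₁ : n₁ < n) (hn₂ : n₂ < n)
    (hrule : IsMaxWeightRule rule) (hε : 0 ≤ ε) (hε1 : ε ≤ 1 / (4 * n ^ 2))
    (hπ : π.bind (ruleKernel rule (rate n n₁ n₂ ε)) = π) :
    Integrable (fun q => coneDist n₁ n₂ q ^ 2) π.toMeasure ∧
      ∫ q, coneDist n₁ n₂ q ^ 2 ∂π.toMeasure ≤ collapseBound n := by
  have hn : 0 < n := by omega
  have hε2 := hε1.trans (one_div_four_mul_sq_le_one hn)
  exact integrable_and_integral_sq_le_of_sq_drift (rate_nonneg hε2) (rate_le_one hε hε2) hπ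
    coneDist_nonneg n.cast_nonneg (by positivity) (fun q a s => abs_coneDist_nextQueue_sub_le q a s)
    fun q s hs => arrivalMean_coneDist_sq_le hn₁ hn₂ hε hε1 (hrule q s hs).1 (hrule q s hs).2

end SteadyState

section HeavyTraffic

variable {n n₁ n₂ : ℕ} {ε : ℝ}

lemma arrivalMean_signed_norm_portProj_sq_sub_le (hn₁ : n₁ < n) (hn₂ : n₂ < n) {η σ : ℝ}
    (hε : 0 ≤ ε) (hε1 : ε ≤ 1) (hη : 0 < η) (hσ : |σ| ≤ 1) (q : QueueMatrix n) {s : Schedule n}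
    (hs : s.IsMaximal) :
    arrivalMean (rate n n₁ n₂ ε) (fun a =>
        σ * ‖portProj n n₁ n₂ (queueVec (nextQueue q a s))‖ ^ 2
          - η * coneDist n₁ n₂ (nextQueue q a s) ^ 2
          - (1 / η + 1) * inner ℝ (portSum n n₁ n₂) (queueVec (nextQueue q a s)))
      ≤ σ * ‖portProj n n₁ n₂ (queueVec q)‖ ^ 2 - η * coneDist n₁ n₂ q ^ 2
          - (1 / η + 1) * inner ℝ (portSum n n₁ n₂) (queueVec q)
        + ((η + ε * n) * coneDist n₁ n₂ q ^ 2
          + (ε * n + (1 / η + 1) * (ε * (n₁ + n₂)) + σ * netVariance n n₁ n₂ ε)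
          - σ * (2 * ε / n * totalQueue q)) := by
  set A := arrivalMean (rate n n₁ n₂ ε)
  set U := fun a => portUnused n₁ n₂ q a s
  set D := fun a => coneDist n₁ n₂ (nextQueue q a s) ^ 2
  set N := fun a => ‖portProj n n₁ n₂ (queueVec (nextQueue q a s))‖ ^ 2
  set L := fun a => inner ℝ (portSum n n₁ n₂) (queueVec (nextQueue q a s))
  have hunused : inner ℝ (portSum n n₁ n₂) (queueVec q) + A U = A L + ε * (n₁ + n₂) :=
    inner_portSum_add_arrivalMean_portUnused hn₁ hn₂ ε q hs
  have hdrift := abs_drift_norm_portProj_sq_le hn₁ hn₂ hε hε1 hη q hs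
  rw [sum_queueVec] at hdrift
  have hsign := (le_abs_self _).trans ((abs_mul σ _).le.trans
    ((mul_le_of_le_one_left (abs_nonneg _) hσ).trans hdrift))
  have herror : A (fun a => η * D a + (1 / η + 1) * U a) = η * A D + (1 / η + 1) * A U := by
    rw [← smul_eq_mul η, ← smul_eq_mul (1 / η + 1), ← map_smul, ← map_smul, ← map_add]
    rfl
  have hlhs : A (fun a => σ * N a - η * D a - (1 / η + 1) * L a)
      = σ * A N - η * A D - (1 / η + 1) * A L := by
    rw [← smul_eq_mul σ, ← smul_eq_mul η, ← smul_eq_mul (1 / η + 1), ← map_smul, ← map_smul,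
      ← map_smul, ← map_sub, ← map_sub]
    rfl
  have hdist : 0 ≤ ε * n * (coneDist n₁ n₂ q - 1) ^ 2 := by positivity
  rw [hlhs]
  rw [herror] at hsign
  linear_combination hsign + hdist + (1 / η + 1) * hunused

variable {rule : QueueMatrix n → PMF (Schedule n)} {π : PMF (QueueMatrix n)}

lemma integrable_totalQueue (h : Integrable queueVec π.toMeasure) :
    Integrable (fun q => (totalQueue q : ℝ)) π.toMeasure :=
  (h.norm.const_mul ((n : ℝ) ^ 2)).mono' (measurable_of_countable _).aestronglyMeasurable
    (ae_of_all _ fun q => by simpa using totalQueue_le_norm q)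

lemma meanTotal_eq_ofReal_integral (h : Integrable queueVec π.toMeasure) :
    meanTotal π = ENNReal.ofReal (∫ q, (totalQueue q : ℝ) ∂π.toMeasure) := by
  rw [ofReal_integral_eq_lintegral_ofReal (integrable_totalQueue h)
    (ae_of_all _ fun q => Nat.cast_nonneg _), meanTotal]
  refine lintegral_congr fun q => ?_
  rw [ENNReal.ofReal_natCast, totalQueue, Fintype.sum_prod_type]
  push_cast
  rfl

lemma integrable_norm_portProj_sq (h : MemLp queueVec 2 π.toMeasure) :
    Integrable (fun q => ‖portProj n n₁ n₂ (queueVec q)‖ ^ 2) π.toMeasure :=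
  h.integrable_norm_pow two_ne_zero |>.mono' (measurable_of_countable _).aestronglyMeasurable
    (ae_of_all _ fun q => by
      rw [Real.norm_of_nonneg (sq_nonneg _)]
      exact pow_le_pow_left₀ (norm_nonneg _) (Submodule.norm_starProjection_apply_le _ _) 2)

theorem abs_integral_totalQueue_sub_netVariance_le (hn₁ : n₁ < n) (hn₂ : n₂ < n)
    (hrule : IsMaxWeightRule rule) {η : ℝ} (hη : 0 < η) (hε : 0 < ε) (hε1 : ε ≤ 1 / (4 * n ^ 2))
    (hπ : π.bind (ruleKernel rule (rate n n₁ n₂ ε)) = π) :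
    |2 * ε / n * (∫ q, (totalQueue q : ℝ) ∂π.toMeasure) - netVariance n n₁ n₂ ε|
      ≤ (η + ε * n) * collapseBound n + ε * n + (1 / η + 1) * (ε * (n₁ + n₂)) := by
  have hε2 := hε1.trans (one_div_four_mul_sq_le_one (by omega : 0 < n))
  have hqueue := memLp_two_queueVec hn₁ hn₂ hrule hε hε2 hπ
  have htotal := integrable_totalQueue (hqueue.integrable one_le_two)
  have hproj := integrable_norm_portProj_sq (n₁ := n₁) (n₂ := n₂) hqueue
  have hsum := (hqueue.integrable one_le_two).const_inner (𝕜 := ℝ) (portSum n n₁ n₂)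
  obtain ⟨hdist, hcollapse⟩ := integrable_and_integral_coneDist_sq_le hn₁ hn₂ hrule hε.le hε1 hπ
  have hsigned {σ : ℝ} (hσ : |σ| ≤ 1) :
      σ * (2 * ε / n * (∫ q, (totalQueue q : ℝ) ∂π.toMeasure) - netVariance n n₁ n₂ ε)
        ≤ (η + ε * n) * collapseBound n + ε * n + (1 / η + 1) * (ε * (n₁ + n₂)) := by
    have hint := (hdist.const_mul (η + ε * n)).add (integrable_const
      (ε * n + (1 / η + 1) * (ε * (n₁ + n₂)) + σ * netVariance n n₁ n₂ ε))
    have hnonneg := integral_nonneg_of_drift (rate_nonneg hε2) (rate_le_one hε.le hε2) hπ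
      (((hproj.const_mul σ).sub (hdist.const_mul η)).sub (hsum.const_mul (1 / η + 1)))
      (hint.sub ((htotal.const_mul (2 * ε / n)).const_mul σ)) fun q s hs =>
        arrivalMean_signed_norm_portProj_sq_sub_le hn₁ hn₂ hε.le hε2 hη hσ q (hrule q s hs).1
    have hintegral := integral_sub hint ((htotal.const_mul (2 * ε / n)).const_mul σ)
    have hintegral_add := integral_add (hdist.const_mul (η + ε * n)) (integrable_const
      (μ := π.toMeasure) (ε * n + (1 / η + 1) * (ε * (n₁ + n₂)) + σ * netVariance n n₁ n₂ ε))
    simp only [Pi.sub_apply, Pi.add_apply] at hnonneg hintegral hintegral_add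
    rw [hintegral, hintegral_add, integral_const_mul, integral_const_mul, integral_const_mul,
      integral_const, probReal_univ, one_smul] at hnonneg
    have := mul_le_mul_of_nonneg_left hcollapse (by positivity : 0 ≤ η + ε * n)
    linarith
  refine abs_le.2 ⟨?_, ?_⟩
  · linarith [hsigned (σ := -1) (by simp)]
  · linarith [hsigned (σ := 1) (by simp)]

lemma continuous_netVariance (n n₁ n₂ : ℕ) : Continuous (netVariance n n₁ n₂) := by
  unfold netVariance satVariance
  fun_prop

-- The choice `η = √ε` balances the errors `η * collapseBound n` and `ε / η * (n₁ + n₂)`.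
lemma tendsto_two_mul_div_mul_integral_totalQueue (hn₁ : n₁ < n) (hn₂ : n₂ < n)
    (hrule : IsMaxWeightRule rule) {π : ℝ → PMF (QueueMatrix n)}
    (hπ : ∀ᶠ ε in 𝓝[>] 0, (π ε).bind (ruleKernel rule (rate n n₁ n₂ ε)) = π ε) :
    Tendsto (fun ε => 2 * ε / n * ∫ q, (totalQueue q : ℝ) ∂(π ε).toMeasure) (𝓝[>] 0)
      (𝓝 ((n₁ + n₂) / n * (1 - 1 / n))) := by
  have hn : (0 : ℝ) < n := by exact_mod_cast (by omega : 0 < n)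
  have herror : Tendsto (fun ε : ℝ => (√ε + ε * n) * collapseBound n + ε * n
      + (√ε + ε) * (n₁ + n₂)) (𝓝[>] 0) (𝓝 0) := by
    refine ((Continuous.tendsto ?_ 0).mono_left nhdsWithin_le_nhds).trans_eq ?_
    · fun_prop
    · simp
  have hvariance : Tendsto (netVariance n n₁ n₂) (𝓝[>] 0) (𝓝 ((n₁ + n₂) / n * (1 - 1 / n))) := by
    refine (((continuous_netVariance n n₁ n₂).tendsto 0).mono_left nhdsWithin_le_nhds).trans_eq ?_
    congr 1
    simp only [netVariance, satVariance]
    ring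
  have hdiff : Tendsto (fun ε => 2 * ε / n * (∫ q, (totalQueue q : ℝ) ∂(π ε).toMeasure)
      - netVariance n n₁ n₂ ε) (𝓝[>] 0) (𝓝 0) := by
    refine squeeze_zero_norm' ?_ herror
    filter_upwards [self_mem_nhdsWithin, hπ,
      Ioo_mem_nhdsGT (by positivity : (0 : ℝ) < 1 / (4 * n ^ 2))] with ε hε hinv hsmall
    refine (abs_integral_totalQueue_sub_netVariance_le hn₁ hn₂ hrule (Real.sqrt_pos.2 hε) hε
      hsmall.2.le hinv).trans_eq ?_
    have hsqrt : 1 / √ε * ε = √ε := by rw [one_div_mul_eq_div, Real.div_sqrt]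
    linear_combination (n₁ + n₂ : ℝ) * hsqrt
  simpa using hdiff.add hvariance

theorem tendsto_ofReal_mul_meanTotal (hn₁ : n₁ < n) (hn₂ : n₂ < n)
    (hrule : IsMaxWeightRule rule) {π : ℝ → PMF (QueueMatrix n)}
    (hπ : ∀ ε ∈ Set.Ioo (0 : ℝ) 1, (π ε).bind (ruleKernel rule (rate n n₁ n₂ ε)) = π ε) :
    Tendsto (fun ε => ENNReal.ofReal ε * meanTotal (π ε)) (𝓝[>] 0)
      (𝓝 (ENNReal.ofReal (((n₁ : ℝ) + n₂) / 2 * (1 - 1 / n)))) := by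
  have hn : (n : ℝ) ≠ 0 := by exact_mod_cast (by omega : n ≠ 0)
  have hunit : ∀ᶠ ε : ℝ in 𝓝[>] 0, ε ∈ Set.Ioo (0 : ℝ) 1 := Ioo_mem_nhdsGT one_pos
  have hlim := ENNReal.tendsto_ofReal
    ((tendsto_two_mul_div_mul_integral_totalQueue hn₁ hn₂ hrule (hunit.mono hπ)).const_mul
      ((n : ℝ) / 2))
  rw [show (n : ℝ) / 2 * ((n₁ + n₂) / n * (1 - 1 / n)) = (n₁ + n₂) / 2 * (1 - 1 / n) by
    field_simp] at hlim
  refine hlim.congr' ?_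
  filter_upwards [hunit] with ε hε
  rw [meanTotal_eq_ofReal_integral ((memLp_two_queueVec hn₁ hn₂ hrule hε.1 hε.2.le
    (hπ ε hε)).integrable one_le_two), ← ENNReal.ofReal_mul hε.1.le]
  congr 1
  field_simp

end HeavyTraffic

section LowerBound

variable {n n₁ n₂ : ℕ}

theorem sum_le_meanTotal {ι : Type*} [Fintype ι] {C : ι → Finset (Fin n × Fin n)}
    (hdisj : Pairwise fun k l => Disjoint (C k) (C l))
    (hC : ∀ k (s : Schedule n), ∑ x ∈ C k, s.1 x.1 x.2 ≤ 1)
    {lam : Fin n → Fin n → ℝ} (h0 : ∀ i j, 0 ≤ lam i j) (h1 : ∀ i j, lam i j ≤ 1)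
    {ε : ℝ} (hε : 0 < ε) (hload : ∀ k, ∑ x ∈ C k, lam x.1 x.2 = 1 - ε)
    {P : Policy n} {init π : PMF (QueueMatrix n)} (hπ : ConvergesInLaw P lam init π) :
    ∑ k, ENNReal.ofReal ((portVariance lam (C k) - ε * (1 - ε)) / (2 * ε)) ≤ meanTotal π := by
  classical
  calc _ ≤ ∑ k, mean π fun q => (portQueue (C k) q : ℝ≥0∞) :=
        Finset.sum_le_sum fun k _ => le_mean_portQueue h0 h1 (hC k) hε (hload k) hπ
    _ = mean π fun q => ∑ k, (portQueue (C k) q : ℝ≥0∞) := (mean_finsetSum _ _ _).symm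
    _ ≤ mean π fun q => ∑ i, ∑ j, (q i j : ℝ≥0∞) := by
        refine mean_mono fun q => ?_
        simp only [portQueue, Nat.cast_sum]
        rw [← Finset.sum_biUnion fun k _ l _ hkl => hdisj hkl, ← Fintype.sum_prod_type']
        exact Finset.sum_le_sum_of_subset (Finset.subset_univ _)
    _ = meanTotal π := (meanTotal_eq_mean π).symm

lemma le_ofReal_mul_meanTotal_of_saturated {ι : Type*} [Fintype ι]
    {C : ι → Finset (Fin n × Fin n)} (hdisj : Pairwise fun k l => Disjoint (C k) (C l))
    (hC : ∀ k (s : Schedule n), ∑ x ∈ C k, s.1 x.1 x.2 ≤ 1) (hcard : ∀ k, (C k).card = n)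
    (hsat : ∀ k, ∀ x ∈ C k, x.1.val < n₁ ∨ x.2.val < n₂) (hn : 0 < n) {ε : ℝ} (hε : 0 < ε)
    (hε1 : ε ≤ 1) {P : Policy n} {init π : PMF (QueueMatrix n)}
    (hπ : ConvergesInLaw P (rate n n₁ n₂ ε) init π) :
    ENNReal.ofReal (Fintype.card ι * ((n * satVariance n ε - ε * (1 - ε)) / 2))
      ≤ ENNReal.ofReal ε * meanTotal π := by
  have hn' : (n : ℝ) ≠ 0 := by positivity
  have hload (k) : ∑ x ∈ C k, rate n n₁ n₂ ε x.1 x.2 = 1 - ε := by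
    rw [Finset.sum_congr rfl fun x hx => rate_of_saturated (hsat k x hx), Finset.sum_const,
      hcard, nsmul_eq_mul, mul_div_cancel₀ _ hn']
  have hvariance (k) : portVariance (rate n n₁ n₂ ε) (C k) = n * satVariance n ε := by
    rw [portVariance, Finset.sum_congr rfl fun x hx => by rw [rate_of_saturated (hsat k x hx)],
      Finset.sum_const, hcard, nsmul_eq_mul, satVariance]
  have hsum := sum_le_meanTotal hdisj hC (rate_nonneg hε1) (rate_le_one hε.le hε1) hε hload hπ
  simp only [hvariance, Finset.sum_const, Finset.card_univ, nsmul_eq_mul] at hsum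
  refine le_trans (le_of_eq ?_) (mul_le_mul_right hsum _)
  rw [ENNReal.ofReal_mul (Nat.cast_nonneg _), ENNReal.ofReal_natCast, mul_left_comm,
    ← ENNReal.ofReal_mul hε.le]
  congr 2
  field_simp

lemma le_ofReal_mul_meanTotal_of_rows (hn₁ : n₁ < n) {ε : ℝ} (hε : 0 < ε) (hε1 : ε ≤ 1)
    {P : Policy n} {init π : PMF (QueueMatrix n)}
    (hπ : ConvergesInLaw P (rate n n₁ n₂ ε) init π) :
    ENNReal.ofReal (n₁ * ((n * satVariance n ε - ε * (1 - ε)) / 2))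
      ≤ ENNReal.ofReal ε * meanTotal π := by
  have hrows := le_ofReal_mul_meanTotal_of_saturated
    (C := fun i : {i : Fin n // i.val < n₁} => {i.1} ×ˢ Finset.univ)
    (fun i k hik => Finset.disjoint_product.2 <| .inl <| Finset.disjoint_singleton.2 <|
      Subtype.coe_ne_coe.2 hik)
    (fun i s => by simpa [Finset.sum_product] using s.2.1 i.1) (fun i => by simp)
    (fun i x hx => .inl (Finset.mem_singleton.1 (Finset.mem_product.1 hx).1 ▸ i.2))
    (by omega) hε hε1 hπ
  rwa [card_fin_val_lt hn₁.le] at hrows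

lemma le_ofReal_mul_meanTotal_of_cols (hn₂ : n₂ < n) {ε : ℝ} (hε : 0 < ε) (hε1 : ε ≤ 1)
    {P : Policy n} {init π : PMF (QueueMatrix n)}
    (hπ : ConvergesInLaw P (rate n n₁ n₂ ε) init π) :
    ENNReal.ofReal (n₂ * ((n * satVariance n ε - ε * (1 - ε)) / 2))
      ≤ ENNReal.ofReal ε * meanTotal π := by
  have hcols := le_ofReal_mul_meanTotal_of_saturated
    (C := fun j : {j : Fin n // j.val < n₂} => Finset.univ ×ˢ {j.1})
    (fun j k hjk => Finset.disjoint_product.2 <| .inr <| Finset.disjoint_singleton.2 <|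
      Subtype.coe_ne_coe.2 hjk)
    (fun j s => by simpa [Finset.sum_product_right] using s.2.2 j.1) (fun j => by simp)
    (fun j x hx => .inr (Finset.mem_singleton.1 (Finset.mem_product.1 hx).2 ▸ j.2))
    (by omega) hε hε1 hπ
  rwa [card_fin_val_lt hn₂.le] at hcols

lemma le_liminf_of_le_satVariance (hn : 0 < n) {m : ℕ} {F : ℝ → ℝ≥0∞}
    (h : ∀ ε ∈ Set.Ioo (0 : ℝ) 1,
      ENNReal.ofReal (m * ((n * satVariance n ε - ε * (1 - ε)) / 2)) ≤ F ε) :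
    ENNReal.ofReal ((m : ℝ) / 2 * (1 - 1 / n)) ≤ liminf F (𝓝[>] 0) := by
  have hn' : (n : ℝ) ≠ 0 := by positivity
  have hcont : Continuous fun ε : ℝ => (m : ℝ) * ((n * satVariance n ε - ε * (1 - ε)) / 2) := by
    unfold satVariance
    fun_prop
  have hlim := ENNReal.tendsto_ofReal ((hcont.tendsto 0).mono_left (nhdsWithin_le_nhds
    (s := Set.Ioi 0)))
  have hvalue : (m : ℝ) * ((n * satVariance n 0 - 0 * (1 - 0)) / 2) = m / 2 * (1 - 1 / n) := by
    unfold satVariance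
    field_simp
    ring
  rw [← hvalue, ← hlim.liminf_eq]
  exact liminf_le_liminf (mem_of_superset (Ioo_mem_nhdsGT one_pos) h)

theorem max_le_liminf_meanTotal (hn₁ : n₁ < n) (hn₂ : n₂ < n) {P : ℝ → Policy n}
    {init π : ℝ → PMF (QueueMatrix n)}
    (h : ∀ ε ∈ Set.Ioo (0 : ℝ) 1, ConvergesInLaw (P ε) (rate n n₁ n₂ ε) (init ε) (π ε)) :
    ENNReal.ofReal ((max n₁ n₂ : ℝ) / 2 * (1 - 1 / n))
      ≤ liminf (fun ε : ℝ => ENNReal.ofReal ε * meanTotal (π ε)) (𝓝[>] 0) := by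
  have hn : 0 < n := by omega
  rcases max_choice (n₁ : ℝ) n₂ with hmax | hmax <;> rw [hmax]
  · exact le_liminf_of_le_satVariance hn fun ε hε =>
      le_ofReal_mul_meanTotal_of_rows hn₁ hε.1 hε.2.le (h ε hε)
  · exact le_liminf_of_le_satVariance hn fun ε hε =>
      le_ofReal_mul_meanTotal_of_cols hn₂ hε.1 hε.2.le (h ε hε)

lemma ofReal_add_div_two_mul_le (hn : 0 < n) (a b : ℝ) :
    ENNReal.ofReal ((a + b) / 2 * (1 - 1 / n))
      ≤ 2 * ENNReal.ofReal (max a b / 2 * (1 - 1 / n)) := by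
  rw [← ENNReal.ofReal_ofNat, ← ENNReal.ofReal_mul (by norm_num), ← mul_assoc]
  have hn' : (1 : ℝ) ≤ n := by exact_mod_cast hn
  have hfactor : 0 ≤ 1 - 1 / (n : ℝ) := sub_nonneg.2 ((div_le_one (by linarith)).2 hn')
  refine ENNReal.ofReal_le_ofReal (mul_le_mul_of_nonneg_right ?_ hfactor)
  linarith [le_max_left a b, le_max_right a b]

end LowerBound

end

end SwitchModel

theorem mainTheorem7 (n n₁ n₂ : ℕ) (hn₁ : n₁ < n) (hn₂ : n₂ < n)
    (MW : Policy n) (hMW : IsMaxWeight MW) :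
    ∃ qbar : ℝ → PMF (QueueMatrix n),
      -- under MaxWeight every system has a unique steady state, reached from every initial law
      (∀ ε ∈ Set.Ioo (0 : ℝ) 1,
        (∀ t, queueLaw MW (rate n n₁ n₂ ε) (qbar ε) t = qbar ε) ∧
        ∀ init, ConvergesInLaw MW (rate n n₁ n₂ ε) init (qbar ε)) ∧
      -- its heavy-traffic limit
      Tendsto (fun ε : ℝ => ENNReal.ofReal ε * meanTotal (qbar ε)) (𝓝[>] 0)
        (𝓝 (ENNReal.ofReal (((n₁ : ℝ) + n₂) / 2 * (1 - 1 / n)))) ∧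
      -- any stable policy (which may depend on `ε`), and the comparison with MaxWeight
      ∀ (P : ℝ → Policy n) (init π : ℝ → PMF (QueueMatrix n)),
        (∀ ε ∈ Set.Ioo (0 : ℝ) 1, ConvergesInLaw (P ε) (rate n n₁ n₂ ε) (init ε) (π ε)) →
        ENNReal.ofReal ((max n₁ n₂ : ℝ) / 2 * (1 - 1 / n)) ≤
            liminf (fun ε : ℝ => ENNReal.ofReal ε * meanTotal (π ε)) (𝓝[>] 0) ∧
          limsup (fun ε : ℝ => ENNReal.ofReal ε * meanTotal (qbar ε)) (𝓝[>] 0) ≤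
            2 * liminf (fun ε : ℝ => ENNReal.ofReal ε * meanTotal (π ε)) (𝓝[>] 0) := by
  obtain ⟨rule, hP, hrule⟩ := hMW
  have hexists (ε : ℝ) : ∃ π : PMF (QueueMatrix n), ε ∈ Set.Ioo (0 : ℝ) 1 →
      π.bind (ruleKernel rule (rate n n₁ n₂ ε)) = π := by
    by_cases hε : ε ∈ Set.Ioo (0 : ℝ) 1
    · exact (exists_invariant_ruleKernel hn₁ hn₂ hrule hε.1 hε.2.le).imp fun _ h _ => h
    · exact ⟨PMF.pure 0, fun h => absurd h hε⟩
  choose qbar hinv using hexists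
  have hlim := tendsto_ofReal_mul_meanTotal hn₁ hn₂ hrule hinv
  refine ⟨qbar, fun ε hε => ⟨fun t => ?_, fun init => ?_⟩, hlim, fun P init π hπ => ?_⟩
  · rw [queueLaw_eq_bind_kernelPow hP, bind_kernelPow_of_invariant _ (hinv ε hε)]
  · exact convergesInLaw_of_invariant hn₁ hn₂ hrule hε.1 hε.2.le hP (hinv ε hε) init
  · have hlower := max_le_liminf_meanTotal hn₁ hn₂ hπ
    refine ⟨hlower, hlim.limsup_eq.trans_le ?_⟩
    exact (ofReal_add_div_two_mul_le (by omega) _ _).trans (mul_le_mul_right hlower 2)
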